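/- **Setting.** Let $I=(0,1]$ and let $\rho=(\rho_\varepsilon)_{\varepsilon\in I}$ be a gauge, i.e. a non-decreasing net in $(0,1]$ with $\rho_\varepsilon\to0$ as $\varepsilon\to0^+$. A net $(x_\varepsilon)$ in a normed space is *moderate* if $\exists N\in\mathbb N:\ |x_\varepsilon|\le\rho_\varepsilon^{-N}$ for $\varepsilon$ small, and *negligible* if $\forall n\in\mathbb N:\ |x_\varepsilon|\le\rho_\varepsilon^{n}$ for $\varepsilon$ small. Let $\widetilde{\mathbb R}$ be the ring of moderate nets in $\mathbb R$ modulo negligible nets, so that $\widetilde{\mathbb R}^n$ is the set of classes $[x_\varepsilon]$ of moderate nets in $\mathbb R^n$. Write $x\le y$ if $x=[x_\varepsilon]$, $y=[y_\varepsilon]$ for some representatives with $x_\varepsilon\le y_\varepsilon$ for all $\varepsilon$; write $x<y$ if $x\le y$ and $x-y$ is invertible; $[a,b]=\{x: a\le x\le b\}$. A set $U\subseteq\widetilde{\mathbb R}^n$ is *sharply open* if for every $x\in U$ there is $r>0$ in $\widetilde{\mathbb R}$ such that $|y-x|<r$ implies $y\in U$, where $|[x_\varepsilon]|=[|x_\varepsilon|]$.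 For $X\subseteq\widetilde{\mathbb R}^n$, $Y\subseteq\widetilde{\mathbb R}^k$, a map $f:X\to Y$ is a *generalized smooth function* (GSF), $f\in\mathcal{GC}^\infty(X,Y)$, if there are open sets $\Omega_\varepsilon\subseteq\mathbb R^n$ and $f_\varepsilon\in C^\infty(\Omega_\varepsilon,\mathbb R^k)$ such that for every $x\in X$ and every representative $(x_\varepsilon)$ of $x$: $x_\varepsilon\in\Omega_\varepsilon$ for $\varepsilon$ small, $f(x)=[f_\varepsilon(x_\varepsilon)]$, and $(\partial^\alpha f_\varepsilon(x_\varepsilon))$ is moderate for all multi-indices $\alpha$. The derivative in direction $v=[v_\varepsilon]$ is $\frac{\partial f}{\partial v}(x)=[\frac{\partial f_\varepsilon}{\partial v_\varepsilon}(x_\varepsilon)]$ (used below only on domains where it does not depend on the net), and $\int_a^b f=F(b)$, where $F$ is the unique GSF on $[a,b]$ with $F'=f$, $F(a)=0$. **Variational problem.** Let $d\in\mathbb N$, $m\in\mathbb N_{>0}$, $t_1<t_2$ in $\widetilde{\mathbb R}$, and $L\in\mathcal{GC}^\infty([t_1,t_2]\times\widetilde{\mathbb R}^{d\times(m+1)},\widetilde{\mathbb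 R})$. For $q\in\mathcal{GC}^\infty([t_1,t_2],\widetilde{\mathbb R}^d)$ put $L[q]^m(t)=L(t,q(t),q^{(1)}(t),\dots,q^{(m)}(t))$ and $J[q]=\int_{t_1}^{t_2}L[q]^m(t)\,dt$. Such a $q$ is a *weak extremal* of $J$ if $\frac{d}{ds}J[q+sh]\big|_{s=0}=0$ for all $h\in\mathcal{GC}^\infty([t_1,t_2],\widetilde{\mathbb R}^d)$ with $h^{(i)}(t_1)=h^{(i)}(t_2)=0$ for $0\le i<m$. Write $\partial_{i+2}L$ for the gradient ($\widetilde{\mathbb R}^d$-valued) of $L$ in the variable $q^{(i)}$, $0\le i\le m$, and define the momenta $$\varphi^{j}(q,t)=\sum_{i=0}^{m-j}(-1)^i\frac{d^i}{dt^i}\,\partial_{i+j+2}L[q]^m(t),\qquad 1\le j\le m .$$ **Transformations.** A *one-parameter group of diffeomorphisms* of a sharply open $D\subseteq\widetilde{\mathbb R}^k$ is a map $\psi\in\mathcal{GC}^\infty(P\times D,D)$, with $P\subseteq\widetilde{\mathbb R}$ sharply open and $0\in P$, such that each $\psi(s,\cdot)\in\mathcal{GC}^\infty(D,D)$ is invertible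 with inverse in $\mathcal{GC}^\infty(D,D)$, $\psi(0,\cdot)=\mathrm{Id}_D$, and $\psi(s,\cdot)\circ\psi(s',\cdot)=\psi(s+s',\cdot)$ whenever $s,s',s+s'\in P$. Let $\tau$ and $\sigma$ be one-parameter groups of diffeomorphisms, with the same parameter set $P$, of the sharply open sets $T'\subseteq[t_1,t_2]$ and $S'\subseteq\widetilde{\mathbb R}^d$ respectively. For $q\in\mathcal{GC}^\infty([t_1,t_2],S')$ put, for $s\in P$, $t\in T'$, $$\frac{d^0\sigma(s,q(t))}{d\tau^0(s,t)}=\sigma(s,q(t)),\qquad \frac{d^i\sigma(s,q(t))}{d\tau^i(s,t)}=\Bigl(\frac{\partial\tau}{\partial t}(s,t)\Bigr)^{-1}\frac{\partial}{\partial t}\Bigl(\frac{d^{i-1}\sigma(s,q(t))}{d\tau^{i-1}(s,t)}\Bigr),\quad 1\le i\le m,$$ $$\eta^0(q,t)=\frac{\partial\sigma}{\partial s}(0,q(t)),\qquad \eta^i(q,t)=\frac{d}{dt}\eta^{i-1}(q,t)-q^{(i)}(t)\,\frac{d}{dt}\frac{\partial\tau}{\partial s}(0,t),\quad 1\le i\le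 m.$$ **Theorem (higher-order Noether's theorem).** Assume that $J$ is invariant under $\tau$ and $\sigma$, i.e. for every weak extremal $q\in\mathcal{GC}^\infty([t_1,t_2],S')$ of $J$, all $s\in P$ and all $t\in T'$, $$L[q]^m(t)=L\Bigl(\tau(s,t),\sigma(s,q(t)),\frac{d\sigma(s,q(t))}{d\tau(s,t)},\dots,\frac{d^m\sigma(s,q(t))}{d\tau^m(s,t)}\Bigr)\frac{\partial\tau}{\partial t}(s,t).$$ For $q\in\mathcal{GC}^\infty([t_1,t_2],S')$ and $t\in T'$ set $$C[q]^m(t)=\sum_{i=1}^m\varphi^i(q,t)\cdot\eta^{i-1}(q,t)+\Bigl(L[q]^m(t)-\sum_{i=1}^m\varphi^i(q,t)\cdot q^{(i)}(t)\Bigr)\frac{\partial\tau}{\partial s}(0,t).$$ Then $C[q]^m$ is a constant of motion on $T'$, $S'$: for every $q\in\mathcal{GC}^\infty([t_1,t_2],S')$ we have $C[q]^m\in\mathcal{GC}^\infty(T',\widetilde{\mathbb R})$, and if $q$ is moreover a weak extremal of $J$, then $\frac{d}{dt}C[q]^m(t)=0$ for all $t\in T'$. -/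

import Mathlib

open Filter Topology
open scoped ContDiff

namespace GSF

noncomputable section

/-! ### Gauges, moderate and negligible nets -/

/-- The index set `(0,1]`. For this order, `∀ᶠ ε in atBot, p ε` means that there is `ε₀ ∈ (0,1]`
such that `p ε` holds for all `ε ∈ (0,ε₀]`, i.e. `p ε` holds for `ε` small. -/
abbrev Idx : Type := Set.Ioc (0 : ℝ) 1

instance : Nonempty Idx := ⟨⟨1, by norm_num⟩⟩

/-- A gauge: a non-decreasing net with values in `(0,1]` that tends to `0` as `ε → 0⁺`. -/
structure Gauge where
  toFun : Idx → ℝ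
  pos : ∀ ε, 0 < toFun ε
  le_one : ∀ ε, toFun ε ≤ 1
  mono : Monotone toFun
  tendsto_zero : Tendsto toFun atBot (𝓝 0)

instance : CoeFun Gauge (fun _ => Idx → ℝ) := ⟨Gauge.toFun⟩

/-- `ρ`-moderate nets. -/
def IsModerate (ρ : Gauge) {E : Type*} [NormedAddCommGroup E] (x : Idx → E) : Prop :=
  ∃ N : ℕ, ∀ᶠ ε in atBot, ‖x ε‖ ≤ (ρ ε ^ N)⁻¹

/-- `ρ`-negligible nets. -/
def IsNegligible (ρ : Gauge) {E : Type*} [NormedAddCommGroup E] (x : Idx → E) : Prop :=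
  ∀ n : ℕ, ∀ᶠ ε in atBot, ‖x ε‖ ≤ ρ ε ^ n

section Nets

variable {ρ : Gauge} {E F G : Type*} [NormedAddCommGroup E] [NormedAddCommGroup F]
  [NormedAddCommGroup G]

theorem Gauge.absorb (ρ : Gauge) (C : ℝ) : ∀ᶠ ε in atBot, C * ρ ε ≤ 1 := by
  have h : Tendsto (fun ε => C * ρ ε) atBot (𝓝 (C * 0)) := ρ.tendsto_zero.const_mul C
  rw [mul_zero] at h
  exact (h.eventually (gt_mem_nhds (zero_lt_one (α := ℝ)))).mono fun ε hε => hε.le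

theorem le_inv_pow_iff (ρ : Gauge) (ε : Idx) (N : ℕ) (a : ℝ) :
    a ≤ (ρ ε ^ N)⁻¹ ↔ a * ρ ε ^ N ≤ 1 := by
  rw [← one_div, le_div_iff₀ (pow_pos (ρ.pos ε) N)]

theorem IsModerate.of_bound {x : Idx → E} {C : ℝ} {N : ℕ}
    (h : ∀ᶠ ε in atBot, ‖x ε‖ * ρ ε ^ N ≤ C) : IsModerate ρ x := by
  refine ⟨N + 1, ?_⟩
  filter_upwards [h, ρ.absorb C] with ε h1 h2
  rw [le_inv_pow_iff, pow_succ, ← mul_assoc]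
  exact (mul_le_mul_of_nonneg_right h1 (ρ.pos ε).le).trans h2

theorem IsNegligible.of_bound {x : Idx → E} {C : ℝ}
    (h : ∀ n : ℕ, ∀ᶠ ε in atBot, ‖x ε‖ ≤ C * ρ ε ^ n) : IsNegligible ρ x := by
  intro n
  filter_upwards [h (n + 1), ρ.absorb C] with ε h1 h2
  calc ‖x ε‖ ≤ C * ρ ε ^ (n + 1) := h1
    _ = (C * ρ ε) * ρ ε ^ n := by ring
    _ ≤ 1 * ρ ε ^ n := mul_le_mul_of_nonneg_right h2 (pow_pos (ρ.pos ε) n).le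
    _ = ρ ε ^ n := one_mul _

theorem IsModerate.const (v : E) : IsModerate ρ (fun _ => v) :=
  .of_bound (N := 0) (C := ‖v‖) (by simp)

theorem IsModerate.add {x y : Idx → E} (hx : IsModerate ρ x) (hy : IsModerate ρ y) :
    IsModerate ρ (x + y) := by
  obtain ⟨N, hN⟩ := hx
  obtain ⟨M, hM⟩ := hy
  refine .of_bound (N := N + M) (C := 2) ?_
  filter_upwards [hN, hM] with ε h1 h2
  rw [le_inv_pow_iff] at h1 h2
  have a1 : ‖x ε‖ * ρ ε ^ (N + M) ≤ 1 := by
    rw [pow_add, ← mul_assoc]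
    exact mul_le_one₀ h1 (pow_pos (ρ.pos ε) M).le (pow_le_one₀ (ρ.pos ε).le (ρ.le_one ε))
  have a2 : ‖y ε‖ * ρ ε ^ (N + M) ≤ 1 := by
    rw [add_comm N M, pow_add, ← mul_assoc]
    exact mul_le_one₀ h2 (pow_pos (ρ.pos ε) N).le (pow_le_one₀ (ρ.pos ε).le (ρ.le_one ε))
  have a3 := mul_le_mul_of_nonneg_right (norm_add_le (x ε) (y ε))
    (pow_pos (ρ.pos ε) (N + M)).le
  simp only [Pi.add_apply]
  linarith

theorem IsModerate.neg {x : Idx → E} (hx : IsModerate ρ x) : IsModerate ρ (-x) := by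
  simpa [IsModerate] using hx

theorem IsNegligible.add {x y : Idx → E} (hx : IsNegligible ρ x) (hy : IsNegligible ρ y) :
    IsNegligible ρ (x + y) := by
  refine .of_bound (C := 2) fun n => ?_
  filter_upwards [hx n, hy n] with ε h1 h2
  have := norm_add_le (x ε) (y ε)
  simp only [Pi.add_apply]
  linarith

theorem IsNegligible.neg {x : Idx → E} (hx : IsNegligible ρ x) : IsNegligible ρ (-x) := by
  simpa [IsNegligible] using hx

theorem IsNegligible.zero : IsNegligible ρ (0 : Idx → E) := by
  intro n
  refine Eventually.of_forall fun ε => ?_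
  simpa using (pow_pos (ρ.pos ε) n).le

theorem IsModerate.bilin {B : E → F → G} {C : ℝ} (hC : 0 ≤ C)
    (hB : ∀ a b, ‖B a b‖ ≤ C * ‖a‖ * ‖b‖)
    {x : Idx → E} {y : Idx → F} (hx : IsModerate ρ x) (hy : IsModerate ρ y) :
    IsModerate ρ (fun ε => B (x ε) (y ε)) := by
  obtain ⟨N, hN⟩ := hx
  obtain ⟨M, hM⟩ := hy
  refine .of_bound (N := N + M) (C := C) ?_
  filter_upwards [hN, hM] with ε h1 h2
  rw [le_inv_pow_iff] at h1 h2
  have p1 : 0 ≤ ρ ε ^ N := (pow_pos (ρ.pos ε) N).le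
  have p2 : 0 ≤ ρ ε ^ M := (pow_pos (ρ.pos ε) M).le
  calc ‖B (x ε) (y ε)‖ * ρ ε ^ (N + M)
      ≤ (C * ‖x ε‖ * ‖y ε‖) * ρ ε ^ (N + M) :=
        mul_le_mul_of_nonneg_right (hB _ _) (by positivity [ρ.pos ε])
    _ = C * ((‖x ε‖ * ρ ε ^ N) * (‖y ε‖ * ρ ε ^ M)) := by rw [pow_add]; ring
    _ ≤ C * 1 := mul_le_mul_of_nonneg_left (mul_le_one₀ h1 (by positivity) h2) hC
    _ = C := mul_one C

theorem IsNegligible.bilin_left {B : E → F → G} {C : ℝ} (hC : 0 ≤ C)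
    (hB : ∀ a b, ‖B a b‖ ≤ C * ‖a‖ * ‖b‖)
    {x : Idx → E} {y : Idx → F} (hx : IsNegligible ρ x) (hy : IsModerate ρ y) :
    IsNegligible ρ (fun ε => B (x ε) (y ε)) := by
  obtain ⟨M, hM⟩ := hy
  refine .of_bound (C := C) fun n => ?_
  filter_upwards [hx (n + M), hM] with ε h1 h2
  rw [le_inv_pow_iff] at h2
  have p1 : 0 ≤ ρ ε ^ n := (pow_pos (ρ.pos ε) n).le
  calc ‖B (x ε) (y ε)‖ ≤ C * ‖x ε‖ * ‖y ε‖ := hB _ _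
    _ ≤ C * ρ ε ^ (n + M) * ‖y ε‖ :=
        mul_le_mul_of_nonneg_right (mul_le_mul_of_nonneg_left h1 hC) (norm_nonneg _)
    _ = C * ρ ε ^ n * (‖y ε‖ * ρ ε ^ M) := by rw [pow_add]; ring
    _ ≤ C * ρ ε ^ n * 1 := mul_le_mul_of_nonneg_left h2 (mul_nonneg hC p1)
    _ = C * ρ ε ^ n := mul_one _

theorem IsNegligible.bilin_right {B : E → F → G} {C : ℝ} (hC : 0 ≤ C)
    (hB : ∀ a b, ‖B a b‖ ≤ C * ‖a‖ * ‖b‖)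
    {x : Idx → E} {y : Idx → F} (hx : IsModerate ρ x) (hy : IsNegligible ρ y) :
    IsNegligible ρ (fun ε => B (x ε) (y ε)) :=
  IsNegligible.bilin_left (B := fun b a => B a b) hC
    (fun b a => (hB a b).trans (by rw [mul_right_comm])) hy hx

end Nets

/-! ### Generalized points

`Gen ρ ℝ` is the Robinson–Colombeau ring of generalized numbers, and `Gen ρ (ℝⁿ)` is its `n`-th
power, with elements `[x_ε]` given by moderate nets of points of `ℝⁿ`. -/

/-- The additive group of moderate nets in `E`. -/
def moderateNets (ρ : Gauge) (E : Type*) [NormedAddCommGroup E] : AddSubgroup (Idx → E) where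
  carrier := {x | IsModerate ρ x}
  add_mem' := IsModerate.add
  zero_mem' := IsModerate.const 0
  neg_mem' := IsModerate.neg

/-- The negligible nets, as a subgroup of the moderate ones. -/
def negligibleNets (ρ : Gauge) (E : Type*) [NormedAddCommGroup E] :
    AddSubgroup (moderateNets ρ E) where
  carrier := {x | IsNegligible ρ (x : Idx → E)}
  add_mem' := IsNegligible.add
  zero_mem' := IsNegligible.zero
  neg_mem' := IsNegligible.neg

/-- Generalized points of `E`: moderate nets modulo negligible nets. -/
def Gen (ρ : Gauge) (E : Type*) [NormedAddCommGroup E] : Type _ :=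
  moderateNets ρ E ⧸ negligibleNets ρ E

namespace Gen

variable {ρ : Gauge} {E F G : Type*} [NormedAddCommGroup E] [NormedAddCommGroup F]
  [NormedAddCommGroup G]

instance : AddCommGroup (Gen ρ E) :=
  inferInstanceAs (AddCommGroup (moderateNets ρ E ⧸ negligibleNets ρ E))

/-- The class `[x_ε]` of a moderate net. -/
def mk (x : Idx → E) (hx : IsModerate ρ x) : Gen ρ E :=
  QuotientAddGroup.mk (s := negligibleNets ρ E) ⟨x, hx⟩

/-- `Rep p x` means that `(x_ε)` is a moderate net and `p = [x_ε]`. -/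
def Rep (p : Gen ρ E) (x : Idx → E) : Prop := ∃ hx : IsModerate ρ x, mk x hx = p

theorem mk_eq_mk {x y : Idx → E} (hx : IsModerate ρ x) (hy : IsModerate ρ y) :
    mk x hx = mk y hy ↔ IsNegligible ρ (x - y) := by
  have h1 : mk x hx = mk y hy ↔
      -(⟨x, hx⟩ : moderateNets ρ E) + ⟨y, hy⟩ ∈ negligibleNets ρ E := QuotientAddGroup.eq
  rw [h1]
  have h2 : IsNegligible ρ (-x + y) ↔ IsNegligible ρ (x - y) :=
    ⟨fun h => by simpa [sub_eq_add_neg, add_comm] using h.neg,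
      fun h => by simpa [sub_eq_add_neg, add_comm] using h.neg⟩
  exact h2

theorem mk_add_mk {x y : Idx → E} (hx : IsModerate ρ x) (hy : IsModerate ρ y) :
    mk x hx + mk y hy = mk (x + y) (hx.add hy) := rfl

theorem exists_rep (p : Gen ρ E) : ∃ (x : Idx → E) (hx : IsModerate ρ x), mk x hx = p :=
  Quotient.inductionOn p fun a => ⟨a.1, a.2, rfl⟩

/-- The standard point `v`, seen as a generalized point. -/
def const (ρ : Gauge) (v : E) : Gen ρ E := mk (fun _ => v) (IsModerate.const v)

/-- The extension to generalized points of a bounded bilinear map: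
`bilin B [x_ε] [y_ε] = [B (x_ε, y_ε)]`. -/
def bilin [NormedSpace ℝ E] [NormedSpace ℝ F] [NormedSpace ℝ G] (B : E × F → G)
    (hB : IsBoundedBilinearMap ℝ B) : Gen ρ E → Gen ρ F → Gen ρ G :=
  Quotient.lift₂
    (fun (x : moderateNets ρ E) (y : moderateNets ρ F) =>
      mk (fun ε => B (x.1 ε, y.1 ε)) (by
        obtain ⟨C, hC, h⟩ := hB.bound
        exact IsModerate.bilin (B := fun a b => B (a, b)) hC.le h x.2 y.2))
    (by
      intro x y x' y' hx hy
      obtain ⟨C, hC, h⟩ := hB.bound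
      have hx' : IsNegligible ρ (x.1 - x'.1) :=
        (mk_eq_mk x.2 x'.2).1 (Quotient.sound hx)
      have hy' : IsNegligible ρ (y.1 - y'.1) :=
        (mk_eq_mk y.2 y'.2).1 (Quotient.sound hy)
      refine (mk_eq_mk _ _).2 ?_
      have h1 := IsNegligible.bilin_left (B := fun a b => B (a, b)) hC.le h hx' y.2
      have h2 := IsNegligible.bilin_right (B := fun a b => B (a, b)) hC.le h x'.2 hy'
      convert h1.add h2 using 1
      funext ε
      simp only [Pi.sub_apply, Pi.add_apply, hB.map_sub_left, hB.map_sub_right]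
      abel)

/-- The extension to generalized points of a Lipschitz map: `lip g [x_ε] = [g x_ε]`. -/
def lip (g : E → F) (hg : ∃ C, LipschitzWith C g) : Gen ρ E → Gen ρ F :=
  Quotient.lift
    (fun x : moderateNets ρ E => mk (fun ε => g (x.1 ε)) (by
      obtain ⟨C, hC⟩ := hg
      obtain ⟨N, hN⟩ := x.2
      refine .of_bound (N := N) (C := C + ‖g 0‖) ?_
      filter_upwards [hN] with ε h1
      rw [le_inv_pow_iff] at h1
      have h2 : ‖g (x.1 ε)‖ ≤ C * ‖x.1 ε‖ + ‖g 0‖ := by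
        have h3 := hC.norm_sub_le (x.1 ε) 0
        rw [sub_zero] at h3
        have h4 := norm_le_norm_sub_add (g (x.1 ε)) (g 0)
        linarith
      have p1 : 0 ≤ ρ ε ^ N := (pow_pos (ρ.pos ε) N).le
      have p2 : ρ ε ^ N ≤ 1 := pow_le_one₀ (ρ.pos ε).le (ρ.le_one ε)
      calc ‖g (x.1 ε)‖ * ρ ε ^ N ≤ (C * ‖x.1 ε‖ + ‖g 0‖) * ρ ε ^ N :=
            mul_le_mul_of_nonneg_right h2 p1
        _ = C * (‖x.1 ε‖ * ρ ε ^ N) + ‖g 0‖ * ρ ε ^ N := by ring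
        _ ≤ C * 1 + ‖g 0‖ * 1 := by gcongr
        _ = C + ‖g 0‖ := by ring))
    (by
      intro x y hxy
      obtain ⟨C, hC⟩ := hg
      have h : IsNegligible ρ (x.1 - y.1) := (mk_eq_mk x.2 y.2).1 (Quotient.sound hxy)
      refine (mk_eq_mk _ _).2 (.of_bound (C := C) fun n => ?_)
      filter_upwards [h n] with ε hε
      exact (hC.norm_sub_le (x.1 ε) (y.1 ε)).trans (mul_le_mul_of_nonneg_left hε C.2))

/-- The extension to generalized points of a bounded linear map: `map A [x_ε] = [A x_ε]`. -/
def map [NormedSpace ℝ E] [NormedSpace ℝ F] (A : E →L[ℝ] F) : Gen ρ E → Gen ρ F :=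
  lip A ⟨_, A.lipschitz⟩

/-- The generalized norm `|[x_ε]| = [|x_ε|]`. -/
def norm : Gen ρ E → Gen ρ ℝ := lip (fun x => ‖x‖) ⟨_, lipschitzWith_one_norm⟩

/-! #### The ring of generalized numbers -/

instance : Mul (Gen ρ ℝ) := ⟨bilin (fun z : ℝ × ℝ => z.1 * z.2) isBoundedBilinearMap_mul⟩

instance : One (Gen ρ ℝ) := ⟨const ρ 1⟩

theorem mk_mul_mk {x y : Idx → ℝ} (hx : IsModerate ρ x) (hy : IsModerate ρ y) :
    ∃ h, mk x hx * mk y hy = mk (x * y) h := ⟨_, rfl⟩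

theorem mk_congr {x y : Idx → E} {hx : IsModerate ρ x} {hy : IsModerate ρ y} (h : x = y) :
    mk x hx = mk y hy := by
  subst h
  rfl

/-- The ring of generalized numbers; product and unit are those of representatives. -/
instance : CommRing (Gen ρ ℝ) :=
  { (inferInstance : AddCommGroup (Gen ρ ℝ)) with
    mul := (· * ·)
    one := 1
    left_distrib := by
      intro a b c
      obtain ⟨x, hx, rfl⟩ := exists_rep a
      obtain ⟨y, hy, rfl⟩ := exists_rep b
      obtain ⟨z, hz, rfl⟩ := exists_rep c
      exact mk_congr (mul_add x y z)
    right_distrib := by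
      intro a b c
      obtain ⟨x, hx, rfl⟩ := exists_rep a
      obtain ⟨y, hy, rfl⟩ := exists_rep b
      obtain ⟨z, hz, rfl⟩ := exists_rep c
      exact mk_congr (add_mul x y z)
    zero_mul := by
      intro a
      obtain ⟨x, hx, rfl⟩ := exists_rep a
      exact mk_congr (zero_mul x)
    mul_zero := by
      intro a
      obtain ⟨x, hx, rfl⟩ := exists_rep a
      exact mk_congr (mul_zero x)
    mul_assoc := by
      intro a b c
      obtain ⟨x, hx, rfl⟩ := exists_rep a
      obtain ⟨y, hy, rfl⟩ := exists_rep b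
      obtain ⟨z, hz, rfl⟩ := exists_rep c
      exact mk_congr (mul_assoc x y z)
    one_mul := by
      intro a
      obtain ⟨x, hx, rfl⟩ := exists_rep a
      exact mk_congr (one_mul x)
    mul_one := by
      intro a
      obtain ⟨x, hx, rfl⟩ := exists_rep a
      exact mk_congr (mul_one x)
    mul_comm := by
      intro a b
      obtain ⟨x, hx, rfl⟩ := exists_rep a
      obtain ⟨y, hy, rfl⟩ := exists_rep b
      exact mk_congr (mul_comm x y) }

/-- `x ≤ y` if there are representatives with `x_ε ≤ y_ε` for all `ε`. -/
instance : LE (Gen ρ ℝ) := ⟨fun p q => ∃ x y, Rep p x ∧ Rep q y ∧ ∀ ε, x ε ≤ y ε⟩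

/-- `x < y` means that `x ≤ y` and that `x - y` is invertible. -/
instance : LT (Gen ρ ℝ) := ⟨fun p q => p ≤ q ∧ IsUnit (p - q)⟩

/-- The action `[r_ε] • [x_ε] = [r_ε x_ε]` of generalized numbers. -/
instance [NormedSpace ℝ E] : SMul (Gen ρ ℝ) (Gen ρ E) :=
  ⟨bilin (fun z : ℝ × E => z.1 • z.2) isBoundedBilinearMap_smul⟩

/-- The scalar product `[x_ε] · [y_ε] = [x_ε · y_ε]`. -/
def dot {E : Type*} [NormedAddCommGroup E] [InnerProductSpace ℝ E] : Gen ρ E → Gen ρ E → Gen ρ ℝ :=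
  bilin (fun z : E × E => inner ℝ z.1 z.2) isBoundedBilinearMap_inner

/-- First component of a generalized point of a product: `[(x_ε, y_ε)] ↦ [x_ε]`. -/
def fst [NormedSpace ℝ E] [NormedSpace ℝ F] : Gen ρ (E × F) → Gen ρ E :=
  map (ContinuousLinearMap.fst ℝ E F)

/-- Second component of a generalized point of a product: `[(x_ε, y_ε)] ↦ [y_ε]`. -/
def snd [NormedSpace ℝ E] [NormedSpace ℝ F] : Gen ρ (E × F) → Gen ρ F :=
  map (ContinuousLinearMap.snd ℝ E F)

/-- `pair [x_ε] [y_ε] = [(x_ε, y_ε)]`. -/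
def pair [NormedSpace ℝ E] [NormedSpace ℝ F] (p : Gen ρ E) (q : Gen ρ F) : Gen ρ (E × F) :=
  map (ContinuousLinearMap.inl ℝ E F) p + map (ContinuousLinearMap.inr ℝ E F) q

/-- `tuple ([x⁰_ε], …, [xⁿ_ε]) = [(x⁰_ε, …, xⁿ_ε)]`. -/
def tuple [NormedSpace ℝ E] {n : ℕ} (p : Fin n → Gen ρ E) : Gen ρ (Fin n → E) :=
  ∑ i, map (ContinuousLinearMap.single ℝ (fun _ : Fin n => E) i) (p i)

/-- Closed intervals `[a,b] = {t | a ≤ t ≤ b}`. -/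
def Icc (a b : Gen ρ ℝ) : Set (Gen ρ ℝ) := {t | a ≤ t ∧ t ≤ b}

/-- Cartesian products of sets of generalized points. -/
def prod [NormedSpace ℝ E] [NormedSpace ℝ F] (A : Set (Gen ρ E)) (B : Set (Gen ρ F)) :
    Set (Gen ρ (E × F)) :=
  {z | fst z ∈ A ∧ snd z ∈ B}

/-- Sharply open sets: every point is the centre of a ball `{y | |y - x| < r}`, `r > 0`, contained
in the set. -/
def IsSharplyOpen (U : Set (Gen ρ E)) : Prop :=
  ∀ x ∈ U, ∃ r : Gen ρ ℝ, 0 < r ∧ ∀ y, norm (y - x) < r → y ∈ U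

/-- The strongly internal set `⟨A_ε⟩`. -/
def stronglyInternal (ρ : Gauge) (A : Idx → Set E) : Set (Gen ρ E) :=
  {p | ∀ x, Rep p x → ∀ᶠ ε in atBot, x ε ∈ A ε}

end Gen

/-! ### Generalized smooth functions, derivatives and integrals -/

section GSFs

open Gen

variable {ρ : Gauge} {E F : Type*} [NormedAddCommGroup E] [NormedSpace ℝ E]
  [NormedAddCommGroup F] [NormedSpace ℝ F]

/-- The net of smooth functions `u_ε : Ω_ε → F` defines the map `f` on `X`. The moderateness of all
partial derivatives `∂^α u_ε (x_ε)`, `|α| = k`, is stated as that of the `k`-th differential. -/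
structure Defines (X : Set (Gen ρ E)) (f : Gen ρ E → Gen ρ F) (Ω : Idx → Set E)
    (u : Idx → E → F) : Prop where
  isOpen : ∀ ε, IsOpen (Ω ε)
  smooth : ∀ ε, ContDiffOn ℝ ∞ (u ε) (Ω ε)
  subset : X ⊆ stronglyInternal ρ Ω
  moderate : ∀ p ∈ X, ∀ x, Rep p x → ∀ k : ℕ,
    IsModerate ρ (fun ε => iteratedFDeriv ℝ k (u ε) (x ε))
  value : ∀ p ∈ X, ∀ x, Rep p x → Rep (f p) (fun ε => u ε (x ε))

/-- `f : X → Y` is a generalized smooth function (values of `f` outside `X` play no role). -/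
def IsGSF (X : Set (Gen ρ E)) (Y : Set (Gen ρ F)) (f : Gen ρ E → Gen ρ F) : Prop :=
  Set.MapsTo f X Y ∧ ∃ Ω u, Defines X f Ω u

/-- `w` is the derivative `[∂u_ε/∂v_ε (x_ε)]` at `p = [x_ε]`, in the direction `v = [v_ε]`, of the
map `f` defined on `X` by some net `(u_ε)`. -/
def HasDeriv (X : Set (Gen ρ E)) (f : Gen ρ E → Gen ρ F) (v p : Gen ρ E) (w : Gen ρ F) : Prop :=
  ∃ Ω u x y, Defines X f Ω u ∧ Rep p x ∧ Rep v y ∧ Rep w (fun ε => fderiv ℝ (u ε) (x ε) (y ε))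

open Classical in
/-- The directional derivative `∂f/∂v (p)` of a generalized smooth function `f` on `X`. -/
def dirDeriv (X : Set (Gen ρ E)) (f : Gen ρ E → Gen ρ F) (v p : Gen ρ E) : Gen ρ F :=
  if h : ∃ w, HasDeriv X f v p w then h.choose else 0

/-- The derivative of a function of one variable defined on `X`. -/
def deriv (X : Set (Gen ρ ℝ)) (f : Gen ρ ℝ → Gen ρ F) (t : Gen ρ ℝ) : Gen ρ F :=
  dirDeriv X f 1 t

/-- The derivative `f^{(i)}` of order `i` of a function of one variable defined on `X`. -/
def iterDeriv (X : Set (Gen ρ ℝ)) (i : ℕ) (f : Gen ρ ℝ → Gen ρ F) : Gen ρ ℝ → Gen ρ F :=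
  (deriv X)^[i] f

/-- `Φ` is the primitive of `f` on `[a,b]` that vanishes at `a`. -/
def IsPrimitive (a b : Gen ρ ℝ) (f Φ : Gen ρ ℝ → Gen ρ ℝ) : Prop :=
  IsGSF (Icc a b) Set.univ Φ ∧ Φ a = 0 ∧ ∀ t ∈ Icc a b, deriv (Icc a b) Φ t = f t

open Classical in
/-- The integral `∫_a^b f`: the value at `b` of the primitive of `f` that vanishes at `a`. -/
def integral (a b : Gen ρ ℝ) (f : Gen ρ ℝ → Gen ρ ℝ) : Gen ρ ℝ :=
  if h : ∃ Φ, IsPrimitive a b f Φ then h.choose b else 0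

/-- `ψ(s,·)`, `s ∈ P`, is a one parameter group of diffeomorphisms of the sharply open set `D`. -/
structure IsOneParamGroup (P : Set (Gen ρ ℝ)) (D : Set (Gen ρ E))
    (ψ : Gen ρ ℝ → Gen ρ E → Gen ρ E) : Prop where
  open_dom : IsSharplyOpen D
  open_par : IsSharplyOpen P
  zero_mem : (0 : Gen ρ ℝ) ∈ P
  gsf : IsGSF (prod P D) D (fun z => ψ (fst z) (snd z))
  diffeo : ∀ s ∈ P, IsGSF D D (ψ s) ∧
    ∃ φ, IsGSF D D φ ∧ (∀ x ∈ D, φ (ψ s x) = x) ∧ ∀ x ∈ D, ψ s (φ x) = x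
  zero : ∀ x ∈ D, ψ 0 x = x
  add : ∀ s ∈ P, ∀ s' ∈ P, s + s' ∈ P → ∀ x ∈ D, ψ s (ψ s' x) = ψ (s + s') x

/-- The partial derivative `∂ψ/∂s (s,x)` of `ψ : P × D → D`. -/
def partialPar (P : Set (Gen ρ ℝ)) (D : Set (Gen ρ E)) (ψ : Gen ρ ℝ → Gen ρ E → Gen ρ E)
    (s : Gen ρ ℝ) (x : Gen ρ E) : Gen ρ E :=
  dirDeriv (prod P D) (fun z => ψ (fst z) (snd z)) (const ρ (1, 0)) (pair s x)

/-- The partial derivative `∂τ/∂t (s,t)` of `τ : P × T' → T'`. -/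
def partialTime (P T' : Set (Gen ρ ℝ)) (τ : Gen ρ ℝ → Gen ρ ℝ → Gen ρ ℝ) (s t : Gen ρ ℝ) :
    Gen ρ ℝ :=
  dirDeriv (prod P T') (fun z => τ (fst z) (snd z)) (const ρ (0, 1)) (pair s t)

end GSFs

/-! ### Higher-order calculus of variations -/

section Variations

open Gen

variable {ρ : Gauge} {d m : ℕ}

/-- The space `ℝᵈ` with the Euclidean norm. -/
abbrev Space (d : ℕ) : Type := EuclideanSpace ℝ (Fin d)

/-- The space of the variables `(t, q, q^{(1)}, …, q^{(m)})`. -/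
abbrev Jet (d m : ℕ) : Type := ℝ × (Fin (m + 1) → Space d)

/-- The domain `[t₁,t₂] × ℝ̃^{d×(m+1)}` of Lagrangians. -/
def jetDomain (d m : ℕ) (t₁ t₂ : Gen ρ ℝ) : Set (Gen ρ (Jet d m)) :=
  prod (Icc t₁ t₂) Set.univ

/-- `[q]^m(t) = (t, q(t), q^{(1)}(t), …, q^{(m)}(t))`. -/
def jet (m : ℕ) (t₁ t₂ : Gen ρ ℝ) (q : Gen ρ ℝ → Gen ρ (Space d)) (t : Gen ρ ℝ) :
    Gen ρ (Jet d m) :=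
  pair t (tuple fun i : Fin (m + 1) => iterDeriv (Icc t₁ t₂) i q t)

/-- The functional `J[q] = ∫_{t₁}^{t₂} L[q]^m(t) dt`. -/
def action (t₁ t₂ : Gen ρ ℝ) (L : Gen ρ (Jet d m) → Gen ρ ℝ)
    (q : Gen ρ ℝ → Gen ρ (Space d)) : Gen ρ ℝ :=
  integral t₁ t₂ fun t => L (jet m t₁ t₂ q t)

/-- Admissible variations: generalized smooth functions on `[t₁,t₂]` whose derivatives of order
less than `m` vanish at `t₁` and at `t₂`. -/
def IsVariation (m : ℕ) (t₁ t₂ : Gen ρ ℝ) (h : Gen ρ ℝ → Gen ρ (Space d)) : Prop :=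
  IsGSF (Icc t₁ t₂) Set.univ h ∧
    ∀ i < m, iterDeriv (Icc t₁ t₂) i h t₁ = 0 ∧ iterDeriv (Icc t₁ t₂) i h t₂ = 0

/-- The first variation `δJ(q;h) = d/ds J[q + s h]` at `s = 0`. -/
def firstVariation (t₁ t₂ : Gen ρ ℝ) (L : Gen ρ (Jet d m) → Gen ρ ℝ)
    (q h : Gen ρ ℝ → Gen ρ (Space d)) : Gen ρ ℝ :=
  deriv Set.univ (fun s => action t₁ t₂ L fun t => q t + s • h t) 0

/-- Weak extremals of `J`. -/
def IsWeakExtremal (t₁ t₂ : Gen ρ ℝ) (L : Gen ρ (Jet d m) → Gen ρ ℝ)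
    (q : Gen ρ ℝ → Gen ρ (Space d)) : Prop :=
  IsGSF (Icc t₁ t₂) Set.univ q ∧ ∀ h, IsVariation m t₁ t₂ h → firstVariation t₁ t₂ L q h = 0

/-- The gradient `∂L/∂q^{(i)}`, `i ≤ m`, of `L` with respect to the variable `q^{(i)}`. -/
def gradL (t₁ t₂ : Gen ρ ℝ) (L : Gen ρ (Jet d m) → Gen ρ ℝ) (i : ℕ) (z : Gen ρ (Jet d m)) :
    Gen ρ (Space d) :=
  ∑ k : Fin d,
    dirDeriv (jetDomain d m t₁ t₂) L
      (const ρ ((0, fun l => if (l : ℕ) = i then EuclideanSpace.single k 1 else 0) : Jet d m)) z •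
    const ρ (EuclideanSpace.single k (1 : ℝ))

/-- The momenta `φ^j(q)(t) = ∑_{i=0}^{m-j} (-1)^i d^i/dt^i ∂L/∂q^{(i+j)} [q]^m(t)`, `j ≤ m`. -/
def momentum (t₁ t₂ : Gen ρ ℝ) (L : Gen ρ (Jet d m) → Gen ρ ℝ) (j : ℕ)
    (q : Gen ρ ℝ → Gen ρ (Space d)) (t : Gen ρ ℝ) : Gen ρ (Space d) :=
  ∑ i ∈ Finset.range (m - j + 1), (-1 : ℤ) ^ i •
    iterDeriv (Icc t₁ t₂) i (fun r => gradL t₁ t₂ L (i + j) (jet m t₁ t₂ q r)) t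

/-- The expressions `d^iσ(s,q(t))/dτ^i(s,t)`: the first one is `σ(s,q(t))`, and the next one is
obtained by differentiating with respect to `t` and dividing by `∂τ/∂t (s,t)`. -/
def transDeriv (P T' : Set (Gen ρ ℝ)) (τ : Gen ρ ℝ → Gen ρ ℝ → Gen ρ ℝ)
    (σ : Gen ρ ℝ → Gen ρ (Space d) → Gen ρ (Space d)) (q : Gen ρ ℝ → Gen ρ (Space d)) :
    ℕ → Gen ρ ℝ → Gen ρ ℝ → Gen ρ (Space d)
  | 0, s, t => σ s (q t)
  | i + 1, s, t =>
    Ring.inverse (partialTime P T' τ s t) • deriv T' (fun r => transDeriv P T' τ σ q i s r) t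

/-- The functional `J` is invariant under the action of `τ` and `σ`. -/
def IsInvariant (t₁ t₂ : Gen ρ ℝ) (L : Gen ρ (Jet d m) → Gen ρ ℝ) (P T' : Set (Gen ρ ℝ))
    (S' : Set (Gen ρ (Space d))) (τ : Gen ρ ℝ → Gen ρ ℝ → Gen ρ ℝ)
    (σ : Gen ρ ℝ → Gen ρ (Space d) → Gen ρ (Space d)) : Prop :=
  ∀ q, IsGSF (Icc t₁ t₂) S' q → IsWeakExtremal t₁ t₂ L q → ∀ s ∈ P, ∀ t ∈ T',
    L (jet m t₁ t₂ q t) =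
      L (pair (τ s t) (tuple fun i : Fin (m + 1) => transDeriv P T' τ σ q i s t)) *
        partialTime P T' τ s t

/-- The prolonged infinitesimal generators `η^i(q,t)`. -/
def generator (t₁ t₂ : Gen ρ ℝ) (P T' : Set (Gen ρ ℝ)) (S' : Set (Gen ρ (Space d)))
    (τ : Gen ρ ℝ → Gen ρ ℝ → Gen ρ ℝ) (σ : Gen ρ ℝ → Gen ρ (Space d) → Gen ρ (Space d))
    (q : Gen ρ ℝ → Gen ρ (Space d)) : ℕ → Gen ρ ℝ → Gen ρ (Space d)
  | 0, t => partialPar P S' σ 0 (q t)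
  | i + 1, t =>
    deriv T' (fun r => generator t₁ t₂ P T' S' τ σ q i r) t -
      deriv T' (fun r => partialPar P T' τ 0 r) t • iterDeriv (Icc t₁ t₂) (i + 1) q t

/-- The quantity `C[q]^m(t) = ∑_{i=1}^m φ^i · η^{i-1} + (L[q]^m - ∑_{i=1}^m φ^i · q^{(i)}) ∂τ/∂s(0,t)`
(both sums are indexed by `i - 1` here). -/
def noetherCharge (t₁ t₂ : Gen ρ ℝ) (L : Gen ρ (Jet d m) → Gen ρ ℝ) (P T' : Set (Gen ρ ℝ))
    (S' : Set (Gen ρ (Space d))) (τ : Gen ρ ℝ → Gen ρ ℝ → Gen ρ ℝ)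
    (σ : Gen ρ ℝ → Gen ρ (Space d) → Gen ρ (Space d)) (q : Gen ρ ℝ → Gen ρ (Space d))
    (t : Gen ρ ℝ) : Gen ρ ℝ :=
  ∑ i ∈ Finset.range m,
      dot (momentum t₁ t₂ L (i + 1) q t) (generator t₁ t₂ P T' S' τ σ q i t) +
    (L (jet m t₁ t₂ q t) - ∑ i ∈ Finset.range m,
      dot (momentum t₁ t₂ L (i + 1) q t) (iterDeriv (Icc t₁ t₂) (i + 1) q t)) *
    partialPar P T' τ 0 t

end Variations

end

end GSF

/-!
The proof is the classical one, carried out in a differential calculus for generalized functions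
on sets of generalized points.

*Calculus.* The functions given by nets of smooth functions on a set `X` (`Smooth X f`) are closed
under composition, bounded bilinear operations, division by invertible functions and integrals
depending on a parameter. Most estimates are reduced to a choice of points: a property that holds
along every net of points of a net of sets `K_ε` holds uniformly on `K_ε`
(`eventually_forall_of_nets`, `exists_uniform_bound`). Derivatives are independent of the defining
net in the directions in which `X` contains segments of invertible length (`IsAdmissible`); this
covers sharply open sets, the non-open interval `[t₁,t₂]`, and products with them. The reason is
the interpolation inequality `norm_fderiv_le_of_segment`: a net with negligible values and moderate
second derivatives on such segments has negligible first derivatives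
(`Defines.isNegligible_fderiv_sub_fderiv`). Hence the sum, Leibniz and chain rules and the symmetry
of mixed derivatives hold for the derivatives of generalized functions.

*Euler–Lagrange equations.* Let `E` be the momentum of order `0`. By differentiation under the
integral sign (`smooth_integral`) and the recursion `(φ^{j+1})' = ∂L/∂q^{(j)} - φ^j`, an extremal
satisfies `∫ E · h = 0` for all variations `h`. For `h = (t - t₁)^m (t₂ - t)^m E` the integrand is
non-negative, so its primitive, which vanishes at both endpoints, is zero
(`monotone_of_deriv_nonneg`), and so is the integrand. The factors `t - t₁` and `t₂ - t` are
cancelled by differentiation and because the ring of generalized numbers is reduced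
(`eq_zero_of_mul_eq_zero`). This gives `E = 0` (`IsWeakExtremal.momentum_zero`).

*Conservation.* The expressions `d^iσ/dτ^i` are generalized smooth on `P × T'`, since `∂τ/∂t` is
invertible, and by the symmetry of mixed derivatives their derivatives at `s = 0` are the
generators `η^i` (`IsTransformedPath.dirDeriv_transDeriv_zero`). Differentiating the invariance of
the action at `s = 0` gives, for `ζ = ∂τ/∂s (0,·)`,
`L ζ' + ∂L/∂t ζ + ∑ ∂L/∂q^{(i)} · η^i = 0`
(`IsTransformedPath.infinitesimal_invariance`). By the recursion for the momenta and `E = 0`, the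
left-hand side is the derivative of the Noether charge.
-/

namespace GSF

/-! ### Moderate and negligible nets -/

section Nets

variable {ρ : Gauge} {E F G : Type*} [NormedAddCommGroup E] [NormedAddCommGroup F]
  [NormedAddCommGroup G]

theorem Gauge.eventually_lt (ρ : Gauge) {c : ℝ} (hc : 0 < c) : ∀ᶠ ε in atBot, ρ ε < c :=
  ρ.tendsto_zero.eventually (gt_mem_nhds hc)

theorem IsModerate.mono {x : Idx → E} {y : Idx → F} (hy : IsModerate ρ y)
    (h : ∀ᶠ ε in atBot, ‖x ε‖ ≤ ‖y ε‖) : IsModerate ρ x := by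
  obtain ⟨N, hN⟩ := hy
  exact ⟨N, by filter_upwards [hN, h] with ε h1 h2 using h2.trans h1⟩

theorem IsModerate.norm {x : Idx → E} (hx : IsModerate ρ x) : IsModerate ρ (fun ε => ‖x ε‖) :=
  hx.mono (.of_forall fun ε => by simp)

theorem IsModerate.mul {x y : Idx → ℝ} (hx : IsModerate ρ x) (hy : IsModerate ρ y) :
    IsModerate ρ (fun ε => x ε * y ε) :=
  IsModerate.bilin (B := fun a b : ℝ => a * b) zero_le_one (fun a b => by simp) hx hy

theorem IsModerate.sum {ι : Type*} (s : Finset ι) {x : ι → Idx → E}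
    (h : ∀ i ∈ s, IsModerate ρ (x i)) : IsModerate ρ (fun ε => ∑ i ∈ s, x i ε) := by
  induction s using Finset.cons_induction with
  | empty => simpa using IsModerate.const (0 : E)
  | cons a s ha ih =>
    simp only [Finset.sum_cons]
    exact (h a (by simp)).add (ih fun i hi => h i (by simp [hi]))

theorem IsModerate.pow {x : Idx → ℝ} (hx : IsModerate ρ x) (k : ℕ) :
    IsModerate ρ (fun ε => x ε ^ k) := by
  induction k with
  | zero => simpa using IsModerate.const (1 : ℝ)
  | succ k ih => simpa only [pow_succ] using ih.mul hx

/-- The net `ρ_ε^{-N}` is moderate. -/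
theorem IsModerate.inv_pow (N : ℕ) : IsModerate ρ (fun ε => (ρ ε ^ N)⁻¹) :=
  ⟨N, .of_forall fun ε => by
    rw [Real.norm_of_nonneg (inv_nonneg.2 (pow_pos (ρ.pos ε) N).le)]⟩

theorem IsNegligible.mono {x : Idx → E} {y : Idx → F} (hy : IsNegligible ρ y)
    (h : ∀ᶠ ε in atBot, ‖x ε‖ ≤ ‖y ε‖) : IsNegligible ρ x := fun n => by
  filter_upwards [hy n, h] with ε h1 h2 using h2.trans h1

theorem IsNegligible.isModerate {x : Idx → E} (hx : IsNegligible ρ x) : IsModerate ρ x :=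
  ⟨0, by simpa using hx 0⟩

theorem IsNegligible.mul_left {x y : Idx → ℝ} (hx : IsModerate ρ x) (hy : IsNegligible ρ y) :
    IsNegligible ρ (fun ε => x ε * y ε) :=
  IsNegligible.bilin_right (B := fun a b : ℝ => a * b) zero_le_one (fun a b => by simp) hx hy

theorem IsNegligible.of_eventuallyEq {x y : Idx → E} (h : x =ᶠ[atBot] y) :
    IsNegligible ρ (x - y) :=
  IsNegligible.zero.mono (y := (0 : Idx → E)) (h.mono fun ε hε => by simp [hε])

theorem IsNegligible.trans {x y z : Idx → E} (h : IsNegligible ρ (x - y))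
    (h' : IsNegligible ρ (y - z)) : IsNegligible ρ (x - z) := by
  simpa using h.add h'

theorem IsNegligible.symm {x y : Idx → E} (h : IsNegligible ρ (x - y)) :
    IsNegligible ρ (y - x) := by
  simpa using h.neg

theorem IsModerate.of_sub {x y : Idx → E} (hx : IsModerate ρ x) (h : IsNegligible ρ (x - y)) :
    IsModerate ρ y := by
  simpa using hx.add h.symm.isModerate

/-! ### Uniformity: properties of all nets of points of a net of sets -/

/-- If a net of properties holds, for `ε` small, along every net of points `z_ε ∈ K_ε`, then it
holds on the whole of `K_ε` for `ε` small: otherwise choose a counterexample for each `ε`. -/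
theorem eventually_forall_of_nets {X : Type*} {K : Idx → Set X} (hK : ∀ ε, (K ε).Nonempty)
    {p : Idx → X → Prop} (h : ∀ z : Idx → X, (∀ ε, z ε ∈ K ε) → ∀ᶠ ε in atBot, p ε (z ε)) :
    ∀ᶠ ε in atBot, ∀ x ∈ K ε, p ε x := by
  have hz : ∀ ε, ∃ z ∈ K ε, p ε z → ∀ x ∈ K ε, p ε x := fun ε => by
    by_cases hh : ∀ x ∈ K ε, p ε x
    · obtain ⟨z, hz⟩ := hK ε
      exact ⟨z, hz, fun _ => hh⟩
    · push Not at hh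
      obtain ⟨z, hz, hp⟩ := hh
      exact ⟨z, hz, fun h => absurd h hp⟩
  choose z hzK hz using hz
  filter_upwards [h z hzK] with ε hε using hz ε hε

/-- A net of maps that is moderate along every net of points of `K_ε` is uniformly moderate
on `K_ε`: choose points where the norm is large. -/
theorem exists_uniform_bound {X : Type*} {K : Idx → Set X} (hK : ∀ ε, (K ε).Nonempty)
    {g : Idx → X → E} (h : ∀ z : Idx → X, (∀ ε, z ε ∈ K ε) → IsModerate ρ (fun ε => g ε (z ε))) :
    ∃ M : Idx → ℝ, IsModerate ρ M ∧ (∀ ε, 0 ≤ M ε) ∧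
      ∀ᶠ ε in atBot, ∀ x ∈ K ε, ‖g ε x‖ ≤ M ε := by
  -- `exp (1 / ρ)` is larger than every moderate net
  have hz : ∀ ε, ∃ z ∈ K ε, (∀ x ∈ K ε, ‖g ε x‖ ≤ ‖g ε z‖ + 1) ∨
      Real.exp (ρ ε)⁻¹ ≤ ‖g ε z‖ := fun ε => by
    by_cases hb : ∃ z ∈ K ε, Real.exp (ρ ε)⁻¹ ≤ ‖g ε z‖
    · obtain ⟨z, hz, hzb⟩ := hb
      exact ⟨z, hz, .inr hzb⟩
    · push Not at hb
      have hbdd : BddAbove ((fun x => ‖g ε x‖) '' K ε) := by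
        refine ⟨Real.exp (ρ ε)⁻¹, ?_⟩
        rintro _ ⟨x, hx, rfl⟩
        exact (hb x hx).le
      obtain ⟨_, ⟨z, hz, rfl⟩, hlt⟩ := exists_lt_of_lt_csSup ((hK ε).image _)
        (sub_one_lt (sSup ((fun x => ‖g ε x‖) '' K ε)))
      refine ⟨z, hz, .inl fun x hx => ?_⟩
      have := le_csSup hbdd ⟨x, hx, rfl⟩
      simp only at this hlt
      linarith
  choose z hzK hz using hz
  have hm := h z hzK
  refine ⟨fun ε => ‖g ε (z ε)‖ + 1, hm.norm.add (IsModerate.const 1), fun ε => by positivity, ?_⟩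
  obtain ⟨N, hN⟩ := hm
  have hexp : ∀ᶠ ε in atBot, (ρ ε ^ N)⁻¹ < Real.exp (ρ ε)⁻¹ := by
    have h1 : Tendsto (fun ε => (ρ ε)⁻¹) atBot atTop :=
      tendsto_inv_nhdsGT_zero.comp (tendsto_nhdsWithin_iff.2
        ⟨ρ.tendsto_zero, .of_forall fun ε => ρ.pos ε⟩)
    have h2 := (Real.tendsto_exp_div_pow_atTop N).comp h1
    filter_upwards [h2.eventually (eventually_gt_atTop 1)] with ε hε
    simp only [Function.comp_apply] at hε
    rw [inv_pow, lt_div_iff₀ (inv_pos.2 (pow_pos (ρ.pos ε) N)), one_mul] at hε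
    exact hε
  filter_upwards [hN, hexp] with ε h1 h2 x hx
  rcases hz ε with h3 | h3
  · exact h3 x hx
  · exact absurd (h2.trans_le h3) (not_lt.2 h1)

theorem exists_uniform_negligible {X : Type*} {K : Idx → Set X} (hK : ∀ ε, (K ε).Nonempty)
    {g : Idx → X → E} (h : ∀ z : Idx → X, (∀ ε, z ε ∈ K ε) → IsNegligible ρ (fun ε => g ε (z ε)))
    (n : ℕ) : ∀ᶠ ε in atBot, ∀ x ∈ K ε, ‖g ε x‖ ≤ ρ ε ^ n :=
  eventually_forall_of_nets hK fun z hz => h z hz n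

/-- A bound `0 ≤ g` that holds up to a negligible error along every net of points of `K ε` holds
uniformly on `K ε`, up to a negligible error. -/
theorem exists_uniform_neg_part {X : Type*} {K : Idx → Set X} (hK : ∀ ε, (K ε).Nonempty)
    {g : Idx → X → ℝ}
    (h : ∀ z : Idx → X, (∀ ε, z ε ∈ K ε) → IsNegligible ρ (fun ε => max (-g ε (z ε)) 0))
    (n : ℕ) : ∀ᶠ ε in atBot, ∀ x ∈ K ε, -ρ ε ^ n ≤ g ε x := by
  filter_upwards [exists_uniform_negligible (g := fun ε x => max (-g ε x) 0) hK h n] with ε hε x hx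
  have h1 := hε x hx
  rw [Real.norm_of_nonneg (le_max_right _ _)] at h1
  linarith [le_max_left (-g ε x) 0]

end Nets

/-! ### Representatives of generalized points -/

namespace Gen

section Reps

variable {ρ : Gauge} {E F G : Type*} [NormedAddCommGroup E] [NormedAddCommGroup F]
  [NormedAddCommGroup G]

theorem exists_rep' (p : Gen ρ E) : ∃ x, Rep p x := by
  obtain ⟨x, hx, h⟩ := exists_rep p
  exact ⟨x, hx, h⟩

theorem rep_mk {x : Idx → E} (hx : IsModerate ρ x) : Rep (mk x hx) x := ⟨hx, rfl⟩

namespace Rep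

variable {p q : Gen ρ E} {x y : Idx → E}

theorem moderate (h : Rep p x) : IsModerate ρ x := h.1

theorem negl (h : Rep p x) (h' : Rep p y) : IsNegligible ρ (x - y) :=
  (mk_eq_mk h.1 h'.1).1 (h.2.trans h'.2.symm)

theorem eq_of_negl (h : Rep p x) (h' : Rep q y) (hxy : IsNegligible ρ (x - y)) : p = q := by
  rw [← h.2, ← h'.2]
  exact (mk_eq_mk h.1 h'.1).2 hxy

theorem unique (h : Rep p x) (h' : Rep q x) : p = q :=
  h.eq_of_negl h' (by simpa using IsNegligible.zero)

theorem of_negl (h : Rep p x) (hxy : IsNegligible ρ (x - y)) : Rep p y :=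
  ⟨h.1.of_sub hxy, (mk_eq_mk _ h.1).2 hxy.symm |>.trans h.2⟩

theorem congr (h : Rep p x) (hxy : x =ᶠ[atBot] y) : Rep p y :=
  h.of_negl (.of_eventuallyEq hxy)

theorem eq_of_eventuallyEq (h : Rep p x) (h' : Rep q y) (hxy : x =ᶠ[atBot] y) : p = q :=
  h.eq_of_negl h' (.of_eventuallyEq hxy)

theorem const (v : E) : Rep (Gen.const ρ v) (fun _ => v) := ⟨_, rfl⟩

theorem zero : Rep (0 : Gen ρ E) (fun _ => 0) := ⟨IsModerate.const 0, rfl⟩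

theorem one : Rep (1 : Gen ρ ℝ) (fun _ => 1) := ⟨IsModerate.const 1, rfl⟩

theorem add (h : Rep p x) (h' : Rep q y) : Rep (p + q) (fun ε => x ε + y ε) := by
  obtain ⟨hx, rfl⟩ := h
  obtain ⟨hy, rfl⟩ := h'
  exact ⟨hx.add hy, rfl⟩

theorem neg (h : Rep p x) : Rep (-p) (fun ε => -x ε) := by
  obtain ⟨hx, rfl⟩ := h
  exact ⟨hx.neg, rfl⟩

theorem sub (h : Rep p x) (h' : Rep q y) : Rep (p - q) (fun ε => x ε - y ε) := by
  simpa only [sub_eq_add_neg] using h.add h'.neg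

theorem sum {ι : Type*} (s : Finset ι) {p : ι → Gen ρ E} {x : ι → Idx → E}
    (h : ∀ i ∈ s, Rep (p i) (x i)) : Rep (∑ i ∈ s, p i) (fun ε => ∑ i ∈ s, x i ε) := by
  induction s using Finset.cons_induction with
  | empty => simpa using Rep.zero
  | cons a s ha ih =>
    simp only [Finset.sum_cons]
    exact (h a (by simp)).add (ih fun i hi => h i (by simp [hi]))

theorem lip (h : Rep p x) (g : E → F) (hg : ∃ C, LipschitzWith C g) :
    Rep (Gen.lip g hg p) (fun ε => g (x ε)) := by
  obtain ⟨hx, rfl⟩ := h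
  exact ⟨_, rfl⟩

theorem norm (h : Rep p x) : Rep (Gen.norm p) (fun ε => ‖x ε‖) := h.lip _ _

theorem mul {p q : Gen ρ ℝ} {x y : Idx → ℝ} (h : Rep p x) (h' : Rep q y) :
    Rep (p * q) (fun ε => x ε * y ε) := by
  obtain ⟨hx, rfl⟩ := h
  obtain ⟨hy, rfl⟩ := h'
  exact ⟨_, rfl⟩

theorem pow {p : Gen ρ ℝ} {x : Idx → ℝ} (h : Rep p x) (k : ℕ) :
    Rep (p ^ k) (fun ε => x ε ^ k) := by
  induction k with
  | zero => simpa using Rep.one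
  | succ k ih => simpa only [pow_succ] using ih.mul h

variable [NormedSpace ℝ E] [NormedSpace ℝ F] [NormedSpace ℝ G]

theorem bilin {r : Gen ρ F} {z : Idx → F} (h : Rep p x) (h' : Rep r z) (B : E × F → G)
    (hB : IsBoundedBilinearMap ℝ B) : Rep (Gen.bilin B hB p r) (fun ε => B (x ε, z ε)) := by
  obtain ⟨hx, rfl⟩ := h
  obtain ⟨hy, rfl⟩ := h'
  exact ⟨_, rfl⟩

theorem map (h : Rep p x) (A : E →L[ℝ] F) : Rep (Gen.map A p) (fun ε => A (x ε)) := h.lip _ _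

theorem smul {r : Gen ρ ℝ} {c : Idx → ℝ} (h : Rep r c) (h' : Rep p x) :
    Rep (r • p) (fun ε => c ε • x ε) := h.bilin h' _ isBoundedBilinearMap_smul

theorem pair {r : Gen ρ F} {z : Idx → F} (h : Rep p x) (h' : Rep r z) :
    Rep (Gen.pair p r) (fun ε => (x ε, z ε)) := by
  have := (h.map (ContinuousLinearMap.inl ℝ E F)).add (h'.map (ContinuousLinearMap.inr ℝ E F))
  have h2 : (fun ε => (x ε, z ε)) = fun ε => ContinuousLinearMap.inl ℝ E F (x ε) +
      ContinuousLinearMap.inr ℝ E F (z ε) := by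
    funext ε
    simp
  rw [h2]
  exact this

theorem fst {p : Gen ρ (E × F)} {x : Idx → E × F} (h : Rep p x) :
    Rep (Gen.fst p) (fun ε => (x ε).1) := h.map _

theorem snd {p : Gen ρ (E × F)} {x : Idx → E × F} (h : Rep p x) :
    Rep (Gen.snd p) (fun ε => (x ε).2) := h.map _

theorem tuple {n : ℕ} {p : Fin n → Gen ρ E} {x : Fin n → Idx → E} (h : ∀ i, Rep (p i) (x i)) :
    Rep (Gen.tuple p) (fun ε i => x i ε) := by
  have := Rep.sum Finset.univ fun i _ =>
    (h i).map (ContinuousLinearMap.single ℝ (fun _ : Fin n => E) i)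
  have h2 : (fun ε i => x i ε) = fun ε => ∑ i,
      ContinuousLinearMap.single ℝ (fun _ : Fin n => E) i (x i ε) :=
    funext fun ε => (Finset.univ_sum_single fun i => x i ε).symm
  rw [h2]
  exact this

theorem dot {E : Type*} [NormedAddCommGroup E] [InnerProductSpace ℝ E] {p q : Gen ρ E}
    {x y : Idx → E} (h : Rep p x) (h' : Rep q y) :
    Rep (Gen.dot p q) (fun ε => inner ℝ (x ε) (y ε)) := h.bilin h' _ isBoundedBilinearMap_inner

end Rep

end Reps

/-! ### Algebra of generalized points -/

section Algebra

variable {ρ : Gauge} {E F G : Type*} [NormedAddCommGroup E] [NormedAddCommGroup F]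
  [NormedAddCommGroup G] [NormedSpace ℝ E] [NormedSpace ℝ F] [NormedSpace ℝ G]

/-- `Gen ρ E` is a module over the ring of generalized numbers. -/
noncomputable instance : Module (Gen ρ ℝ) (Gen ρ E) where
  one_smul p := by
    obtain ⟨x, hx⟩ := exists_rep' p
    exact (Rep.one.smul hx).unique (by simpa using hx)
  mul_smul a b p := by
    obtain ⟨x, hx⟩ := exists_rep' p
    obtain ⟨c, hc⟩ := exists_rep' a
    obtain ⟨d, hd⟩ := exists_rep' b
    exact ((hc.mul hd).smul hx).unique (by simpa only [mul_smul] using hc.smul (hd.smul hx))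
  smul_zero a := by
    obtain ⟨c, hc⟩ := exists_rep' a
    exact (hc.smul Rep.zero).unique (by simpa using Rep.zero)
  smul_add a p q := by
    obtain ⟨c, hc⟩ := exists_rep' a
    obtain ⟨x, hx⟩ := exists_rep' p
    obtain ⟨y, hy⟩ := exists_rep' q
    exact (hc.smul (hx.add hy)).unique (by simpa using (hc.smul hx).add (hc.smul hy))
  add_smul a b p := by
    obtain ⟨x, hx⟩ := exists_rep' p
    obtain ⟨c, hc⟩ := exists_rep' a
    obtain ⟨d, hd⟩ := exists_rep' b
    exact ((hc.add hd).smul hx).unique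
      (by simpa only [add_smul] using (hc.smul hx).add (hd.smul hx))
  zero_smul p := by
    obtain ⟨x, hx⟩ := exists_rep' p
    exact (Rep.zero.smul hx).unique (by simpa using Rep.zero)

/-- `bilin B` as a biadditive map. -/
noncomputable def bilinHom (B : E × F → G) (hB : IsBoundedBilinearMap ℝ B) :
    Gen ρ E →+ Gen ρ F →+ Gen ρ G :=
  AddMonoidHom.mk' (fun p => AddMonoidHom.mk' (bilin B hB p) fun q r => by
    obtain ⟨x, hx⟩ := exists_rep' p
    obtain ⟨y, hy⟩ := exists_rep' q
    obtain ⟨z, hz⟩ := exists_rep' r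
    refine (hx.bilin (hy.add hz) B hB).unique ?_
    simpa only [hB.add_right] using (hx.bilin hy B hB).add (hx.bilin hz B hB)) fun p q => by
    ext r
    obtain ⟨x, hx⟩ := exists_rep' p
    obtain ⟨y, hy⟩ := exists_rep' q
    obtain ⟨z, hz⟩ := exists_rep' r
    refine ((hx.add hy).bilin hz B hB).unique ?_
    simp only [hB.add_left]
    exact (hx.bilin hz B hB).add (hy.bilin hz B hB)

@[simp] theorem fst_pair (p : Gen ρ E) (q : Gen ρ F) : fst (pair p q) = p := by
  obtain ⟨x, hx⟩ := exists_rep' p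
  obtain ⟨y, hy⟩ := exists_rep' q
  exact (hx.pair hy).fst.unique hx

@[simp] theorem snd_pair (p : Gen ρ E) (q : Gen ρ F) : snd (pair p q) = q := by
  obtain ⟨x, hx⟩ := exists_rep' p
  obtain ⟨y, hy⟩ := exists_rep' q
  exact (hx.pair hy).snd.unique hy

@[simp] theorem pair_eta (z : Gen ρ (E × F)) : pair (fst z) (snd z) = z := by
  obtain ⟨x, hx⟩ := exists_rep' z
  exact (hx.fst.pair hx.snd).unique hx

theorem pair_mem_prod {A : Set (Gen ρ E)} {B : Set (Gen ρ F)} {p : Gen ρ E} {q : Gen ρ F}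
    (hp : p ∈ A) (hq : q ∈ B) : pair p q ∈ prod A B := by
  simpa [prod] using ⟨hp, hq⟩

/-- The action of a generalized linear map on a generalized point. -/
noncomputable def app (A : Gen ρ (E →L[ℝ] F)) (p : Gen ρ E) : Gen ρ F :=
  bilin (fun z : (E →L[ℝ] F) × E => z.1 z.2) isBoundedBilinearMap_apply A p

theorem Rep.app {A : Gen ρ (E →L[ℝ] F)} {p : Gen ρ E} {a : Idx → E →L[ℝ] F} {x : Idx → E}
    (hA : Rep A a) (hp : Rep p x) : Rep (app A p) (fun ε => a ε (x ε)) :=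
  hA.bilin hp _ isBoundedBilinearMap_apply

section Dot

variable {E : Type*} [NormedAddCommGroup E] [InnerProductSpace ℝ E]

theorem dot_sub (p q r : Gen ρ E) : dot p (q - r) = dot p q - dot p r :=
  map_sub (bilinHom (fun z : E × E => inner ℝ z.1 z.2) isBoundedBilinearMap_inner p) q r

theorem sub_dot (p q r : Gen ρ E) : dot (p - q) r = dot p r - dot q r := by
  have := map_sub (bilinHom (fun z : E × E => inner ℝ z.1 z.2) isBoundedBilinearMap_inner) p q
  exact DFunLike.congr_fun this r

theorem dot_zero (p : Gen ρ E) : dot p 0 = 0 :=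
  map_zero (bilinHom (fun z : E × E => inner ℝ z.1 z.2) isBoundedBilinearMap_inner p)

theorem zero_dot (p : Gen ρ E) : dot 0 p = 0 := by
  have := map_zero (bilinHom (ρ := ρ) (fun z : E × E => inner ℝ z.1 z.2) isBoundedBilinearMap_inner)
  exact DFunLike.congr_fun this p

theorem dot_smul (a : Gen ρ ℝ) (p q : Gen ρ E) : dot p (a • q) = a * dot p q := by
  obtain ⟨c, hc⟩ := exists_rep' a
  obtain ⟨x, hx⟩ := exists_rep' p
  obtain ⟨y, hy⟩ := exists_rep' q
  refine (hx.dot (hc.smul hy)).unique ?_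
  simpa only [real_inner_smul_right] using hc.mul (hx.dot hy)

/-- The scalar product is definite. -/
theorem eq_zero_of_dot_self {p : Gen ρ E} (h : dot p p = 0) : p = 0 := by
  obtain ⟨x, hx⟩ := exists_rep' p
  have h1 := (hx.dot hx).negl (h ▸ Rep.zero)
  refine hx.eq_of_negl .zero fun n => ?_
  filter_upwards [h1 (n * 2)] with ε hε
  simp only [Pi.sub_apply, sub_zero, real_inner_self_eq_norm_sq] at hε ⊢
  rw [Real.norm_of_nonneg (by positivity), pow_mul] at hε
  exact (sq_le_sq₀ (norm_nonneg _) (pow_pos (ρ.pos ε) n).le).1 hε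

end Dot

/-- The ring of generalized numbers is reduced. -/
theorem eq_zero_of_mul_self {a : Gen ρ ℝ} (h : a * a = 0) : a = 0 := by
  refine eq_zero_of_dot_self ?_
  obtain ⟨x, hx⟩ := exists_rep' a
  rw [← h]
  exact (hx.dot hx).unique (hx.mul hx)

/-! ### Order and invertibility of generalized numbers -/

theorem isUnit_iff {p : Gen ρ ℝ} {x : Idx → ℝ} (hx : Rep p x) :
    IsUnit p ↔ ∃ N : ℕ, ∀ᶠ ε in atBot, ρ ε ^ N ≤ |x ε| := by
  constructor
  · intro h
    obtain ⟨q, hq⟩ := h.exists_right_inv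
    obtain ⟨y, hy⟩ := exists_rep' q
    have h1 := (hx.mul hy).negl (hq ▸ Rep.one)
    obtain ⟨N, hN⟩ := hy.moderate
    refine ⟨N + 1, ?_⟩
    filter_upwards [h1 1, hN, ρ.eventually_lt (c := 1 / 2) (by norm_num)] with ε h2 h3 h4
    simp only [Pi.sub_apply, pow_one, Real.norm_eq_abs] at h2 h3
    rw [le_inv_pow_iff] at h3
    have h5 : 1 / 2 ≤ |x ε| * |y ε| := by
      rw [← abs_mul]
      have := abs_sub_abs_le_abs_sub 1 (x ε * y ε)
      rw [abs_sub_comm, abs_one] at this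
      linarith
    have hpos := pow_pos (ρ.pos ε) N
    calc ρ ε ^ (N + 1) = ρ ε ^ N * ρ ε := pow_succ _ _
      _ ≤ ρ ε ^ N * (|x ε| * |y ε|) := by gcongr; linarith
      _ = |x ε| * (|y ε| * ρ ε ^ N) := by ring
      _ ≤ |x ε| * 1 := by gcongr
      _ = |x ε| := mul_one _
  · rintro ⟨N, hN⟩
    have hm : IsModerate ρ (fun ε => (x ε)⁻¹) := ⟨N, by
      filter_upwards [hN] with ε hε
      rw [norm_inv]
      exact inv_anti₀ (pow_pos (ρ.pos ε) N) hε⟩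
    refine IsUnit.of_mul_eq_one (mk _ hm) ((hx.mul (rep_mk hm)).eq_of_eventuallyEq .one ?_)
    filter_upwards [hN] with ε hε
    refine mul_inv_cancel₀ fun h0 => ?_
    rw [h0, abs_zero] at hε
    exact absurd hε (not_le.2 (pow_pos (ρ.pos ε) N))

theorem rep_inverse {p : Gen ρ ℝ} {x : Idx → ℝ} (hp : IsUnit p) (hx : Rep p x) :
    Rep (Ring.inverse p) (fun ε => (x ε)⁻¹) := by
  obtain ⟨N, hN⟩ := (isUnit_iff hx).1 hp
  have hm : IsModerate ρ (fun ε => (x ε)⁻¹) := ⟨N, by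
    filter_upwards [hN] with ε hε
    rw [norm_inv]
    exact inv_anti₀ (pow_pos (ρ.pos ε) N) hε⟩
  have h : p * mk _ hm = 1 := by
    refine (hx.mul (rep_mk hm)).eq_of_eventuallyEq .one ?_
    filter_upwards [hN] with ε hε
    refine mul_inv_cancel₀ fun h0 => ?_
    rw [h0, abs_zero] at hε
    exact absurd hε (not_le.2 (pow_pos (ρ.pos ε) N))
  have : Ring.inverse p = mk _ hm := by
    rw [← one_mul (mk _ hm), ← Ring.inverse_mul_cancel p hp, mul_assoc, h, mul_one]
  exact this ▸ rep_mk hm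

theorem le_iff {p q : Gen ρ ℝ} {x y : Idx → ℝ} (hx : Rep p x) (hy : Rep q y) :
    p ≤ q ↔ IsNegligible ρ (fun ε => max (x ε - y ε) 0) := by
  constructor
  · rintro ⟨x', y', hx', hy', h⟩
    refine ((hx.negl hx').add (hy'.negl hy)).mono (.of_forall fun ε => ?_)
    simp only [Pi.add_apply, Pi.sub_apply, Real.norm_eq_abs]
    rw [abs_of_nonneg (le_max_right _ _)]
    refine max_le ((le_abs_self _).trans' ?_) (abs_nonneg _)
    linarith [h ε]
  · intro h
    refine ⟨x, fun ε => max (x ε) (y ε), hx, hy.of_negl (h.mono (.of_forall fun ε => ?_)),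
      fun ε => le_max_left _ _⟩
    simp only [Pi.sub_apply, Real.norm_eq_abs]
    rw [abs_sub_comm, abs_of_nonneg (by simp), abs_of_nonneg (le_max_right _ _)]
    rcases le_total (x ε) (y ε) with h1 | h1 <;> simp [h1]

theorem le_antisymm' {p q : Gen ρ ℝ} (h : p ≤ q) (h' : q ≤ p) : p = q := by
  obtain ⟨x, hx⟩ := exists_rep' p
  obtain ⟨y, hy⟩ := exists_rep' q
  refine hx.eq_of_negl hy ((((le_iff hx hy).1 h).add ((le_iff hy hx).1 h')).mono
    (.of_forall fun ε => ?_))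
  simp only [Pi.sub_apply, Pi.add_apply, Real.norm_eq_abs]
  rw [abs_of_nonneg (a := _ + _) (by positivity)]
  refine abs_le.2 ⟨?_, ?_⟩
  · linarith [le_max_left (y ε - x ε) 0, le_max_right (x ε - y ε) 0]
  · linarith [le_max_left (x ε - y ε) 0, le_max_right (y ε - x ε) 0]

theorem le_of_rep {p q : Gen ρ ℝ} {x y : Idx → ℝ} (hx : Rep p x) (hy : Rep q y)
    (h : ∀ ε, x ε ≤ y ε) : p ≤ q := ⟨x, y, hx, hy, h⟩

/-- An interval `[a,b]` has endpoints with representatives at a distance at least `ρ_ε^N`. -/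
theorem exists_rep_lt {a b : Gen ρ ℝ} (h : a < b) : ∃ x y, Rep a x ∧ Rep b y ∧
    (∀ ε, x ε ≤ y ε) ∧ ∃ N : ℕ, ∀ᶠ ε in atBot, ρ ε ^ N ≤ y ε - x ε := by
  obtain ⟨⟨x, y, hx, hy, hxy⟩, hu⟩ := h
  obtain ⟨N, hN⟩ := (isUnit_iff (hx.sub hy)).1 hu
  refine ⟨x, y, hx, hy, hxy, N, ?_⟩
  filter_upwards [hN] with ε hε
  rwa [abs_sub_comm, abs_of_nonneg (sub_nonneg.2 (hxy ε))] at hε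

/-- Points of an interval have representatives between those of its endpoints. -/
theorem exists_rep_mem_Icc {a b t : Gen ρ ℝ} {x y : Idx → ℝ} (hx : Rep a x) (hy : Rep b y)
    (hxy : ∀ ε, x ε ≤ y ε) (ht : t ∈ Icc a b) : ∃ z, Rep t z ∧ ∀ ε, z ε ∈ Set.Icc (x ε) (y ε) := by
  obtain ⟨z, hz⟩ := exists_rep' t
  refine ⟨fun ε => max (x ε) (min (y ε) (z ε)), hz.of_negl ((((le_iff hx hz).1 ht.1).add
    ((le_iff hz hy).1 ht.2)).mono (.of_forall fun ε => ?_)), fun ε => ⟨le_max_left _ _,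
      max_le (hxy ε) (min_le_left _ _)⟩⟩
  simp only [Pi.sub_apply, Pi.add_apply, Real.norm_eq_abs]
  rw [abs_of_nonneg (a := _ + _) (by positivity)]
  rcases le_total (y ε) (z ε) with h1 | h1
  · rw [min_eq_left h1, max_eq_right (hxy ε), abs_of_nonneg (by linarith)]
    linarith [le_max_left (z ε - y ε) 0, le_max_right (x ε - z ε) 0]
  · rw [min_eq_right h1]
    rcases le_total (x ε) (z ε) with h2 | h2
    · rw [max_eq_right h2, sub_self, abs_zero]
      positivity
    · rw [max_eq_left h2, abs_of_nonpos (by linarith)]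
      linarith [le_max_left (x ε - z ε) 0, le_max_right (z ε - y ε) 0]

/-- A net between representatives of two points of an interval represents a point of it. -/
theorem mem_Icc_of_between {a b t t' : Gen ρ ℝ} {z z' w : Idx → ℝ} (ht : t ∈ Icc a b)
    (ht' : t' ∈ Icc a b) (hz : Rep t z) (hz' : Rep t' z') (hw : ∀ ε, w ε ∈ Set.uIcc (z ε) (z' ε)) :
    ∃ p ∈ Icc a b, Rep p w := by
  obtain ⟨x, hx⟩ := exists_rep' a
  obtain ⟨y, hy⟩ := exists_rep' b
  have hm : IsModerate ρ w := by
    refine (hz.moderate.norm.add hz'.moderate.norm).mono (.of_forall fun ε => ?_)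
    simp only [Pi.add_apply, Real.norm_eq_abs]
    rw [abs_of_nonneg (a := _ + _) (by positivity)]
    have h := Set.mem_uIcc.1 (hw ε)
    have := abs_le.1 (le_refl |z ε|)
    have := abs_le.1 (le_refl |z' ε|)
    rw [abs_le]
    rcases h with h | h <;> constructor <;> linarith [abs_nonneg (z ε), abs_nonneg (z' ε)]
  refine ⟨mk w hm, ⟨(le_iff hx (rep_mk hm)).2 ((((le_iff hx hz).1 ht.1).add
    ((le_iff hx hz').1 ht'.1)).mono (.of_forall fun ε => ?_)), (le_iff (rep_mk hm) hy).2
    ((((le_iff hz hy).1 ht.2).add ((le_iff hz' hy).1 ht'.2)).mono (.of_forall fun ε => ?_))⟩,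
    rep_mk hm⟩
  all_goals
    simp only [Pi.add_apply, Real.norm_eq_abs]
    rw [abs_of_nonneg (a := _ + _) (by positivity), abs_of_nonneg (le_max_right _ _)]
    refine max_le ?_ (by positivity)
    have h := Set.mem_uIcc.1 (hw ε)
  · have := le_max_left (x ε - z ε) 0
    have := le_max_left (x ε - z' ε) 0
    have := le_max_right (x ε - z ε) 0
    have := le_max_right (x ε - z' ε) 0
    rcases h with h | h <;> linarith
  · have := le_max_left (z ε - y ε) 0
    have := le_max_left (z' ε - y ε) 0
    have := le_max_right (z ε - y ε) 0
    have := le_max_right (z' ε - y ε) 0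
    rcases h with h | h <;> linarith

theorem left_mem_Icc {a b : Gen ρ ℝ} (h : a ≤ b) : a ∈ Icc a b := by
  obtain ⟨x, hx⟩ := exists_rep' a
  exact ⟨le_of_rep hx hx fun _ => le_rfl, h⟩

theorem right_mem_Icc {a b : Gen ρ ℝ} (h : a ≤ b) : b ∈ Icc a b := by
  obtain ⟨x, hx⟩ := exists_rep' b
  exact ⟨h, le_of_rep hx hx fun _ => le_rfl⟩

end Algebra

end Gen

/-! ### Closure properties of generalized smooth functions -/

section Smooth

open Gen

variable {ρ : Gauge} {E F G H : Type*} [NormedAddCommGroup E] [NormedSpace ℝ E]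
  [NormedAddCommGroup F] [NormedSpace ℝ F] [NormedAddCommGroup G] [NormedSpace ℝ G]
  [NormedAddCommGroup H] [NormedSpace ℝ H]
  {X : Set (Gen ρ E)} {Y : Set (Gen ρ F)} {f : Gen ρ E → Gen ρ F} {g : Gen ρ F → Gen ρ G}
  {Ω : Idx → Set E} {u : Idx → E → F}

/-- A net of smooth functions whose first derivatives are moderate at the points of `X` takes
values independent, up to negligible nets, of the representative: by the mean value inequality on
the segment between two representatives. -/
theorem isNegligible_sub_of_rep (hΩ : ∀ ε, IsOpen (Ω ε)) (hu : ∀ ε, ContDiffOn ℝ ∞ (u ε) (Ω ε))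
    (hX : X ⊆ stronglyInternal ρ Ω)
    (hm : ∀ p ∈ X, ∀ x, Rep p x → IsModerate ρ (fun ε => iteratedFDeriv ℝ 1 (u ε) (x ε)))
    {p : Gen ρ E} (hp : p ∈ X) {x y : Idx → E} (hx : Rep p x) (hy : Rep p y) :
    IsNegligible ρ ((fun ε => u ε (x ε)) - fun ε => u ε (y ε)) := by
  have hK : ∀ ε, (segment ℝ (x ε) (y ε)).Nonempty := fun ε => ⟨_, left_mem_segment ℝ _ _⟩
  have hrep : ∀ z : Idx → E, (∀ ε, z ε ∈ segment ℝ (x ε) (y ε)) → Rep p z := fun z hz =>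
    hx.of_negl ((hy.negl hx).mono (.of_forall fun ε => by
      simp only [Pi.sub_apply]
      rw [norm_sub_rev]
      exact norm_sub_le_of_mem_segment (hz ε)))
  have h1 := eventually_forall_of_nets hK (p := fun ε z => z ∈ Ω ε) fun z hz =>
    hX hp z (hrep z hz)
  obtain ⟨M, hM, hM0, h2⟩ := exists_uniform_bound hK
    (g := fun ε z => iteratedFDeriv ℝ 1 (u ε) z) fun z hz => hm p hp z (hrep z hz)
  have h3 : IsNegligible ρ (fun ε => M ε * ‖x ε - y ε‖) :=
    IsNegligible.mul_left hM ((hx.negl hy).mono (.of_forall fun ε => by simp))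
  refine h3.mono ?_
  filter_upwards [h1, h2] with ε hε hε'
  rw [Real.norm_of_nonneg (mul_nonneg (hM0 ε) (norm_nonneg _))]
  refine Convex.norm_image_sub_le_of_norm_fderiv_le (𝕜 := ℝ) (s := segment ℝ (x ε) (y ε))
    (fun z hz => ?_) (fun z hz => ?_) (convex_segment _ _) (right_mem_segment ℝ _ _)
    (left_mem_segment ℝ _ _)
  · exact ((hu ε).contDiffAt ((hΩ ε).mem_nhds (hε z hz))).differentiableAt (by simp)
  · rw [← norm_iteratedFDeriv_one]
    exact hε' z hz

theorem moderate_of_iteratedFDeriv_zero {x : Idx → E}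
    (h : IsModerate ρ (fun ε => iteratedFDeriv ℝ 0 (u ε) (x ε))) :
    IsModerate ρ (fun ε => u ε (x ε)) :=
  h.mono (.of_forall fun ε => by rw [norm_iteratedFDeriv_zero])

/-- Nets of smooth functions with moderate derivatives at the points of `X` define generalized
smooth functions on `X`. -/
theorem exists_defines (hΩ : ∀ ε, IsOpen (Ω ε)) (hu : ∀ ε, ContDiffOn ℝ ∞ (u ε) (Ω ε))
    (hX : X ⊆ stronglyInternal ρ Ω)
    (hm : ∀ p ∈ X, ∀ x, Rep p x → ∀ k : ℕ, IsModerate ρ (fun ε => iteratedFDeriv ℝ k (u ε) (x ε))) :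
    ∃ f : Gen ρ E → Gen ρ F, Defines X f Ω u := by
  classical
  choose r hr using fun p : Gen ρ E => exists_rep' p
  refine ⟨fun p => if h : p ∈ X then
    mk (fun ε => u ε (r p ε)) (moderate_of_iteratedFDeriv_zero (hm p h _ (hr p) 0)) else 0,
    hΩ, hu, hX, hm, fun p hp x hx => ?_⟩
  rw [dif_pos hp]
  exact (rep_mk _).of_negl
    (isNegligible_sub_of_rep hΩ hu hX (fun p hp x hx => hm p hp x hx 1) hp (hr p) hx)

namespace Defines

theorem contDiffAt (h : Defines X f Ω u) {ε : Idx} {x : E} (hx : x ∈ Ω ε) :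
    ContDiffAt ℝ ∞ (u ε) x := (h.smooth ε).contDiffAt ((h.isOpen ε).mem_nhds hx)

theorem differentiableAt (h : Defines X f Ω u) {ε : Idx} {x : E} (hx : x ∈ Ω ε) :
    DifferentiableAt ℝ (u ε) x := (h.contDiffAt hx).differentiableAt (by simp)

theorem mono (h : Defines X f Ω u) {X' : Set (Gen ρ E)} (hX : X' ⊆ X) : Defines X' f Ω u :=
  ⟨h.isOpen, h.smooth, hX.trans h.subset, fun p hp => h.moderate p (hX hp),
    fun p hp => h.value p (hX hp)⟩

theorem congr (h : Defines X f Ω u) {f' : Gen ρ E → Gen ρ F} (hf : ∀ p ∈ X, f p = f' p) :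
    Defines X f' Ω u :=
  ⟨h.isOpen, h.smooth, h.subset, h.moderate, fun p hp => hf p hp ▸ h.value p hp⟩

/-- The net of differentials of a net of smooth functions defines a generalized smooth function. -/
theorem exists_fderiv (h : Defines X f Ω u) :
    ∃ Df : Gen ρ E → Gen ρ (E →L[ℝ] F), Defines X Df Ω (fun ε => _root_.fderiv ℝ (u ε)) := by
  refine exists_defines h.isOpen (fun ε => (h.smooth ε).fderiv_of_isOpen (h.isOpen ε) (by simp))
    h.subset fun p hp x hx k => ?_
  exact (h.moderate p hp x hx (k + 1)).mono (.of_forall fun ε => by rw [norm_iteratedFDeriv_fderiv])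

/-- The directional derivatives along representatives of a point and of a direction represent
a generalized point that does not depend on them. -/
theorem isNegligible_fderiv_sub (h : Defines X f Ω u) {p v : Gen ρ E} (hp : p ∈ X)
    {x x' y y' : Idx → E}
    (hx : Rep p x) (hx' : Rep p x') (hy : Rep v y) (hy' : Rep v y') :
    IsNegligible ρ ((fun ε => _root_.fderiv ℝ (u ε) (x ε) (y ε)) -
      fun ε => _root_.fderiv ℝ (u ε) (x' ε) (y' ε)) := by
  obtain ⟨Df, hDf⟩ := h.exists_fderiv
  exact ((hDf.value p hp x hx).app hy).negl ((hDf.value p hp x' hx').app hy')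

theorem comp {Ω' : Idx → Set F} {w : Idx → F → G} (hg : Defines Y g Ω' w) (hf : Defines X f Ω u)
    (hXY : Set.MapsTo f X Y) :
    Defines X (fun p => g (f p)) (fun ε => Ω ε ∩ u ε ⁻¹' Ω' ε) (fun ε => w ε ∘ u ε) := by
  have hopen : ∀ ε, IsOpen (Ω ε ∩ u ε ⁻¹' Ω' ε) := fun ε =>
    (hf.smooth ε).continuousOn.isOpen_inter_preimage (hf.isOpen ε) (hg.isOpen ε)
  have hmem : ∀ p ∈ X, ∀ x, Rep p x → ∀ᶠ ε in atBot, x ε ∈ Ω ε ∩ u ε ⁻¹' Ω' ε :=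
    fun p hp x hx => by
      filter_upwards [hf.subset hp x hx, hg.subset (hXY hp) _ (hf.value p hp x hx)] with ε h1 h2
        using ⟨h1, h2⟩
  refine ⟨hopen, fun ε => (hg.smooth ε).comp ((hf.smooth ε).mono Set.inter_subset_left)
    fun x hx => hx.2, fun p hp => hmem p hp, fun p hp x hx k => ?_, fun p hp x hx =>
    hg.value _ (hXY hp) _ (hf.value p hp x hx)⟩
  set C : Idx → ℝ := fun ε => ∑ i ∈ Finset.range (k + 1), ‖iteratedFDeriv ℝ i (w ε) (u ε (x ε))‖
  set D : Idx → ℝ := fun ε => 1 + ∑ i ∈ Finset.range (k + 1), ‖iteratedFDeriv ℝ i (u ε) (x ε)‖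
  have hC : IsModerate ρ C := IsModerate.sum _ fun i _ =>
    (hg.moderate _ (hXY hp) _ (hf.value p hp x hx) i).norm
  have hD : IsModerate ρ D := (IsModerate.const 1).add (IsModerate.sum _ fun i _ =>
    (hf.moderate p hp x hx i).norm)
  refine (((IsModerate.const ((k.factorial : ℕ) : ℝ)).mul hC).mul (hD.pow k)).mono ?_
  filter_upwards [hmem p hp x hx] with ε hε
  have hD1 : 1 ≤ D ε := le_add_of_nonneg_right (Finset.sum_nonneg fun i _ => norm_nonneg _)
  rw [← iteratedFDerivWithin_of_isOpen k (hopen ε) hε]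
  refine (norm_iteratedFDerivWithin_comp_le (hg.smooth ε)
    ((hf.smooth ε).mono Set.inter_subset_left) (by exact_mod_cast le_top)
    (hg.isOpen ε).uniqueDiffOn (hopen ε).uniqueDiffOn (fun x hx => hx.2) hε
    (C := C ε) (D := D ε) (fun i hi => ?_) fun i hi hi' => ?_).trans (le_abs_self _)
  · rw [iteratedFDerivWithin_of_isOpen i (hg.isOpen ε) hε.2]
    exact Finset.single_le_sum (f := fun i => ‖iteratedFDeriv ℝ i (w ε) (u ε (x ε))‖)
      (fun i _ => norm_nonneg _) (Finset.mem_range.2 (Nat.lt_succ_of_le hi))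
  · rw [iteratedFDerivWithin_of_isOpen i (hopen ε) hε]
    refine le_trans ?_ (le_self_pow₀ hD1 (by omega))
    refine le_trans ?_ (le_add_of_nonneg_left zero_le_one)
    exact Finset.single_le_sum (f := fun i => ‖iteratedFDeriv ℝ i (u ε) (x ε)‖)
      (fun i _ => norm_nonneg _) (Finset.mem_range.2 (Nat.lt_succ_of_le hi'))

theorem map (h : Defines X f Ω u) (A : F →L[ℝ] G) :
    Defines X (fun p => Gen.map A (f p)) Ω (fun ε => A ∘ u ε) := by
  refine ⟨h.isOpen, fun ε => A.contDiff.comp_contDiffOn (h.smooth ε), h.subset,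
    fun p hp x hx k => ?_, fun p hp x hx => (h.value p hp x hx).map A⟩
  refine ((IsModerate.const ‖A‖).mul (h.moderate p hp x hx k).norm).mono ?_
  filter_upwards [h.subset hp x hx] with ε hε
  exact (A.norm_iteratedFDeriv_comp_left (h.contDiffAt hε) (by exact_mod_cast le_top)).trans
    (le_abs_self _)

theorem add {f' : Gen ρ E → Gen ρ F} {Ω' : Idx → Set E} {u' : Idx → E → F} (h : Defines X f Ω u)
    (h' : Defines X f' Ω' u') :
    Defines X (fun p => f p + f' p) (fun ε => Ω ε ∩ Ω' ε) (fun ε => u ε + u' ε) := by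
  refine ⟨fun ε => (h.isOpen ε).inter (h'.isOpen ε), fun ε =>
    ((h.smooth ε).mono Set.inter_subset_left).add ((h'.smooth ε).mono Set.inter_subset_right),
    fun p hp x hx => (h.subset hp x hx).and (h'.subset hp x hx), fun p hp x hx k => ?_,
    fun p hp x hx => (h.value p hp x hx).add (h'.value p hp x hx)⟩
  refine ((h.moderate p hp x hx k).add (h'.moderate p hp x hx k)).mono ?_
  filter_upwards [h.subset hp x hx, h'.subset hp x hx] with ε h1 h2
  rw [iteratedFDeriv_add_apply ((h.contDiffAt h1).of_le (by exact_mod_cast le_top))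
    ((h'.contDiffAt h2).of_le (by exact_mod_cast le_top))]
  rfl

theorem bilin {g' : Gen ρ E → Gen ρ G} {Ω' : Idx → Set E} {w : Idx → E → G}
    (h : Defines X f Ω u) (h' : Defines X g' Ω' w) (B : F × G → H)
    (hB : IsBoundedBilinearMap ℝ B) :
    Defines X (fun p => Gen.bilin B hB (f p) (g' p)) (fun ε => Ω ε ∩ Ω' ε)
      (fun ε x => B (u ε x, w ε x)) := by
  have hopen : ∀ ε, IsOpen (Ω ε ∩ Ω' ε) := fun ε => (h.isOpen ε).inter (h'.isOpen ε)
  refine ⟨hopen, fun ε => hB.contDiff.comp_contDiffOn (((h.smooth ε).mono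
    Set.inter_subset_left).prodMk ((h'.smooth ε).mono Set.inter_subset_right)),
    fun p hp x hx => (h.subset hp x hx).and (h'.subset hp x hx), fun p hp x hx k => ?_,
    fun p hp x hx => (h.value p hp x hx).bilin (h'.value p hp x hx) B hB⟩
  refine ((IsModerate.const ‖hB.toContinuousLinearMap‖).mul
    (IsModerate.sum (Finset.range (k + 1)) fun i _ =>
      ((IsModerate.const ((k.choose i : ℕ) : ℝ)).mul (h.moderate p hp x hx i).norm).mul
        (h'.moderate p hp x hx (k - i)).norm)).mono ?_
  filter_upwards [h.subset hp x hx, h'.subset hp x hx] with ε h1 h2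
  refine le_trans ?_ (le_abs_self _)
  have := hB.toContinuousLinearMap.norm_iteratedFDerivWithin_le_of_bilinear
    ((h.smooth ε).mono Set.inter_subset_left) ((h'.smooth ε).mono Set.inter_subset_right)
    (hopen ε).uniqueDiffOn ⟨h1, h2⟩ (n := k) (by exact_mod_cast le_top)
  simp only [iteratedFDerivWithin_of_isOpen _ (hopen ε) ⟨h1, h2⟩] at this
  exact this

theorem const (X : Set (Gen ρ E)) {c : Gen ρ F} {y : Idx → F} (hc : Rep c y) :
    Defines X (fun _ => c) (fun _ => Set.univ) (fun ε _ => y ε) := by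
  refine ⟨fun _ => isOpen_univ, fun _ => contDiffOn_const,
    fun p _ x _ => .of_forall fun _ => trivial,
    fun p hp x hx k => hc.moderate.mono (.of_forall fun ε => ?_), fun p hp x hx => hc⟩
  rcases Nat.eq_zero_or_pos k with rfl | hk
  · rw [norm_iteratedFDeriv_zero]
  · rw [iteratedFDeriv_const_of_ne (by omega)]
    simp

theorem id (X : Set (Gen ρ E)) :
    Defines X (fun p => p) (fun _ => Set.univ) (fun _ x => x) := by
  refine ⟨fun _ => isOpen_univ, fun _ => contDiffOn_id, fun p _ x _ => .of_forall fun _ => trivial,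
    fun p hp x hx k => ?_, fun p hp x hx => hx⟩
  rcases k with - | k
  · exact hx.moderate.mono (.of_forall fun ε => by rw [norm_iteratedFDeriv_zero])
  · refine (IsModerate.const (ContinuousLinearMap.id ℝ E)).mono (.of_forall fun ε => ?_)
    have h1 : _root_.fderiv ℝ (fun x : E => x) = fun _ => ContinuousLinearMap.id ℝ E :=
      funext fun x => fderiv_fun_id
    rw [← norm_iteratedFDeriv_fderiv, h1]
    rcases Nat.eq_zero_or_pos k with rfl | hk
    · rw [norm_iteratedFDeriv_zero]
    · rw [iteratedFDeriv_const_of_ne (by omega)]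
      simp

theorem inverse : Defines {p : Gen ρ ℝ | IsUnit p} Ring.inverse (fun _ => {0}ᶜ)
    (fun _ => Inv.inv) := by
  have hmem : ∀ p : Gen ρ ℝ, IsUnit p → ∀ x, Rep p x → ∀ᶠ ε in atBot, x ε ≠ 0 := fun p hp x hx => by
    obtain ⟨N, hN⟩ := (isUnit_iff hx).1 hp
    filter_upwards [hN] with ε hε h0
    rw [h0, abs_zero] at hε
    exact absurd hε (not_le.2 (pow_pos (ρ.pos ε) N))
  refine ⟨fun _ => isOpen_compl_singleton, fun _ => contDiffOn_inv ℝ,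
    fun p hp x hx => hmem p hp x hx,
    fun p hp x hx k => ?_, fun p hp x hx => rep_inverse hp hx⟩
  refine ((IsModerate.const ((k.factorial : ℕ) : ℝ)).mul
    ((rep_inverse hp hx).moderate.pow (k + 1))).mono (.of_forall fun ε => ?_)
  rw [norm_iteratedFDeriv_eq_norm_iteratedDeriv, iteratedDeriv_eq_iterate, iter_deriv_inv, norm_mul,
    norm_mul, norm_pow, norm_neg, norm_one, one_pow, one_mul, norm_mul, norm_pow, norm_inv,
    norm_zpow]
  refine le_of_eq ?_
  rw [show (-1 - (k : ℤ)) = -((k + 1 : ℕ) : ℤ) by push_cast; ring, zpow_neg, zpow_natCast, inv_pow]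

end Defines

/-- `f` is given on `X` by a net of smooth functions: `f` is a generalized smooth function on `X`,
without restriction on its values. -/
def Smooth (X : Set (Gen ρ E)) (f : Gen ρ E → Gen ρ F) : Prop := ∃ Ω u, Defines X f Ω u

theorem IsGSF.smooth (h : IsGSF X Y f) : Smooth X f := h.2

namespace Smooth

theorem isGSF (h : Smooth X f) : IsGSF X Set.univ f := ⟨fun _ _ => trivial, h⟩

theorem mono (h : Smooth X f) {X' : Set (Gen ρ E)} (hX : X' ⊆ X) : Smooth X' f := by
  obtain ⟨Ω, u, h⟩ := h
  exact ⟨Ω, u, h.mono hX⟩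

theorem congr (h : Smooth X f) {f' : Gen ρ E → Gen ρ F} (hf : ∀ p ∈ X, f p = f' p) :
    Smooth X f' := by
  obtain ⟨Ω, u, h⟩ := h
  exact ⟨Ω, u, h.congr hf⟩

theorem comp (hg : Smooth Y g) (hf : Smooth X f) (hXY : Set.MapsTo f X Y) :
    Smooth X (fun p => g (f p)) := by
  obtain ⟨_, _, hg⟩ := hg
  obtain ⟨_, _, hf⟩ := hf
  exact ⟨_, _, hg.comp hf hXY⟩

theorem map (h : Smooth X f) (A : F →L[ℝ] G) : Smooth X (fun p => Gen.map A (f p)) := by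
  obtain ⟨_, _, h⟩ := h
  exact ⟨_, _, h.map A⟩

theorem bilin {g : Gen ρ E → Gen ρ G} (h : Smooth X f) (h' : Smooth X g) (B : F × G → H)
    (hB : IsBoundedBilinearMap ℝ B) : Smooth X (fun p => Gen.bilin B hB (f p) (g p)) := by
  obtain ⟨_, _, h⟩ := h
  obtain ⟨_, _, h'⟩ := h'
  exact ⟨_, _, h.bilin h' B hB⟩

theorem const (X : Set (Gen ρ E)) (c : Gen ρ F) : Smooth X (fun _ => c) := by
  obtain ⟨y, hy⟩ := exists_rep' c
  exact ⟨_, _, Defines.const X hy⟩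

theorem id (X : Set (Gen ρ E)) : Smooth X (fun p => p) := ⟨_, _, Defines.id X⟩

theorem add {f' : Gen ρ E → Gen ρ F} (h : Smooth X f) (h' : Smooth X f') :
    Smooth X (fun p => f p + f' p) := by
  obtain ⟨_, _, h⟩ := h
  obtain ⟨_, _, h'⟩ := h'
  exact ⟨_, _, h.add h'⟩

theorem smul {f' : Gen ρ E → Gen ρ ℝ} (h' : Smooth X f') (h : Smooth X f) :
    Smooth X (fun p => f' p • f p) := h'.bilin h _ _

theorem neg (h : Smooth X f) : Smooth X (fun p => -f p) :=
  (h.map (-ContinuousLinearMap.id ℝ F)).congr fun p _ => by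
    obtain ⟨x, hx⟩ := exists_rep' (f p)
    exact (hx.map _).unique hx.neg

theorem sub {f' : Gen ρ E → Gen ρ F} (h : Smooth X f) (h' : Smooth X f') :
    Smooth X (fun p => f p - f' p) := by
  simpa only [sub_eq_add_neg] using h.add h'.neg

theorem mul {f g : Gen ρ E → Gen ρ ℝ} (h : Smooth X f) (h' : Smooth X g) :
    Smooth X (fun p => f p * g p) := h.bilin h' _ isBoundedBilinearMap_mul

theorem pow {f : Gen ρ E → Gen ρ ℝ} (h : Smooth X f) (k : ℕ) : Smooth X (fun p => f p ^ k) := by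
  induction k with
  | zero => simpa using Smooth.const X (1 : Gen ρ ℝ)
  | succ k ih => simpa only [pow_succ] using ih.mul h

theorem dot {F : Type*} [NormedAddCommGroup F] [InnerProductSpace ℝ F] {f g : Gen ρ E → Gen ρ F}
    (h : Smooth X f) (h' : Smooth X g) : Smooth X (fun p => Gen.dot (f p) (g p)) :=
  h.bilin h' _ isBoundedBilinearMap_inner

theorem app {f : Gen ρ E → Gen ρ (F →L[ℝ] G)} {g : Gen ρ E → Gen ρ F}
    (h : Smooth X f) (h' : Smooth X g) : Smooth X (fun p => Gen.app (f p) (g p)) :=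
  h.bilin h' _ isBoundedBilinearMap_apply

theorem sum {ι : Type*} (s : Finset ι) {f : ι → Gen ρ E → Gen ρ F}
    (h : ∀ i ∈ s, Smooth X (f i)) : Smooth X (fun p => ∑ i ∈ s, f i p) := by
  induction s using Finset.cons_induction with
  | empty => simpa using Smooth.const X (0 : Gen ρ F)
  | cons a s ha ih =>
    simp only [Finset.sum_cons]
    exact (h a (by simp)).add (ih fun i hi => h i (by simp [hi]))

theorem pair {g : Gen ρ E → Gen ρ G} (h : Smooth X f) (h' : Smooth X g) :
    Smooth X (fun p => Gen.pair (f p) (g p)) := (h.map _).add (h'.map _)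

theorem tuple {n : ℕ} {f : Fin n → Gen ρ E → Gen ρ F} (h : ∀ i, Smooth X (f i)) :
    Smooth X (fun p => Gen.tuple fun i => f i p) := Smooth.sum _ fun i _ => (h i).map _

theorem zsmul (h : Smooth X f) (n : ℤ) : Smooth X (fun p => n • f p) := by
  induction n with
  | zero => simpa using Smooth.const X (0 : Gen ρ F)
  | succ n ih => simpa only [add_zsmul, one_zsmul] using ih.add h
  | pred n ih => exact (ih.sub h).congr fun p _ => by rw [sub_zsmul, one_zsmul, sub_eq_add_neg]

theorem fst (X : Set (Gen ρ (E × F))) : Smooth X Gen.fst := (Smooth.id X).map _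

theorem snd (X : Set (Gen ρ (E × F))) : Smooth X Gen.snd := (Smooth.id X).map _

theorem inverse {f : Gen ρ E → Gen ρ ℝ} (h : Smooth X f) (hu : ∀ p ∈ X, IsUnit (f p)) :
    Smooth X (fun p => Ring.inverse (f p)) :=
  Smooth.comp (Y := {p : Gen ρ ℝ | IsUnit p}) ⟨_, _, Defines.inverse⟩ h hu

end Smooth

end Smooth

/-! ### Uniqueness of directional derivatives -/

/-- Interpolation between the values and the second derivatives of a function on a segment bounds
its first derivative at the end of the segment. -/
theorem norm_fderiv_le_of_segment {E F : Type*} [NormedAddCommGroup E] [NormedSpace ℝ E]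
    [NormedAddCommGroup F] [NormedSpace ℝ F] {w : E → F} {Ω : Set E} (hΩ : IsOpen Ω)
    (hw : ContDiffOn ℝ ∞ w Ω) {x y : E} {M δ h : ℝ} (hh : 0 ≤ h) (hh1 : h ≤ 1) (hM : 0 ≤ M)
    (hmem : ∀ s ∈ Set.Icc (0 : ℝ) 1, x + s • y ∈ Ω)
    (h2 : ∀ s ∈ Set.Icc (0 : ℝ) 1, ‖fderiv ℝ (fderiv ℝ w) (x + s • y)‖ ≤ M)
    (h0 : ∀ s ∈ Set.Icc (0 : ℝ) 1, ‖w (x + s • y)‖ ≤ δ) :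
    h * ‖fderiv ℝ w x y‖ ≤ 2 * δ + M * ‖y‖ ^ 2 * h ^ 2 := by
  have hS : ∀ z ∈ segment ℝ x (x + h • y), ∃ s ∈ Set.Icc (0 : ℝ) 1, s ≤ h ∧ z = x + s • y := by
    intro z hz
    rw [segment_eq_image'] at hz
    obtain ⟨θ, hθ, rfl⟩ := hz
    refine ⟨θ * h, ⟨mul_nonneg hθ.1 hh, mul_le_one₀ hθ.2 hh hh1⟩,
      mul_le_of_le_one_left hh hθ.2, ?_⟩
    simp [mul_smul]
  have hx : x ∈ segment ℝ x (x + h • y) := left_mem_segment _ _ _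
  have hd : ∀ z ∈ segment ℝ x (x + h • y), DifferentiableAt ℝ w z := fun z hz => by
    obtain ⟨s, hs, -, rfl⟩ := hS z hz
    exact (hw.contDiffAt (hΩ.mem_nhds (hmem s hs))).differentiableAt (by simp)
  have hd' : ∀ z ∈ segment ℝ x (x + h • y), DifferentiableAt ℝ (fderiv ℝ w) z := fun z hz => by
    obtain ⟨s, hs, -, rfl⟩ := hS z hz
    exact ((hw.fderiv_of_isOpen hΩ (m := ∞) (by simp)).contDiffAt
      (hΩ.mem_nhds (hmem s hs))).differentiableAt (by simp)
  have h1 : ∀ z ∈ segment ℝ x (x + h • y), ‖fderiv ℝ w z - fderiv ℝ w x‖ ≤ M * (h * ‖y‖) := by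
    intro z hz
    have := Convex.norm_image_sub_le_of_norm_fderiv_le (𝕜 := ℝ) (C := M) hd' (fun z hz => by
      obtain ⟨s, hs, -, rfl⟩ := hS z hz
      exact h2 s hs) (convex_segment _ _) hx hz
    refine this.trans (mul_le_mul_of_nonneg_left ?_ hM)
    obtain ⟨s, hs, hsh, rfl⟩ := hS z hz
    rw [add_sub_cancel_left, norm_smul, Real.norm_of_nonneg hs.1]
    gcongr
  have h3 := Convex.norm_image_sub_le_of_norm_fderiv_le' (𝕜 := ℝ) hd h1 (convex_segment _ _) hx
    (right_mem_segment ℝ x (x + h • y))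
  rw [add_sub_cancel_left, map_smul, norm_smul, Real.norm_of_nonneg hh] at h3
  have h4 := h0 h ⟨hh, hh1⟩
  have h5 := h0 0 ⟨le_rfl, zero_le_one⟩
  rw [zero_smul, add_zero] at h5
  have h6 : ‖h • fderiv ℝ w x y‖ ≤
      ‖w (x + h • y) - w x - h • fderiv ℝ w x y‖ + ‖w (x + h • y)‖ + ‖w x‖ := by
    have : h • fderiv ℝ w x y = -(w (x + h • y) - w x - h • fderiv ℝ w x y) +
        w (x + h • y) + -w x := by abel
    calc ‖h • fderiv ℝ w x y‖ = ‖-(w (x + h • y) - w x - h • fderiv ℝ w x y) +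
        w (x + h • y) + -w x‖ := by rw [← this]
      _ ≤ _ := by
        refine (norm_add₃_le ..).trans ?_
        rw [norm_neg, norm_neg]
  rw [norm_smul, Real.norm_of_nonneg hh] at h6
  nlinarith

section Derivatives

open Gen

variable {ρ : Gauge} {E F G H : Type*} [NormedAddCommGroup E] [NormedSpace ℝ E]
  [NormedAddCommGroup F] [NormedSpace ℝ F] [NormedAddCommGroup G] [NormedSpace ℝ G]
  [NormedAddCommGroup H] [NormedSpace ℝ H]
  {X : Set (Gen ρ E)} {Y : Set (Gen ρ F)} {f : Gen ρ E → Gen ρ F} {g : Gen ρ F → Gen ρ G}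
  {Ω : Idx → Set E} {u : Idx → E → F} {v : E}

/-- Every point of `X` is the end of a segment in `X`, in the direction `v` and of invertible
length. The sign of the length may depend on `ε`, as it has to for intervals. -/
def IsAdmissible (X : Set (Gen ρ E)) (v : E) : Prop :=
  ∀ p ∈ X, ∃ (x : Idx → E) (r : Idx → ℝ), Rep p x ∧ IsModerate ρ r ∧
    (∃ N : ℕ, ∀ᶠ ε in atBot, ρ ε ^ N ≤ |r ε|) ∧
    ∀ s : Idx → ℝ, (∀ ε, s ε ∈ Set.Icc (0 : ℝ) 1) →
      ∃ z ∈ X, Rep z (fun ε => x ε + s ε • r ε • v)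

/-- A net that defines the zero function on `X` has zero derivatives in admissible directions. -/
theorem Defines.isNegligible_fderiv (h : Defines X (fun _ => (0 : Gen ρ F)) Ω u)
    (hX : IsAdmissible X v) {p : Gen ρ E} (hp : p ∈ X) :
    ∃ x, Rep p x ∧ IsNegligible ρ (fun ε => _root_.fderiv ℝ (u ε) (x ε) v) := by
  obtain ⟨x, r, hx, hr, ⟨N, hN⟩, hs⟩ := hX p hp
  refine ⟨x, hx, ?_⟩
  obtain ⟨D, hD⟩ := h.exists_fderiv
  obtain ⟨D2, hD2⟩ := hD.exists_fderiv
  have hK : ∀ _ : Idx, (Set.Icc (0 : ℝ) 1).Nonempty := fun _ => ⟨0, by simp⟩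
  have h1 := eventually_forall_of_nets hK (p := fun ε s => x ε + s • r ε • v ∈ Ω ε) fun s hs' => by
    obtain ⟨z, hz, hzr⟩ := hs s hs'
    exact h.subset hz _ hzr
  obtain ⟨M, hM, hM0, h2⟩ := exists_uniform_bound (ρ := ρ) hK (g := fun ε s =>
      _root_.fderiv ℝ (_root_.fderiv ℝ (u ε)) (x ε + s • r ε • v)) fun s hs' => by
    obtain ⟨z, hz, hzr⟩ := hs s hs'
    exact (hD2.value z hz _ hzr).moderate
  have h3 := exists_uniform_negligible (ρ := ρ) hK (g := fun ε s => u ε (x ε + s • r ε • v))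
    fun s hs' => by
      obtain ⟨z, hz, hzr⟩ := hs s hs'
      refine ((h.value z hz _ hzr).negl .zero).mono (.of_forall fun ε => ?_)
      simp
  -- interpolate with step `ρ_ε^k` for all `k`
  have hM' : IsModerate ρ (fun ε => 2 + M ε * ‖r ε • v‖ ^ 2) :=
    (IsModerate.const 2).add (hM.mul ((hr.bilin (B := fun (a : ℝ) (b : E) => a • b) zero_le_one
      (fun a b => by simp [norm_smul]) (IsModerate.const v)).norm.pow 2))
  have hA : IsNegligible ρ (fun ε => _root_.fderiv ℝ (u ε) (x ε) (r ε • v)) := by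
    obtain ⟨K, hK'⟩ := hM'
    intro n
    filter_upwards [h1, h2, h3 (2 * (n + K)), hK'] with ε e1 e2 e3 e4
    have hpos := pow_pos (ρ.pos ε) (n + K)
    have := norm_fderiv_le_of_segment (h.isOpen ε) (h.smooth ε) hpos.le
      (pow_le_one₀ (ρ.pos ε).le (ρ.le_one ε)) (hM0 ε) e1 e2 e3
    rw [Real.norm_of_nonneg (by have := hM0 ε; positivity), le_inv_pow_iff] at e4
    have h5 : ρ ε ^ (n + K) * ‖_root_.fderiv ℝ (u ε) (x ε) (r ε • v)‖ ≤
        ρ ε ^ (n + K) * ((2 + M ε * ‖r ε • v‖ ^ 2) * ρ ε ^ (n + K)) := by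
      refine this.trans (le_of_eq ?_)
      ring
    refine (le_of_mul_le_mul_left h5 hpos).trans ?_
    calc (2 + M ε * ‖r ε • v‖ ^ 2) * ρ ε ^ (n + K)
        = ((2 + M ε * ‖r ε • v‖ ^ 2) * ρ ε ^ K) * ρ ε ^ n := by ring
      _ ≤ 1 * ρ ε ^ n := mul_le_mul_of_nonneg_right e4 (pow_pos (ρ.pos ε) n).le
      _ = ρ ε ^ n := one_mul _
  refine (IsNegligible.bilin_right (B := fun (a : ℝ) (b : F) => a • b) zero_le_one
    (fun a b => by simp [norm_smul]) (IsModerate.inv_pow (ρ := ρ) N) hA).mono ?_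
  filter_upwards [hN] with ε hε
  have hpos := pow_pos (ρ.pos ε) N
  rw [map_smul, norm_smul, norm_smul, Real.norm_of_nonneg (inv_nonneg.2 hpos.le), ← mul_assoc]
  refine le_mul_of_one_le_left (norm_nonneg _) ?_
  rw [inv_mul_eq_div, one_le_div hpos]
  exact hε

/-- The directional derivative of a generalized smooth function in an admissible direction does
not depend on the net that defines it. -/
theorem Defines.isNegligible_fderiv_sub_fderiv {Ω' : Idx → Set E} {u' : Idx → E → F}
    (h : Defines X f Ω u) (h' : Defines X f Ω' u') (hX : IsAdmissible X v) {p : Gen ρ E}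
    (hp : p ∈ X) {x y : Idx → E} (hx : Rep p x) (hy : Rep p y) :
    IsNegligible ρ ((fun ε => _root_.fderiv ℝ (u ε) (x ε) v) -
      fun ε => _root_.fderiv ℝ (u' ε) (y ε) v) := by
  have h0 : Defines X (fun _ => (0 : Gen ρ F)) (fun ε => Ω ε ∩ Ω' ε)
      (fun ε => u ε + (-ContinuousLinearMap.id ℝ F) ∘ u' ε) := by
    refine (h.add (h'.map (-ContinuousLinearMap.id ℝ F))).congr fun p hp => ?_
    obtain ⟨z, hz⟩ := exists_rep' (f p)
    refine (hz.add (hz.map _)).unique ?_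
    simpa using Rep.zero
  obtain ⟨z, hz, hn⟩ := h0.isNegligible_fderiv hX hp
  have hv := Rep.const (ρ := ρ) v
  refine (h.isNegligible_fderiv_sub hp hx hz hv hv).trans
    (.trans ?_ (h'.isNegligible_fderiv_sub hp hz hy hv hv))
  refine hn.mono ?_
  filter_upwards [h.subset hp z hz, h'.subset hp z hz] with ε h1 h2
  rw [fderiv_add (h.differentiableAt h1)
    ((-ContinuousLinearMap.id ℝ F).differentiableAt.comp _ (h'.differentiableAt h2)),
    fderiv_comp _ (-ContinuousLinearMap.id ℝ F).differentiableAt (h'.differentiableAt h2),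
    ContinuousLinearMap.fderiv]
  simp [sub_eq_add_neg]

/-- The directional derivative is represented by the directional derivatives of any net that
defines the function. -/
theorem Defines.rep_dirDeriv (h : Defines X f Ω u) (hX : IsAdmissible X v) {p : Gen ρ E}
    (hp : p ∈ X) {x : Idx → E} (hx : Rep p x) :
    Rep (dirDeriv X f (Gen.const ρ v) p) (fun ε => _root_.fderiv ℝ (u ε) (x ε) v) := by
  obtain ⟨Df, hDf⟩ := h.exists_fderiv
  have hv := Rep.const (ρ := ρ) v
  have hex : ∃ w, HasDeriv X f (Gen.const ρ v) p w :=
    ⟨_, Ω, u, x, _, h, hx, hv, (hDf.value p hp x hx).app hv⟩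
  rw [dirDeriv, dif_pos hex]
  obtain ⟨Ω', u', x', y', h', hx', hy', hw⟩ := hex.choose_spec
  exact (hw.of_negl (h'.isNegligible_fderiv_sub hp hx' hx' hy' hv)).of_negl
    (h'.isNegligible_fderiv_sub_fderiv h hX hp hx' hx)

theorem Defines.dirDeriv_eq (h : Defines X f Ω u) (hX : IsAdmissible X v) {p : Gen ρ E}
    (hp : p ∈ X) {x : Idx → E} (hx : Rep p x) {q : Gen ρ F} {y : Idx → F} (hq : Rep q y)
    (hy : ∀ᶠ ε in atBot, x ε ∈ Ω ε → _root_.fderiv ℝ (u ε) (x ε) v = y ε) :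
    dirDeriv X f (Gen.const ρ v) p = q := by
  refine (h.rep_dirDeriv hX hp hx).eq_of_eventuallyEq hq ?_
  filter_upwards [h.subset hp x hx, hy] with ε h1 h2 using h2 h1

/-! ### Admissible directions -/

theorem IsAdmissible.prod_left (hX : IsAdmissible X v) (Y : Set (Gen ρ F)) :
    IsAdmissible (prod X Y) ((v, 0) : E × F) := by
  intro p hp
  obtain ⟨x, r, hx, hr, hN, hs⟩ := hX _ hp.1
  obtain ⟨y, hy⟩ := exists_rep' (snd p)
  refine ⟨fun ε => (x ε, y ε), r, ?_, hr, hN, fun s h01 => ?_⟩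
  · simpa using hx.pair hy
  · obtain ⟨z, hz, hzr⟩ := hs s h01
    exact ⟨pair z (snd p), pair_mem_prod hz hp.2, by simpa using hzr.pair hy⟩

theorem IsAdmissible.prod_right (hX : IsAdmissible X v) (Y : Set (Gen ρ F)) :
    IsAdmissible (prod Y X) ((0, v) : F × E) := by
  intro p hp
  obtain ⟨x, r, hx, hr, hN, hs⟩ := hX _ hp.2
  obtain ⟨y, hy⟩ := exists_rep' (fst p)
  refine ⟨fun ε => (y ε, x ε), r, ?_, hr, hN, fun s h01 => ?_⟩
  · simpa using hy.pair hx
  · obtain ⟨z, hz, hzr⟩ := hs s h01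
    exact ⟨pair (fst p) z, pair_mem_prod hp.1 hz, by simpa using hy.pair hzr⟩

theorem isAdmissible_univ (v : E) : IsAdmissible (ρ := ρ) Set.univ v := by
  intro p _
  obtain ⟨x, hx⟩ := exists_rep' p
  refine ⟨x, fun _ => 1, hx, .const 1, ⟨0, by simp⟩, fun s hs => ⟨mk _ ?_, trivial, rep_mk _⟩⟩
  refine hx.moderate.add ((IsModerate.const v).mono (.of_forall fun ε => ?_))
  rw [one_smul, norm_smul, Real.norm_of_nonneg (hs ε).1]
  exact mul_le_of_le_one_left (norm_nonneg _) (hs ε).2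

theorem isAdmissible_Icc {a b : Gen ρ ℝ} (hab : a < b) : IsAdmissible (Icc a b) (1 : ℝ) := by
  intro p hp
  obtain ⟨x, y, hx, hy, hxy, N, hN⟩ := exists_rep_lt hab
  obtain ⟨z, hz, hzxy⟩ := exists_rep_mem_Icc hx hy hxy hp
  -- move towards the endpoint that is farther away
  refine ⟨z, fun ε => if z ε ≤ (x ε + y ε) / 2 then (y ε - x ε) / 2 else -((y ε - x ε) / 2), hz,
    (hy.sub hx).moderate.mono (.of_forall fun ε => ?_), ⟨N + 1, ?_⟩, fun s hs => ?_⟩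
  · have := hxy ε
    rw [Real.norm_of_nonneg (r := y ε - x ε) (by linarith), Real.norm_eq_abs, abs_le]
    split_ifs <;> constructor <;> linarith
  · filter_upwards [hN, ρ.eventually_lt (c := 1 / 2) (by norm_num)] with ε h1 h2
    have h3 : ρ ε ^ (N + 1) ≤ (y ε - x ε) / 2 := by
      rw [pow_succ]
      have := pow_pos (ρ.pos ε) N
      nlinarith
    refine h3.trans ?_
    split_ifs
    · exact le_abs_self _
    · rw [abs_neg]
      exact le_abs_self _
  · have ha : a ≤ b := hab.1
    refine mem_Icc_of_between (left_mem_Icc ha) (right_mem_Icc ha) hx hy fun ε => ?_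
    rw [Set.uIcc_of_le (hxy ε)]
    have h1 := hs ε
    have h2 := hzxy ε
    have h3 := hxy ε
    have h4 : 0 ≤ (1 - s ε) * (y ε - x ε) := mul_nonneg (by linarith [h1.2]) (by linarith)
    have h5 : 0 ≤ s ε * (y ε - x ε) := mul_nonneg h1.1 (by linarith)
    simp only [smul_eq_mul, mul_one]
    split_ifs with h <;> constructor <;> nlinarith [h2.1, h2.2]

theorem Gen.IsSharplyOpen.isAdmissible {U : Set (Gen ρ E)} (hU : IsSharplyOpen U) (v : E) :
    IsAdmissible U v := by
  intro p hp
  obtain ⟨R, hR, hball⟩ := hU p hp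
  obtain ⟨x, hx⟩ := exists_rep' p
  obtain ⟨c, d, hc, hd, hcd, N, hN⟩ := exists_rep_lt hR
  have hRr : Rep R (fun ε => d ε - c ε) := by simpa using hd.sub hc
  have hv : 0 < 2 * (1 + ‖v‖) := by positivity
  have hr : IsModerate ρ (fun ε => ρ ε ^ N / (2 * (1 + ‖v‖))) := by
    refine (IsModerate.const (1 : ℝ)).mono (.of_forall fun ε => ?_)
    rw [norm_one, Real.norm_of_nonneg (div_nonneg (pow_pos (ρ.pos ε) N).le hv.le),
      div_le_one hv]
    linarith [pow_le_one₀ (n := N) (ρ.pos ε).le (ρ.le_one ε), norm_nonneg v]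
  refine ⟨x, fun ε => ρ ε ^ N / (2 * (1 + ‖v‖)), hx, hr, ⟨N + 1, ?_⟩, fun s hs => ?_⟩
  · filter_upwards [ρ.eventually_lt (inv_pos.2 hv)] with ε hε
    rw [abs_of_nonneg (div_nonneg (pow_pos (ρ.pos ε) N).le hv.le), pow_succ, div_eq_mul_inv]
    exact mul_le_mul_of_nonneg_left hε.le (pow_pos (ρ.pos ε) N).le
  · have hb : ∀ ε, ‖s ε • (ρ ε ^ N / (2 * (1 + ‖v‖))) • v‖ ≤ ρ ε ^ N / 2 := fun ε => by
      have hpos := pow_pos (ρ.pos ε) N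
      rw [norm_smul, norm_smul, Real.norm_of_nonneg (hs ε).1,
        Real.norm_of_nonneg (div_nonneg hpos.le hv.le)]
      refine (mul_le_of_le_one_left (by positivity) (hs ε).2).trans ?_
      rw [div_mul_eq_mul_div, div_le_div_iff₀ hv two_pos]
      nlinarith [norm_nonneg v]
    have hm : IsModerate ρ (fun ε => s ε • (ρ ε ^ N / (2 * (1 + ‖v‖))) • v) := by
      refine (IsModerate.const (1 : ℝ)).mono (.of_forall fun ε => (hb ε).trans ?_)
      rw [norm_one]
      linarith [pow_le_one₀ (n := N) (ρ.pos ε).le (ρ.le_one ε)]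
    have hz : Rep (p + mk _ hm) (fun ε => x ε + s ε • (ρ ε ^ N / (2 * (1 + ‖v‖))) • v) :=
      hx.add (rep_mk hm)
    refine ⟨_, hball _ ?_, hz⟩
    rw [add_sub_cancel_left]
    have hn := (rep_mk hm).norm
    refine ⟨(le_iff hn hRr).2 (IsNegligible.zero.mono (y := (0 : Idx → ℝ)) ?_),
      (isUnit_iff (hn.sub hRr)).2 ⟨N + 1, ?_⟩⟩
    · filter_upwards [hN] with ε hε
      have hpos := pow_pos (ρ.pos ε) N
      rw [max_eq_right (by linarith [hb ε])]
      simp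
    · filter_upwards [hN, ρ.eventually_lt (c := 1 / 2) (by norm_num)] with ε hε h2
      have hpos := pow_pos (ρ.pos ε) N
      rw [abs_sub_comm, pow_succ]
      refine le_trans ?_ (le_abs_self _)
      nlinarith [hb ε]

/-! ### Rules of differential calculus -/

theorem hasDeriv_congr {f' : Gen ρ E → Gen ρ F} (h : ∀ p ∈ X, f p = f' p) (v p : Gen ρ E)
    (w : Gen ρ F) : HasDeriv X f v p w ↔ HasDeriv X f' v p w := by
  constructor
  · rintro ⟨Ω, u, x, y, hd, h'⟩
    exact ⟨Ω, u, x, y, hd.congr h, h'⟩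
  · rintro ⟨Ω, u, x, y, hd, h'⟩
    exact ⟨Ω, u, x, y, hd.congr fun p hp => (h p hp).symm, h'⟩

/-- Directional derivatives only depend on the values on the domain. -/
theorem dirDeriv_congr {f' : Gen ρ E → Gen ρ F} (h : ∀ p ∈ X, f p = f' p) (v p : Gen ρ E) :
    dirDeriv X f v p = dirDeriv X f' v p := by
  have : HasDeriv X f v p = HasDeriv X f' v p := funext fun w => propext (hasDeriv_congr h v p w)
  unfold GSF.dirDeriv
  rw [this]

theorem dirDeriv_mono (h : Smooth X f) {X' : Set (Gen ρ E)} (hX' : X' ⊆ X)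
    (hv : IsAdmissible X v) (hv' : IsAdmissible X' v) {p : Gen ρ E} (hp : p ∈ X') :
    dirDeriv X' f (Gen.const ρ v) p = dirDeriv X f (Gen.const ρ v) p := by
  obtain ⟨Ω, u, h⟩ := h
  obtain ⟨x, hx⟩ := exists_rep' p
  exact ((h.mono hX').rep_dirDeriv hv' hp hx).unique (h.rep_dirDeriv hv (hX' hp) hx)

theorem Smooth.dirDeriv (h : Smooth X f) (hv : IsAdmissible X v) :
    Smooth X (dirDeriv X f (Gen.const ρ v)) := by
  obtain ⟨Ω, u, h⟩ := h
  obtain ⟨Df, hDf⟩ := h.exists_fderiv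
  refine (Smooth.app ⟨_, _, hDf⟩ (Smooth.const X (Gen.const ρ v))).congr fun p hp => ?_
  obtain ⟨x, hx⟩ := exists_rep' p
  exact ((hDf.value p hp x hx).app (.const v)).unique (h.rep_dirDeriv hv hp hx)

/-- `Df` is the total differential of `f` on `X`, for some net that defines `f`. -/
def HasTotalDeriv (X : Set (Gen ρ E)) (f : Gen ρ E → Gen ρ F)
    (Df : Gen ρ E → Gen ρ (E →L[ℝ] F)) : Prop :=
  ∃ Ω u, Defines X f Ω u ∧ Defines X Df Ω (fun ε => _root_.fderiv ℝ (u ε))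

theorem Smooth.exists_hasTotalDeriv (h : Smooth X f) : ∃ Df, HasTotalDeriv X f Df := by
  obtain ⟨Ω, u, h⟩ := h
  obtain ⟨Df, hDf⟩ := h.exists_fderiv
  exact ⟨Df, Ω, u, h, hDf⟩

namespace HasTotalDeriv

variable {Df : Gen ρ E → Gen ρ (E →L[ℝ] F)} {Dg : Gen ρ F → Gen ρ (F →L[ℝ] G)}

theorem smooth (h : HasTotalDeriv X f Df) : Smooth X f := by
  obtain ⟨Ω, u, h, -⟩ := h
  exact ⟨Ω, u, h⟩

theorem smooth_deriv (h : HasTotalDeriv X f Df) : Smooth X Df := by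
  obtain ⟨Ω, u, -, h⟩ := h
  exact ⟨_, _, h⟩

theorem dirDeriv_eq (h : HasTotalDeriv X f Df) (hv : IsAdmissible X v) {p : Gen ρ E} (hp : p ∈ X) :
    dirDeriv X f (Gen.const ρ v) p = app (Df p) (Gen.const ρ v) := by
  obtain ⟨Ω, u, h, h'⟩ := h
  obtain ⟨x, hx⟩ := exists_rep' p
  exact (h.rep_dirDeriv hv hp hx).unique ((h'.value p hp x hx).app (.const v))

/-- The chain rule. -/
theorem dirDeriv_comp (hg : HasTotalDeriv Y g Dg) (hf : Smooth X f) (hXY : Set.MapsTo f X Y)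
    (hv : IsAdmissible X v) {p : Gen ρ E} (hp : p ∈ X) :
    dirDeriv X (fun p => g (f p)) (Gen.const ρ v) p =
      app (Dg (f p)) (dirDeriv X f (Gen.const ρ v) p) := by
  obtain ⟨Ω, u, hf⟩ := hf
  obtain ⟨Ω', w, hg, hg'⟩ := hg
  obtain ⟨x, hx⟩ := exists_rep' p
  refine (hg.comp hf hXY).dirDeriv_eq hv hp hx ((hg'.value _ (hXY hp) _ (hf.value p hp x hx)).app
    (hf.rep_dirDeriv hv hp hx)) (.of_forall fun ε hε => ?_)
  rw [fderiv_comp _ (hg.differentiableAt hε.2) (hf.differentiableAt hε.1)]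
  rfl

end HasTotalDeriv

theorem dirDeriv_map (h : Smooth X f) (A : F →L[ℝ] G) (hv : IsAdmissible X v) {p : Gen ρ E}
    (hp : p ∈ X) :
    dirDeriv X (fun p => map A (f p)) (Gen.const ρ v) p =
      map A (dirDeriv X f (Gen.const ρ v) p) := by
  obtain ⟨Ω, u, h⟩ := h
  obtain ⟨x, hx⟩ := exists_rep' p
  refine (h.map A).dirDeriv_eq hv hp hx ((h.rep_dirDeriv hv hp hx).map A)
    (.of_forall fun ε hε => ?_)
  rw [fderiv_comp _ A.differentiableAt (h.differentiableAt hε), A.fderiv]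
  rfl

theorem dirDeriv_add {f' : Gen ρ E → Gen ρ F} (h : Smooth X f) (h' : Smooth X f')
    (hv : IsAdmissible X v) {p : Gen ρ E} (hp : p ∈ X) :
    dirDeriv X (fun p => f p + f' p) (Gen.const ρ v) p =
      dirDeriv X f (Gen.const ρ v) p + dirDeriv X f' (Gen.const ρ v) p := by
  obtain ⟨Ω, u, h⟩ := h
  obtain ⟨Ω', u', h'⟩ := h'
  obtain ⟨x, hx⟩ := exists_rep' p
  refine (h.add h').dirDeriv_eq hv hp hx ((h.rep_dirDeriv hv hp hx).add
    (h'.rep_dirDeriv hv hp hx)) (.of_forall fun ε hε => ?_)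
  rw [fderiv_add (h.differentiableAt hε.1) (h'.differentiableAt hε.2)]
  rfl

/-- The Leibniz rule. -/
theorem dirDeriv_bilin {g : Gen ρ E → Gen ρ G} (h : Smooth X f) (h' : Smooth X g)
    (B : F × G → H) (hB : IsBoundedBilinearMap ℝ B) (hv : IsAdmissible X v) {p : Gen ρ E}
    (hp : p ∈ X) :
    dirDeriv X (fun p => bilin B hB (f p) (g p)) (Gen.const ρ v) p =
      bilin B hB (f p) (dirDeriv X g (Gen.const ρ v) p) +
        bilin B hB (dirDeriv X f (Gen.const ρ v) p) (g p) := by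
  obtain ⟨Ω, u, h⟩ := h
  obtain ⟨Ω', u', h'⟩ := h'
  obtain ⟨x, hx⟩ := exists_rep' p
  refine (h.bilin h' B hB).dirDeriv_eq hv hp hx (((h.value p hp x hx).bilin
    (h'.rep_dirDeriv hv hp hx) B hB).add ((h.rep_dirDeriv hv hp hx).bilin
      (h'.value p hp x hx) B hB)) (.of_forall fun ε hε => ?_)
  have h1 := (hB.hasFDerivAt (u ε (x ε), u' ε (x ε))).comp (x ε)
    ((h.differentiableAt hε.1).hasFDerivAt.prodMk (h'.differentiableAt hε.2).hasFDerivAt)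
  have h2 : HasFDerivAt (fun z => B (u ε z, u' ε z)) _ (x ε) := h1
  rw [h2.fderiv]
  simp

theorem dirDeriv_const (X : Set (Gen ρ E)) (c : Gen ρ F) (hv : IsAdmissible X v) {p : Gen ρ E}
    (hp : p ∈ X) : dirDeriv X (fun _ => c) (Gen.const ρ v) p = 0 := by
  obtain ⟨y, hy⟩ := exists_rep' c
  obtain ⟨x, hx⟩ := exists_rep' p
  exact (Defines.const X hy).dirDeriv_eq hv hp hx .zero (.of_forall fun ε _ => by simp)

theorem dirDeriv_id (X : Set (Gen ρ E)) (hv : IsAdmissible X v) {p : Gen ρ E}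
    (hp : p ∈ X) : dirDeriv X (fun p => p) (Gen.const ρ v) p = Gen.const ρ v := by
  obtain ⟨x, hx⟩ := exists_rep' p
  exact (Defines.id X).dirDeriv_eq hv hp hx (.const v) (.of_forall fun ε _ => by simp)

theorem dirDeriv_neg (h : Smooth X f) (hv : IsAdmissible X v) {p : Gen ρ E} (hp : p ∈ X) :
    dirDeriv X (fun p => -f p) (Gen.const ρ v) p = -dirDeriv X f (Gen.const ρ v) p := by
  have h1 : ∀ q : Gen ρ F, map (-ContinuousLinearMap.id ℝ F) q = -q := fun q => by
    obtain ⟨x, hx⟩ := exists_rep' q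
    exact (hx.map _).unique hx.neg
  rw [← h1, ← dirDeriv_map h _ hv hp]
  exact dirDeriv_congr (fun p _ => (h1 _).symm) _ _

theorem dirDeriv_sub {f' : Gen ρ E → Gen ρ F} (h : Smooth X f) (h' : Smooth X f')
    (hv : IsAdmissible X v) {p : Gen ρ E} (hp : p ∈ X) :
    dirDeriv X (fun p => f p - f' p) (Gen.const ρ v) p =
      dirDeriv X f (Gen.const ρ v) p - dirDeriv X f' (Gen.const ρ v) p := by
  simp only [sub_eq_add_neg]
  rw [dirDeriv_add h h'.neg hv hp, dirDeriv_neg h' hv hp]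

theorem dirDeriv_sum {ι : Type*} (s : Finset ι) {f : ι → Gen ρ E → Gen ρ F}
    (h : ∀ i ∈ s, Smooth X (f i)) (hv : IsAdmissible X v) {p : Gen ρ E} (hp : p ∈ X) :
    dirDeriv X (fun p => ∑ i ∈ s, f i p) (Gen.const ρ v) p =
      ∑ i ∈ s, dirDeriv X (f i) (Gen.const ρ v) p := by
  induction s using Finset.cons_induction with
  | empty => simpa using dirDeriv_const X (0 : Gen ρ F) hv hp
  | cons a s ha ih =>
    have h' : ∀ i ∈ s, Smooth X (f i) := fun i hi => h i (by simp [hi])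
    simp only [Finset.sum_cons]
    rw [dirDeriv_add (h a (by simp)) (Smooth.sum s h') hv hp, ih h']

theorem dirDeriv_zsmul (h : Smooth X f) (n : ℤ) (hv : IsAdmissible X v) {p : Gen ρ E}
    (hp : p ∈ X) :
    dirDeriv X (fun p => n • f p) (Gen.const ρ v) p = n • dirDeriv X f (Gen.const ρ v) p := by
  induction n with
  | zero => simpa using dirDeriv_const X (0 : Gen ρ F) hv hp
  | succ n ih =>
    simp only [add_zsmul, one_zsmul]
    rw [dirDeriv_add (h.zsmul _) h hv hp, ih]
  | pred n ih =>
    simp only [sub_zsmul, one_zsmul, ← sub_eq_add_neg]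
    rw [dirDeriv_sub (h.zsmul _) h hv hp, ih]

theorem dirDeriv_mul {f g : Gen ρ E → Gen ρ ℝ} (h : Smooth X f) (h' : Smooth X g)
    (hv : IsAdmissible X v) {p : Gen ρ E} (hp : p ∈ X) :
    dirDeriv X (fun p => f p * g p) (Gen.const ρ v) p =
      f p * dirDeriv X g (Gen.const ρ v) p + dirDeriv X f (Gen.const ρ v) p * g p :=
  dirDeriv_bilin h h' _ isBoundedBilinearMap_mul hv hp

theorem dirDeriv_smul {f' : Gen ρ E → Gen ρ ℝ} (h' : Smooth X f') (h : Smooth X f)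
    (hv : IsAdmissible X v) {p : Gen ρ E} (hp : p ∈ X) :
    dirDeriv X (fun p => f' p • f p) (Gen.const ρ v) p =
      f' p • dirDeriv X f (Gen.const ρ v) p + dirDeriv X f' (Gen.const ρ v) p • f p :=
  dirDeriv_bilin h' h _ isBoundedBilinearMap_smul hv hp

theorem dirDeriv_dot {F : Type*} [NormedAddCommGroup F] [InnerProductSpace ℝ F]
    {f g : Gen ρ E → Gen ρ F} (h : Smooth X f) (h' : Smooth X g)
    (hv : IsAdmissible X v) {p : Gen ρ E} (hp : p ∈ X) :
    dirDeriv X (fun p => dot (f p) (g p)) (Gen.const ρ v) p =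
      dot (f p) (dirDeriv X g (Gen.const ρ v) p) + dot (dirDeriv X f (Gen.const ρ v) p) (g p) :=
  dirDeriv_bilin h h' _ isBoundedBilinearMap_inner hv hp

theorem dirDeriv_pair {g : Gen ρ E → Gen ρ G} (h : Smooth X f) (h' : Smooth X g)
    (hv : IsAdmissible X v) {p : Gen ρ E} (hp : p ∈ X) :
    dirDeriv X (fun p => pair (f p) (g p)) (Gen.const ρ v) p =
      pair (dirDeriv X f (Gen.const ρ v) p) (dirDeriv X g (Gen.const ρ v) p) := by
  simp only [pair]
  rw [dirDeriv_add (h.map _) (h'.map _) hv hp, dirDeriv_map h _ hv hp, dirDeriv_map h' _ hv hp]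

theorem dirDeriv_tuple {n : ℕ} {f : Fin n → Gen ρ E → Gen ρ F} (h : ∀ i, Smooth X (f i))
    (hv : IsAdmissible X v) {p : Gen ρ E} (hp : p ∈ X) :
    dirDeriv X (fun p => tuple fun i => f i p) (Gen.const ρ v) p =
      tuple fun i => dirDeriv X (f i) (Gen.const ρ v) p := by
  simp only [tuple]
  rw [dirDeriv_sum _ (fun i _ => (h i).map _) hv hp]
  exact Finset.sum_congr rfl fun i _ => dirDeriv_map (h i) _ hv hp

theorem Defines.dirDeriv {Ω : Idx → Set E} {u : Idx → E → F} (h : Defines X f Ω u)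
    (hv : IsAdmissible X v) :
    Defines X (dirDeriv X f (Gen.const ρ v)) Ω (fun ε x => _root_.fderiv ℝ (u ε) x v) := by
  obtain ⟨Df, hDf⟩ := h.exists_fderiv
  refine (hDf.map (ContinuousLinearMap.apply ℝ F v)).congr fun p hp => ?_
  obtain ⟨x, hx⟩ := exists_rep' p
  exact ((hDf.value p hp x hx).map _).unique (h.rep_dirDeriv hv hp hx)

/-- Mixed second derivatives are symmetric. -/
theorem dirDeriv_comm (h : Smooth X f) {v' : E} (hv : IsAdmissible X v) (hv' : IsAdmissible X v')
    {p : Gen ρ E} (hp : p ∈ X) :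
    dirDeriv X (dirDeriv X f (Gen.const ρ v)) (Gen.const ρ v') p =
      dirDeriv X (dirDeriv X f (Gen.const ρ v')) (Gen.const ρ v) p := by
  obtain ⟨Ω, u, h⟩ := h
  obtain ⟨Df, hDf⟩ := h.exists_fderiv
  obtain ⟨x, hx⟩ := exists_rep' p
  have key : ∀ {v v' : E}, IsAdmissible X v → IsAdmissible X v' →
      Rep (dirDeriv X (dirDeriv X f (Gen.const ρ v)) (Gen.const ρ v') p)
        (fun ε => _root_.fderiv ℝ (_root_.fderiv ℝ (u ε)) (x ε) v' v) := by
    intro v v' hv hv'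
    refine ((h.dirDeriv hv).rep_dirDeriv hv' hp hx).congr ?_
    filter_upwards [h.subset hp x hx] with ε hε
    rw [fderiv_clm_apply (hDf.differentiableAt hε) (differentiableAt_const v)]
    simp
  refine (key hv hv').eq_of_eventuallyEq (key hv' hv) ?_
  filter_upwards [h.subset hp x hx] with ε hε
  exact ((h.contDiffAt hε).isSymmSndFDerivAt (by
    rw [minSmoothness_of_isRCLikeNormedField]
    exact WithTop.coe_le_coe.2 (le_top : (2 : ℕ∞) ≤ ⊤))) v' v

/-! ### Slices of functions on products -/

theorem smooth_slice_left {A : Set (Gen ρ E)} {B : Set (Gen ρ F)} {f : Gen ρ (E × F) → Gen ρ G}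
    (h : Smooth (prod A B) f) {t : Gen ρ F} (ht : t ∈ B) : Smooth A (fun s => f (pair s t)) :=
  h.comp ((Smooth.id A).pair (Smooth.const A t)) fun _ hs => pair_mem_prod hs ht

theorem smooth_slice_right {A : Set (Gen ρ E)} {B : Set (Gen ρ F)} {f : Gen ρ (E × F) → Gen ρ G}
    (h : Smooth (prod A B) f) {s : Gen ρ E} (hs : s ∈ A) : Smooth B (fun t => f (pair s t)) :=
  h.comp ((Smooth.const B s).pair (Smooth.id B)) fun _ ht => pair_mem_prod hs ht

theorem dirDeriv_slice_left {A : Set (Gen ρ E)} {B : Set (Gen ρ F)} {f : Gen ρ (E × F) → Gen ρ G}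
    (h : Smooth (prod A B) f) (hv : IsAdmissible A v) {s : Gen ρ E} {t : Gen ρ F} (hs : s ∈ A)
    (ht : t ∈ B) : dirDeriv A (fun s => f (pair s t)) (Gen.const ρ v) s =
      dirDeriv (prod A B) f (Gen.const ρ (v, 0)) (pair s t) := by
  obtain ⟨Df, hDf⟩ := h.exists_hasTotalDeriv
  rw [hDf.dirDeriv_comp (f := fun s => pair s t) ((Smooth.id A).pair (Smooth.const A t))
    (fun _ hs => pair_mem_prod hs ht) hv hs, hDf.dirDeriv_eq (hv.prod_left B) (pair_mem_prod hs ht),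
    dirDeriv_pair (Smooth.id A) (Smooth.const A t) hv hs, dirDeriv_id A hv hs,
    dirDeriv_const A t hv hs, ((Rep.const v).pair .zero).unique (.const ((v, 0) : E × F))]

theorem dirDeriv_slice_right {A : Set (Gen ρ F)} {B : Set (Gen ρ E)} {f : Gen ρ (F × E) → Gen ρ G}
    (h : Smooth (prod A B) f) (hv : IsAdmissible B v) {s : Gen ρ F} {t : Gen ρ E} (hs : s ∈ A)
    (ht : t ∈ B) : dirDeriv B (fun t => f (pair s t)) (Gen.const ρ v) t =
      dirDeriv (prod A B) f (Gen.const ρ (0, v)) (pair s t) := by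
  obtain ⟨Df, hDf⟩ := h.exists_hasTotalDeriv
  rw [hDf.dirDeriv_comp (f := fun t => pair s t) ((Smooth.const B s).pair (Smooth.id B))
    (fun _ ht => pair_mem_prod hs ht) hv ht,
    hDf.dirDeriv_eq (hv.prod_right A) (pair_mem_prod hs ht),
    dirDeriv_pair (Smooth.const B s) (Smooth.id B) hv ht, dirDeriv_id B hv ht,
    dirDeriv_const B s hv ht, (Rep.zero.pair (.const v)).unique (.const ((0, v) : F × E))]

end Derivatives

/-! ### Parametric integrals of smooth functions -/

section Classical

/-- If a compact slice lies in an open set, so do the neighbouring ones. -/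
theorem isOpen_setOf_forall_mem {α β : Type*} [TopologicalSpace α] [TopologicalSpace β]
    {Ω : Set (α × β)} (hΩ : IsOpen Ω) {K : Set β} (hK : IsCompact K) :
    IsOpen {s | ∀ t ∈ K, (s, t) ∈ Ω} :=
  isOpen_iff_eventually.2 fun _ hs => hK.eventually_forall_of_forall_eventually
    (P := fun s t => (s, t) ∈ Ω) fun t ht => hΩ.mem_nhds (hs t ht)

/-- The partial derivative of `u` with respect to its first variable. -/
noncomputable def partialFst (u : ℝ × ℝ → ℝ) (z : ℝ × ℝ) : ℝ := fderiv ℝ u z (1, 0)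

theorem ContDiffOn.partialFst {u : ℝ × ℝ → ℝ} {Ω : Set (ℝ × ℝ)} (hΩ : IsOpen Ω)
    (hu : ContDiffOn ℝ ∞ u Ω) : ContDiffOn ℝ ∞ (partialFst u) Ω :=
  (hu.fderiv_of_isOpen hΩ (m := ∞) (by simp)).clm_apply contDiffOn_const

variable {u : ℝ × ℝ → ℝ} {Ω : Set (ℝ × ℝ)} {x y : ℝ}

theorem continuousOn_slice (hu : ContinuousOn u Ω) {s : ℝ} (hs : ∀ t ∈ Set.uIcc x y, (s, t) ∈ Ω) :
    ContinuousOn (fun t => u (s, t)) (Set.uIcc x y) :=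
  hu.comp (by fun_prop) hs

theorem hasDerivAt_integral_slice (hΩ : IsOpen Ω) (hu : ContDiffOn ℝ ∞ u Ω) {s : ℝ}
    (hs : ∀ t ∈ Set.uIcc x y, (s, t) ∈ Ω) :
    HasDerivAt (fun s => ∫ t in x..y, u (s, t)) (∫ t in x..y, partialFst u (s, t)) s := by
  have hV := isOpen_setOf_forall_mem hΩ (isCompact_uIcc (a := x) (b := y))
  obtain ⟨δ, hδ, hball⟩ := Metric.nhds_basis_closedBall.mem_iff.1 (hV.mem_nhds hs)
  have hK : Metric.closedBall s δ ×ˢ Set.uIcc x y ⊆ Ω := fun z hz => hball hz.1 z.2 hz.2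
  obtain ⟨C, hC⟩ := ((isCompact_closedBall s δ).prod isCompact_uIcc).exists_bound_of_continuousOn
    ((ContDiffOn.partialFst hΩ hu).continuousOn.mono hK)
  have hint : ∀ s' ∈ Metric.closedBall s δ,
      IntervalIntegrable (fun t => u (s', t)) MeasureTheory.volume x y := fun s' hs' =>
    (continuousOn_slice hu.continuousOn (hball hs')).intervalIntegrable
  have hsub : Set.uIoc x y ⊆ Set.uIcc x y := Set.uIoc_subset_uIcc
  refine (intervalIntegral.hasDerivAt_integral_of_dominated_loc_of_deriv_le
    (F := fun s t => u (s, t)) (F' := fun s t => partialFst u (s, t)) (bound := fun _ => C)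
    (Metric.closedBall_mem_nhds s hδ) ?_ (hint s (Metric.mem_closedBall_self hδ.le)) ?_ ?_
    intervalIntegrable_const ?_).2
  · filter_upwards [Metric.closedBall_mem_nhds s hδ] with s' hs'
      using (intervalIntegrable_iff.1 (hint s' hs')).aestronglyMeasurable
  · exact (intervalIntegrable_iff.1 (continuousOn_slice
      (ContDiffOn.partialFst hΩ hu).continuousOn hs).intervalIntegrable).aestronglyMeasurable
  · exact .of_forall fun t ht s' hs' => hC (s', t) ⟨hs', hsub ht⟩
  · refine .of_forall fun t ht s' hs' => ?_
    have hd := ((hu.contDiffAt (hΩ.mem_nhds (hball hs' t (hsub ht)))).differentiableAt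
      (by simp)).hasFDerivAt
    exact hd.comp_hasDerivAt s' ((hasDerivAt_id s').prodMk (hasDerivAt_const s' t))

theorem contDiffOn_integral_slice (hΩ : IsOpen Ω) (hu : ContDiffOn ℝ ∞ u Ω) :
    ContDiffOn ℝ ∞ (fun s => ∫ t in x..y, u (s, t)) {s | ∀ t ∈ Set.uIcc x y, (s, t) ∈ Ω} := by
  have hV := isOpen_setOf_forall_mem hΩ (isCompact_uIcc (a := x) (b := y))
  rw [contDiffOn_infty]
  intro n
  induction n generalizing u with
  | zero =>
    exact contDiffOn_zero.2 fun s hs =>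
      (hasDerivAt_integral_slice hΩ hu hs).continuousAt.continuousWithinAt
  | succ n ih =>
    rw [show ((n + 1 : ℕ) : ℕ∞ω) = (n : ℕ∞ω) + 1 by push_cast; rfl,
      contDiffOn_succ_iff_deriv_of_isOpen hV]
    refine ⟨fun s hs =>
      (hasDerivAt_integral_slice hΩ hu hs).differentiableAt.differentiableWithinAt,
      by simp, (ih (ContDiffOn.partialFst hΩ hu)).congr fun s hs => ?_⟩
    exact (hasDerivAt_integral_slice hΩ hu hs).deriv

theorem iteratedDeriv_integral_slice (hΩ : IsOpen Ω) (hu : ContDiffOn ℝ ∞ u Ω) {s : ℝ}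
    (hs : ∀ t ∈ Set.uIcc x y, (s, t) ∈ Ω) (k : ℕ) :
    iteratedDeriv (k + 1) (fun s => ∫ t in x..y, u (s, t)) s =
      iteratedDeriv k (fun s => ∫ t in x..y, partialFst u (s, t)) s := by
  have hV := isOpen_setOf_forall_mem hΩ (isCompact_uIcc (a := x) (b := y))
  rw [iteratedDeriv_succ']
  refine Filter.EventuallyEq.iteratedDeriv_eq k ?_
  filter_upwards [hV.mem_nhds hs] with s' hs' using (hasDerivAt_integral_slice hΩ hu hs').deriv

variable {w : ℝ → ℝ} {U : Set ℝ}

theorem isOpen_setOf_uIcc_subset (hU : IsOpen U) (x : ℝ) : IsOpen {t | Set.uIcc x t ⊆ U} := by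
  have h : {t | Set.uIcc x t ⊆ U} = {t | ∀ θ ∈ Set.Icc (0 : ℝ) 1, (t, θ) ∈
      (fun z : ℝ × ℝ => x + z.2 • (z.1 - x)) ⁻¹' U} := by
    ext t
    simp only [Set.mem_ofPred_eq, ← segment_eq_uIcc, segment_eq_image', Set.image_subset_iff]
    rfl
  rw [h]
  exact isOpen_setOf_forall_mem (hU.preimage (by fun_prop)) isCompact_Icc

theorem hasDerivAt_integral_of_uIcc_subset (hU : IsOpen U) (hw : ContinuousOn w U) {t : ℝ}
    (ht : Set.uIcc x t ⊆ U) : HasDerivAt (fun t => ∫ s in x..t, w s) (w t) t :=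
  intervalIntegral.integral_hasDerivAt_right (hw.mono ht).intervalIntegrable
    (hw.stronglyMeasurableAtFilter hU t (ht Set.right_mem_uIcc))
    (hw.continuousAt (hU.mem_nhds (ht Set.right_mem_uIcc)))

end Classical

/-! ### Primitives and integrals of generalized smooth functions -/

section Integrals

open Gen

variable {ρ : Gauge} {a b : Gen ρ ℝ}

/-- A generalized smooth function with non-negative derivative is monotone. -/
theorem monotone_of_deriv_nonneg (hab : a < b) {K : Gen ρ ℝ → Gen ρ ℝ}
    (hK : Smooth (Icc a b) K) (hd : ∀ t ∈ Icc a b, 0 ≤ deriv (Icc a b) K t) {p q : Gen ρ ℝ}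
    (hp : p ∈ Icc a b) (hq : q ∈ Icc a b) (hpq : p ≤ q) : K p ≤ K q := by
  obtain ⟨Ω, u, h⟩ := hK
  obtain ⟨z, z', hz, hz', hzz⟩ := hpq
  have hne : ∀ ε, (Set.Icc (z ε) (z' ε)).Nonempty := fun ε => ⟨_, Set.left_mem_Icc.2 (hzz ε)⟩
  have hrep : ∀ w : Idx → ℝ, (∀ ε, w ε ∈ Set.Icc (z ε) (z' ε)) → ∃ t ∈ Icc a b, Rep t w :=
    fun w hw => mem_Icc_of_between hp hq hz hz' fun ε => by
      rw [Set.uIcc_of_le (hzz ε)]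
      exact hw ε
  have h1 := eventually_forall_of_nets hne (p := fun ε w => w ∈ Ω ε) fun w hw => by
    obtain ⟨t, ht, htw⟩ := hrep w hw
    exact h.subset ht w htw
  have h2 := exists_uniform_neg_part (ρ := ρ) hne (g := fun ε w => _root_.fderiv ℝ (u ε) w 1)
    fun w hw => by
      obtain ⟨t, ht, htw⟩ := hrep w hw
      have h3 := h.rep_dirDeriv (isAdmissible_Icc hab) ht htw
      simpa using (le_iff .zero h3).1 (hd t ht)
  refine (le_iff (h.value p hp z hz) (h.value q hq z' hz')).2 fun n => ?_
  obtain ⟨N, hN⟩ := (hz'.sub hz).moderate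
  filter_upwards [h1, h2 (n + N), hN] with ε e1 e2 e3
  have hpos := pow_pos (ρ.pos ε) n
  have hdiff : ∀ t ∈ Set.Icc (z ε) (z' ε), DifferentiableAt ℝ (u ε) t := fun t ht =>
    h.differentiableAt (e1 t ht)
  have h4 := Convex.mul_sub_le_image_sub_of_le_deriv (convex_Icc (z ε) (z' ε))
    (fun t ht => (hdiff t ht).continuousAt.continuousWithinAt)
    (fun t ht => (hdiff t (interior_subset ht)).differentiableWithinAt)
    (C := -ρ ε ^ (n + N)) (fun t ht => by
      rw [← fderiv_apply_one_eq_deriv]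
      exact e2 t (interior_subset ht))
    (z ε) (Set.left_mem_Icc.2 (hzz ε)) (z' ε) (Set.right_mem_Icc.2 (hzz ε)) (hzz ε)
  rw [Real.norm_of_nonneg (sub_nonneg.2 (hzz ε)), le_inv_pow_iff] at e3
  rw [Real.norm_of_nonneg (le_max_right _ _)]
  refine max_le ?_ hpos.le
  have h5 : ρ ε ^ (n + N) * (z' ε - z ε) ≤ ρ ε ^ n := by
    calc ρ ε ^ (n + N) * (z' ε - z ε) = ρ ε ^ n * ((z' ε - z ε) * ρ ε ^ N) := by ring
      _ ≤ ρ ε ^ n * 1 := mul_le_mul_of_nonneg_left e3 hpos.le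
      _ = ρ ε ^ n := mul_one _
  linarith

theorem eq_of_deriv_eq_zero (hab : a < b) {K : Gen ρ ℝ → Gen ρ ℝ} (hK : Smooth (Icc a b) K)
    (hd : ∀ t ∈ Icc a b, deriv (Icc a b) K t = 0) : K a = K b := by
  have ha := left_mem_Icc hab.1
  have hb := right_mem_Icc hab.1
  have h0 : (0 : Gen ρ ℝ) ≤ 0 := le_of_rep .zero .zero fun _ => le_rfl
  refine le_antisymm' (monotone_of_deriv_nonneg hab hK (fun t ht => hd t ht ▸ h0) ha hb hab.1) ?_
  have h1 := monotone_of_deriv_nonneg hab hK.neg (fun t ht => by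
    rw [deriv, show (1 : Gen ρ ℝ) = Gen.const ρ 1 from rfl,
      dirDeriv_neg hK (isAdmissible_Icc hab) ht]
    exact (show -deriv (Icc a b) K t = 0 by rw [hd t ht, neg_zero]) ▸ h0) ha hb hab.1
  obtain ⟨x, y, hx, hy, hxy⟩ := h1
  have hx' : Rep (K a) (fun ε => -x ε) := by simpa using hx.neg
  have hy' : Rep (K b) (fun ε => -y ε) := by simpa using hy.neg
  exact le_of_rep hy' hx' fun ε => neg_le_neg (hxy ε)

/-- The primitives of a net that defines `f` define a primitive of `f`. -/
theorem Defines.exists_primitive (hab : a < b) {f : Gen ρ ℝ → Gen ρ ℝ} {Ω : Idx → Set ℝ}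
    {u : Idx → ℝ → ℝ} (h : Defines (Icc a b) f Ω u) {x : Idx → ℝ} (hx : Rep a x) :
    ∃ Φ, IsPrimitive a b f Φ ∧
      Defines (Icc a b) Φ (fun ε => {t | Set.uIcc (x ε) t ⊆ Ω ε})
        (fun ε t => ∫ s in x ε..t, u ε s) := by
  have ha := left_mem_Icc hab.1
  have hO : ∀ ε, IsOpen {t | Set.uIcc (x ε) t ⊆ Ω ε} := fun ε =>
    isOpen_setOf_uIcc_subset (h.isOpen ε) _
  have hder : ∀ ε, ∀ t ∈ {t | Set.uIcc (x ε) t ⊆ Ω ε},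
      HasDerivAt (fun t => ∫ s in x ε..t, u ε s) (u ε t) t := fun ε t ht =>
    hasDerivAt_integral_of_uIcc_subset (h.isOpen ε) (h.smooth ε).continuousOn ht
  have hne : ∀ (z : Idx → ℝ) ε, (Set.uIcc (x ε) (z ε)).Nonempty := fun z ε => Set.nonempty_uIcc
  have hmem : ∀ p ∈ Icc a b, ∀ z, Rep p z → ∀ᶠ ε in atBot, Set.uIcc (x ε) (z ε) ⊆ Ω ε :=
    fun p hp z hz => eventually_forall_of_nets (hne z) fun w hw => by
      obtain ⟨t, ht, htw⟩ := mem_Icc_of_between ha hp hx hz hw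
      exact h.subset ht w htw
  obtain ⟨Φ, hΦ⟩ : ∃ Φ : Gen ρ ℝ → Gen ρ ℝ,
      Defines (Icc a b) Φ (fun ε => {t | Set.uIcc (x ε) t ⊆ Ω ε})
        (fun ε t => ∫ s in x ε..t, u ε s) := by
    refine exists_defines hO (fun ε => ?_) hmem fun p hp z hz k => ?_
    · rw [contDiffOn_infty_iff_deriv_of_isOpen (hO ε)]
      exact ⟨fun t ht => (hder ε t ht).differentiableAt.differentiableWithinAt,
        ((h.smooth ε).mono fun t (ht : Set.uIcc (x ε) t ⊆ Ω ε) =>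
          ht Set.right_mem_uIcc).congr fun t ht => (hder ε t ht).deriv⟩
    · rcases k with - | k
      · obtain ⟨M, hM, hM0, hb⟩ := exists_uniform_bound (ρ := ρ) (hne z) (g := fun ε w => u ε w)
          fun w hw => by
            obtain ⟨t, ht, htw⟩ := mem_Icc_of_between ha hp hx hz hw
            exact (h.value t ht w htw).moderate
        refine (hM.mul (hz.sub hx).moderate.norm).mono ?_
        filter_upwards [hb] with ε hε
        rw [norm_iteratedFDeriv_zero]
        refine (intervalIntegral.norm_integral_le_of_norm_le_const fun t ht =>
          hε t (Set.uIoc_subset_uIcc ht)).trans (le_abs_self _)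
      · refine (h.moderate p hp z hz k).mono ?_
        filter_upwards [hmem p hp z hz] with ε hε
        rw [norm_iteratedFDeriv_eq_norm_iteratedDeriv, norm_iteratedFDeriv_eq_norm_iteratedDeriv,
          iteratedDeriv_succ']
        refine le_of_eq (congrArg _ (Filter.EventuallyEq.iteratedDeriv_eq k ?_))
        filter_upwards [(hO ε).mem_nhds hε] with t ht using (hder ε t ht).deriv
  refine ⟨Φ, ⟨Smooth.isGSF ⟨_, _, hΦ⟩, ?_, fun t ht => ?_⟩, hΦ⟩
  · have h1 := hΦ.value a ha x hx
    simp only [intervalIntegral.integral_same] at h1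
    exact h1.unique .zero
  · obtain ⟨z, hz⟩ := exists_rep' t
    refine hΦ.dirDeriv_eq (isAdmissible_Icc hab) ht hz (h.value t ht z hz)
      (.of_forall fun ε hε => ?_)
    rw [fderiv_apply_one_eq_deriv, (hder ε _ hε).deriv]

/-- All primitives give the same integral. -/
theorem IsPrimitive.integral_eq (hab : a < b) {f Φ : Gen ρ ℝ → Gen ρ ℝ}
    (hΦ : IsPrimitive a b f Φ) : integral a b f = Φ b := by
  have hex : ∃ Φ, IsPrimitive a b f Φ := ⟨Φ, hΦ⟩
  rw [integral, dif_pos hex]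
  obtain ⟨h1, h1a, h1d⟩ := hex.choose_spec
  obtain ⟨h2, h2a, h2d⟩ := hΦ
  have h := eq_of_deriv_eq_zero hab (h1.smooth.sub h2.smooth) fun t ht => by
    refine (dirDeriv_sub h1.smooth h2.smooth (isAdmissible_Icc hab) ht).trans ?_
    exact sub_eq_zero.2 ((h1d t ht).trans (h2d t ht).symm)
  rw [h1a, h2a, sub_zero] at h
  exact sub_eq_zero.1 h.symm

/-- The integral is represented by the integrals of any net that defines the integrand. -/
theorem Defines.rep_integral (hab : a < b) {f : Gen ρ ℝ → Gen ρ ℝ} {Ω : Idx → Set ℝ}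
    {u : Idx → ℝ → ℝ} (h : Defines (Icc a b) f Ω u) {x y : Idx → ℝ} (hx : Rep a x)
    (hy : Rep b y) : Rep (integral a b f) (fun ε => ∫ s in x ε..y ε, u ε s) := by
  obtain ⟨Φ, hΦ, hD⟩ := h.exists_primitive hab hx
  rw [hΦ.integral_eq hab]
  exact hD.value b (right_mem_Icc hab.1) y hy

theorem Smooth.exists_primitive (hab : a < b) {f : Gen ρ ℝ → Gen ρ ℝ} (h : Smooth (Icc a b) f) :
    ∃ Φ, IsPrimitive a b f Φ := by
  obtain ⟨Ω, u, h⟩ := h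
  obtain ⟨x, hx⟩ := exists_rep' a
  obtain ⟨Φ, hΦ, -⟩ := h.exists_primitive hab hx
  exact ⟨Φ, hΦ⟩

theorem Defines.slice {B : Set (Gen ρ ℝ)} {G : Gen ρ (ℝ × ℝ) → Gen ρ ℝ} {Ω : Idx → Set (ℝ × ℝ)}
    {u : Idx → ℝ × ℝ → ℝ} (h : Defines (prod Set.univ B) G Ω u) {s : Gen ρ ℝ} {z : Idx → ℝ}
    (hz : Rep s z) : ∃ Ω', Defines B (fun t => G (pair s t)) Ω' (fun ε t => u ε (z ε, t)) := by
  have h1 := ((Defines.const B hz).map (ContinuousLinearMap.inl ℝ ℝ ℝ)).add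
    ((Defines.id B).map (ContinuousLinearMap.inr ℝ ℝ ℝ))
  have h2 := h.comp h1 fun t ht => pair_mem_prod trivial ht
  have e : (fun ε => u ε ∘ ((⇑(ContinuousLinearMap.inl ℝ ℝ ℝ) ∘ fun _ => z ε) +
      ⇑(ContinuousLinearMap.inr ℝ ℝ ℝ) ∘ fun x => x)) = fun ε t => u ε (z ε, t) := by
    funext ε t
    simp
  rw [e] at h2
  exact ⟨_, h2⟩

/-- Integrals of generalized smooth functions depending on a parameter are generalized smooth
functions of the parameter, and can be differentiated under the integral sign. -/
theorem smooth_integral (hab : a < b) {G : Gen ρ (ℝ × ℝ) → Gen ρ ℝ}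
    (hG : Smooth (prod Set.univ (Icc a b)) G) :
    Smooth Set.univ (fun s => integral a b fun t => G (pair s t)) ∧
      ∀ s, deriv Set.univ (fun s => integral a b fun t => G (pair s t)) s =
        integral a b fun t => dirDeriv (prod Set.univ (Icc a b)) G (Gen.const ρ (1, 0))
          (pair s t) := by
  obtain ⟨Ω, u, h⟩ := hG
  obtain ⟨x, hx⟩ := exists_rep' a
  obtain ⟨y, hy⟩ := exists_rep' b
  have ha := left_mem_Icc hab.1
  have hb := right_mem_Icc hab.1
  have hadm : IsAdmissible (prod Set.univ (Icc a b)) ((1, 0) : ℝ × ℝ) :=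
    (isAdmissible_univ (1 : ℝ)).prod_left _
  have hne : ∀ ε, (Set.uIcc (x ε) (y ε)).Nonempty := fun ε => Set.nonempty_uIcc
  have hmem : ∀ s (z : Idx → ℝ), Rep s z →
      ∀ᶠ ε in atBot, ∀ t ∈ Set.uIcc (x ε) (y ε), (z ε, t) ∈ Ω ε :=
    fun s z hz => eventually_forall_of_nets hne (p := fun ε t => (z ε, t) ∈ Ω ε) fun w hw => by
      obtain ⟨t, ht, htw⟩ := mem_Icc_of_between ha hb hx hy hw
      exact h.subset (pair_mem_prod trivial ht) _ (hz.pair htw)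
  have hval : ∀ {G : Gen ρ (ℝ × ℝ) → Gen ρ ℝ} {u : Idx → ℝ × ℝ → ℝ},
      Defines (prod Set.univ (Icc a b)) G Ω u → ∀ (s : Gen ρ ℝ) (z : Idx → ℝ), Rep s z →
      Rep (integral a b fun t => G (pair s t)) (fun ε => ∫ t in x ε..y ε, u ε (z ε, t)) := by
    intro G u h s z hz
    obtain ⟨Ω', h'⟩ := h.slice hz
    exact h'.rep_integral hab hx hy
  have hmod : ∀ (k : ℕ) {G : Gen ρ (ℝ × ℝ) → Gen ρ ℝ} {u : Idx → ℝ × ℝ → ℝ},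
      Defines (prod Set.univ (Icc a b)) G Ω u → ∀ (s : Gen ρ ℝ) (z : Idx → ℝ), Rep s z →
      IsModerate ρ (fun ε => iteratedDeriv k (fun s => ∫ t in x ε..y ε, u ε (s, t)) (z ε)) := by
    intro k
    induction k with
    | zero =>
      intro G u h s z hz
      simpa only [iteratedDeriv_zero] using (hval h s z hz).moderate
    | succ k ih =>
      intro G u h s z hz
      refine (ih (h.dirDeriv hadm) s z hz).mono ?_
      filter_upwards [hmem s z hz] with ε hε
      rw [iteratedDeriv_integral_slice (h.isOpen ε) (h.smooth ε) hε]
      rfl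
  have hD : Defines Set.univ (fun s => integral a b fun t => G (pair s t))
      (fun ε => {s | ∀ t ∈ Set.uIcc (x ε) (y ε), (s, t) ∈ Ω ε})
      (fun ε s => ∫ t in x ε..y ε, u ε (s, t)) := by
    refine ⟨fun ε => isOpen_setOf_forall_mem (h.isOpen ε) isCompact_uIcc,
      fun ε => contDiffOn_integral_slice (h.isOpen ε) (h.smooth ε), fun s _ z hz => hmem s z hz,
      fun s _ z hz k => (hmod k h s z hz).mono (.of_forall fun ε => ?_),
      fun s _ z hz => hval h s z hz⟩
    rw [norm_iteratedFDeriv_eq_norm_iteratedDeriv]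
  refine ⟨⟨_, _, hD⟩, fun s => ?_⟩
  obtain ⟨z, hz⟩ := exists_rep' s
  refine hD.dirDeriv_eq (isAdmissible_univ (1 : ℝ)) trivial hz
    (hval (h.dirDeriv hadm) s z hz) (.of_forall fun ε hε => ?_)
  rw [fderiv_apply_one_eq_deriv, (hasDerivAt_integral_slice (h.isOpen ε) (h.smooth ε) hε).deriv]
  rfl

end Integrals

/-! ### Functions of one generalized variable -/

section OneVariable

open Gen

variable {ρ : Gauge} {F G : Type*} [NormedAddCommGroup F] [NormedSpace ℝ F]
  [NormedAddCommGroup G] [NormedSpace ℝ G] {X : Set (Gen ρ ℝ)} {f f' : Gen ρ ℝ → Gen ρ F}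
  {t : Gen ρ ℝ}

theorem deriv_congr (h : ∀ t ∈ X, f t = f' t) (t : Gen ρ ℝ) : deriv X f t = deriv X f' t :=
  dirDeriv_congr h _ _

theorem Smooth.deriv (h : Smooth X f) (hX : IsAdmissible X (1 : ℝ)) : Smooth X (deriv X f) :=
  h.dirDeriv hX

theorem deriv_mono {X' : Set (Gen ρ ℝ)} (h : Smooth X f) (hX : X' ⊆ X)
    (hv : IsAdmissible X (1 : ℝ)) (hv' : IsAdmissible X' (1 : ℝ)) (ht : t ∈ X') :
    deriv X' f t = deriv X f t := dirDeriv_mono h hX hv hv' ht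

theorem deriv_add (h : Smooth X f) (h' : Smooth X f') (hX : IsAdmissible X (1 : ℝ))
    (ht : t ∈ X) : deriv X (fun t => f t + f' t) t = deriv X f t + deriv X f' t :=
  dirDeriv_add h h' hX ht

theorem deriv_sub (h : Smooth X f) (h' : Smooth X f') (hX : IsAdmissible X (1 : ℝ))
    (ht : t ∈ X) : deriv X (fun t => f t - f' t) t = deriv X f t - deriv X f' t :=
  dirDeriv_sub h h' hX ht

theorem deriv_sum {ι : Type*} (s : Finset ι) {f : ι → Gen ρ ℝ → Gen ρ F}
    (h : ∀ i ∈ s, Smooth X (f i)) (hX : IsAdmissible X (1 : ℝ)) (ht : t ∈ X) :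
    deriv X (fun t => ∑ i ∈ s, f i t) t = ∑ i ∈ s, deriv X (f i) t :=
  dirDeriv_sum s h hX ht

theorem deriv_zsmul (h : Smooth X f) (n : ℤ) (hX : IsAdmissible X (1 : ℝ)) (ht : t ∈ X) :
    deriv X (fun t => n • f t) t = n • deriv X f t := dirDeriv_zsmul h n hX ht

theorem deriv_const (X : Set (Gen ρ ℝ)) (c : Gen ρ F) (hX : IsAdmissible X (1 : ℝ))
    (ht : t ∈ X) : deriv X (fun _ => c) t = 0 := dirDeriv_const X c hX ht

theorem deriv_id (X : Set (Gen ρ ℝ)) (hX : IsAdmissible X (1 : ℝ)) (ht : t ∈ X) :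
    deriv X (fun t => t) t = 1 := dirDeriv_id X hX ht

theorem deriv_mul {f f' : Gen ρ ℝ → Gen ρ ℝ} (h : Smooth X f) (h' : Smooth X f')
    (hX : IsAdmissible X (1 : ℝ)) (ht : t ∈ X) :
    deriv X (fun t => f t * f' t) t = f t * deriv X f' t + deriv X f t * f' t :=
  dirDeriv_mul h h' hX ht

theorem deriv_smul {c : Gen ρ ℝ → Gen ρ ℝ} (hc : Smooth X c) (h : Smooth X f)
    (hX : IsAdmissible X (1 : ℝ)) (ht : t ∈ X) :
    deriv X (fun t => c t • f t) t = c t • deriv X f t + deriv X c t • f t :=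
  dirDeriv_smul hc h hX ht

theorem deriv_dot {F : Type*} [NormedAddCommGroup F] [InnerProductSpace ℝ F]
    {f f' : Gen ρ ℝ → Gen ρ F} (h : Smooth X f) (h' : Smooth X f')
    (hX : IsAdmissible X (1 : ℝ)) (ht : t ∈ X) :
    deriv X (fun t => dot (f t) (f' t)) t = dot (f t) (deriv X f' t) + dot (deriv X f t) (f' t) :=
  dirDeriv_dot h h' hX ht

theorem iterDeriv_succ (X : Set (Gen ρ ℝ)) (i : ℕ) (f : Gen ρ ℝ → Gen ρ F) :
    iterDeriv X (i + 1) f = deriv X (iterDeriv X i f) := Function.iterate_succ_apply' _ _ _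

theorem Smooth.iterDeriv (h : Smooth X f) (hX : IsAdmissible X (1 : ℝ)) (i : ℕ) :
    Smooth X (iterDeriv X i f) := by
  induction i with
  | zero => exact h
  | succ i ih =>
    rw [iterDeriv_succ]
    exact ih.deriv hX

theorem iterDeriv_congr (h : ∀ t ∈ X, f t = f' t) (i : ℕ) :
    ∀ t ∈ X, iterDeriv X i f t = iterDeriv X i f' t := by
  induction i with
  | zero => exact h
  | succ i ih =>
    intro t _
    rw [iterDeriv_succ, iterDeriv_succ, deriv_congr ih]

theorem iterDeriv_add_smul (h : Smooth X f) (h' : Smooth X f') (hX : IsAdmissible X (1 : ℝ))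
    (c : Gen ρ ℝ) (i : ℕ) : ∀ t ∈ X, iterDeriv X i (fun t => f t + c • f' t) t =
      iterDeriv X i f t + c • iterDeriv X i f' t := by
  induction i with
  | zero => exact fun t _ => rfl
  | succ i ih =>
    intro t ht
    have hc := Smooth.const X c
    rw [iterDeriv_succ, iterDeriv_succ, iterDeriv_succ, deriv_congr ih,
      deriv_add (h.iterDeriv hX i) (hc.smul (h'.iterDeriv hX i)) hX ht,
      deriv_smul hc (h'.iterDeriv hX i) hX ht, deriv_const X c hX ht, zero_smul, add_zero]

/-- Differentiating lowers the order of vanishing by at most one. -/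
theorem exists_deriv_pow_smul {c : Gen ρ ℝ → Gen ρ ℝ} (hc : Smooth X c)
    (hX : IsAdmissible X (1 : ℝ))
    (h : Smooth X f) (k : ℕ) : ∃ g, Smooth X g ∧
      ∀ t ∈ X, deriv X (fun t => c t ^ (k + 1) • f t) t = c t ^ k • g t := by
  induction k with
  | zero =>
    exact ⟨_, (hc.smul h).deriv hX, fun t _ => by simp⟩
  | succ k ih =>
    obtain ⟨g, hg, hgd⟩ := ih
    refine ⟨fun t => g t + deriv X c t • f t, hg.add ((hc.deriv hX).smul h), fun t ht => ?_⟩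
    have e : ∀ t ∈ X, c t ^ (k + 1 + 1) • f t = c t • c t ^ (k + 1) • f t := fun t _ => by
      rw [smul_smul, ← pow_succ']
    rw [deriv_congr e, deriv_smul hc ((hc.pow _).smul h) hX ht, hgd t ht, smul_smul, ← pow_succ',
      smul_add, smul_comm]

theorem iterDeriv_pow_smul_eq_zero {c : Gen ρ ℝ → Gen ρ ℝ} (hc : Smooth X c)
    (hX : IsAdmissible X (1 : ℝ)) (h : Smooth X f) {i k : ℕ} (hik : i < k) (ht : t ∈ X)
    (hct : c t = 0) : iterDeriv X i (fun t => c t ^ k • f t) t = 0 := by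
  induction i generalizing k f with
  | zero =>
    change c t ^ k • f t = 0
    rw [hct, zero_pow hik.ne', zero_smul]
  | succ i ih =>
    obtain ⟨k, rfl⟩ : ∃ k', k = k' + 1 := ⟨k - 1, by omega⟩
    obtain ⟨g, hg, hgd⟩ := exists_deriv_pow_smul hc hX h k
    change iterDeriv X i (deriv X fun t => c t ^ (k + 1) • f t) t = 0
    rw [iterDeriv_congr hgd i t ht]
    exact ih hg (by omega)

/-- A factor with invertible derivative can be cancelled: from `c g = 0` one gets `c g' + c' g = 0`,
hence `c' g² = 0`, and the ring of generalized numbers is reduced. -/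
theorem eq_zero_of_mul_eq_zero {c g : Gen ρ ℝ → Gen ρ ℝ} (hX : IsAdmissible X (1 : ℝ))
    (hc : Smooth X c) (hcu : ∀ t ∈ X, IsUnit (deriv X c t)) (hg : Smooth X g)
    (h : ∀ t ∈ X, c t * g t = 0) : ∀ t ∈ X, g t = 0 := by
  intro t ht
  have h1 := deriv_mul hc hg hX ht
  rw [deriv_congr h, deriv_const X _ hX ht] at h1
  refine eq_zero_of_mul_self ((hcu t ht).mul_left_cancel ?_)
  calc deriv X c t * (g t * g t)
      = g t * (c t * deriv X g t + deriv X c t * g t) - (c t * g t) * deriv X g t := by ring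
    _ = deriv X c t * 0 := by rw [← h1, h t ht]; ring

theorem eq_zero_of_pow_mul_eq_zero {c g : Gen ρ ℝ → Gen ρ ℝ} (hX : IsAdmissible X (1 : ℝ))
    (hc : Smooth X c) (hcu : ∀ t ∈ X, IsUnit (deriv X c t)) (hg : Smooth X g) (k : ℕ)
    (h : ∀ t ∈ X, c t ^ k * g t = 0) : ∀ t ∈ X, g t = 0 := by
  induction k with
  | zero => simpa using h
  | succ k ih =>
    refine ih (eq_zero_of_mul_eq_zero hX hc hcu ((hc.pow k).mul hg) fun t ht => ?_)
    rw [← mul_assoc, ← pow_succ']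
    exact h t ht

theorem integral_congr {a b : Gen ρ ℝ} {f f' : Gen ρ ℝ → Gen ρ ℝ} (h : ∀ t ∈ Icc a b, f t = f' t) :
    integral a b f = integral a b f' := by
  have : IsPrimitive a b f = IsPrimitive a b f' := funext fun Φ => propext
    ⟨fun hΦ => ⟨hΦ.1, hΦ.2.1, fun t ht => (hΦ.2.2 t ht).trans (h t ht)⟩,
      fun hΦ => ⟨hΦ.1, hΦ.2.1, fun t ht => (hΦ.2.2 t ht).trans (h t ht).symm⟩⟩
  unfold GSF.integral
  rw [this]

end OneVariable

/-! ### Gradients of Lagrangians -/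

section Gradient

open Gen

variable {ρ : Gauge} {d m : ℕ} {t₁ t₂ : Gen ρ ℝ} {L : Gen ρ (Jet d m) → Gen ρ ℝ}
  {DL : Gen ρ (Jet d m) → Gen ρ (Jet d m →L[ℝ] ℝ)}

/-- The vector of the jet space with component `e_k` in the variable `q^{(i)}`. -/
noncomputable def jetBasis (d m i : ℕ) (k : Fin d) : Jet d m :=
  (0, fun l => if (l : ℕ) = i then EuclideanSpace.single k 1 else 0)

/-- The gradient of a linear form on the jet space with respect to the variable `q^{(i)}`. -/
noncomputable def gradForm (d m i : ℕ) : (Jet d m →L[ℝ] ℝ) →L[ℝ] Space d :=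
  ∑ k : Fin d, (ContinuousLinearMap.apply ℝ ℝ (jetBasis d m i k)).smulRight
    (EuclideanSpace.single k (1 : ℝ))

theorem gradForm_apply (i : ℕ) (A : Jet d m →L[ℝ] ℝ) :
    gradForm d m i A = ∑ k : Fin d, A (jetBasis d m i k) • EuclideanSpace.single k (1 : ℝ) := by
  simp [gradForm]

theorem inner_gradForm (i : Fin (m + 1)) (A : Jet d m →L[ℝ] ℝ) (v : Space d) :
    inner ℝ (gradForm d m i A) v = A (0, Pi.single i v) := by
  have hv : ((0, Pi.single i v) : Jet d m) = ∑ k : Fin d, v k • jetBasis d m i k := by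
    refine Prod.ext ?_ (funext fun l => ?_)
    · simp [Prod.fst_sum, jetBasis]
    · rw [Prod.snd_sum, Finset.sum_apply]
      by_cases hl : l = i
      · subst hl
        ext j
        simp [jetBasis, Pi.single_apply]
      · have hl' : (l : ℕ) ≠ i := fun h => hl (Fin.ext h)
        simp [jetBasis, hl, hl']
  rw [hv, map_sum, gradForm_apply, sum_inner]
  refine Finset.sum_congr rfl fun k _ => ?_
  rw [map_smul, real_inner_smul_left, EuclideanSpace.inner_single_left]
  simp [mul_comm]

/-- A linear form on the jet space in terms of its gradients. -/
theorem app_pair_tuple (A : Gen ρ (Jet d m →L[ℝ] ℝ)) (c : Gen ρ ℝ) (y : ℕ → Gen ρ (Space d)) :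
    app A (pair c (tuple fun i : Fin (m + 1) => y i)) =
      c * app A (const ρ (1, 0)) +
        ∑ i ∈ Finset.range (m + 1), dot (map (gradForm d m i) A) (y i) := by
  obtain ⟨a, ha⟩ := exists_rep' A
  obtain ⟨r, hr⟩ := exists_rep' c
  choose z hz using fun i => exists_rep' (y i)
  have h1 := ha.app (hr.pair (Rep.tuple fun i : Fin (m + 1) => hz i))
  have h2 := (hr.mul (ha.app (Rep.const ((1, 0) : Jet d m)))).add (Rep.sum (Finset.range (m + 1))
    fun i _ => (ha.map (gradForm d m i)).dot (hz i))
  refine h1.eq_of_eventuallyEq h2 (.of_forall fun ε => ?_)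
  have h3 : ((r ε, fun i : Fin (m + 1) => z i ε) : Jet d m) =
      r ε • (1, 0) + ∑ i : Fin (m + 1), ((0, Pi.single i (z i ε)) : Jet d m) := by
    refine Prod.ext ?_ ?_
    · simp [Prod.fst_sum]
    · simp only [Prod.snd_add, Prod.snd_sum, Prod.smul_snd, smul_zero, zero_add]
      exact (Finset.univ_sum_single fun i : Fin (m + 1) => z i ε).symm
  beta_reduce
  rw [Finset.sum_range (f := fun i => inner ℝ (gradForm d m i (a ε)) (z i ε))]
  simp only [inner_gradForm]
  rw [h3, map_add, map_smul, map_sum, smul_eq_mul]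

theorem isAdmissible_jetDomain (t₁ t₂ : Gen ρ ℝ) (v : Fin (m + 1) → Space d) :
    IsAdmissible (jetDomain d m t₁ t₂) ((0, v) : Jet d m) :=
  (isAdmissible_univ v).prod_right _

theorem gradL_eq (hDL : HasTotalDeriv (jetDomain d m t₁ t₂) L DL) (i : ℕ) {z : Gen ρ (Jet d m)}
    (hz : z ∈ jetDomain d m t₁ t₂) : gradL t₁ t₂ L i z = map (gradForm d m i) (DL z) := by
  obtain ⟨a, ha⟩ := exists_rep' (DL z)
  have h1 : Rep (gradL t₁ t₂ L i z) (fun ε => ∑ k : Fin d, a ε (jetBasis d m i k) •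
      EuclideanSpace.single k (1 : ℝ)) := Rep.sum _ fun k _ => by
    refine Rep.smul ?_ (Rep.const _)
    rw [hDL.dirDeriv_eq (isAdmissible_jetDomain t₁ t₂ _) hz]
    exact ha.app (Rep.const _)
  refine h1.unique ?_
  simpa only [gradForm_apply] using ha.map (gradForm d m i)

variable {E : Type*} [NormedAddCommGroup E] [NormedSpace ℝ E] {X : Set (Gen ρ E)} {v : E}

theorem smooth_comp_pair_tuple {F : Type*} [NormedAddCommGroup F] [NormedSpace ℝ F]
    {M : Gen ρ (Jet d m) → Gen ρ F} (hM : Smooth (jetDomain d m t₁ t₂) M) {c : Gen ρ E → Gen ρ ℝ}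
    {y : ℕ → Gen ρ E → Gen ρ (Space d)} (hc : Smooth X c) (hcm : Set.MapsTo c X (Icc t₁ t₂))
    (hy : ∀ i ≤ m, Smooth X (y i)) :
    Smooth X (fun p => M (pair (c p) (tuple fun i : Fin (m + 1) => y i p))) :=
  hM.comp (hc.pair (Smooth.tuple fun i : Fin (m + 1) => hy i (Nat.lt_succ_iff.1 i.2)))
    fun _ hp => pair_mem_prod (hcm hp) trivial

/-- The chain rule for Lagrangians. -/
theorem dirDeriv_lagrangian (hDL : HasTotalDeriv (jetDomain d m t₁ t₂) L DL) {c : Gen ρ E → Gen ρ ℝ}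
    {y : ℕ → Gen ρ E → Gen ρ (Space d)} (hc : Smooth X c) (hcm : Set.MapsTo c X (Icc t₁ t₂))
    (hy : ∀ i ≤ m, Smooth X (y i)) (hv : IsAdmissible X v) {p : Gen ρ E} (hp : p ∈ X)
    {z : Gen ρ (Jet d m)} (hz : z = pair (c p) (tuple fun i : Fin (m + 1) => y i p)) :
    dirDeriv X (fun p => L (pair (c p) (tuple fun i : Fin (m + 1) => y i p))) (const ρ v) p =
      dirDeriv X c (const ρ v) p * app (DL z) (const ρ (1, 0)) +
        ∑ i ∈ Finset.range (m + 1), dot (gradL t₁ t₂ L i z) (dirDeriv X (y i) (const ρ v) p) := by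
  have hy' : ∀ i : Fin (m + 1), Smooth X (y i) := fun i => hy i (Nat.lt_succ_iff.1 i.2)
  have hmaps : Set.MapsTo (fun p => pair (c p) (tuple fun i : Fin (m + 1) => y i p)) X
      (jetDomain d m t₁ t₂) := fun _ hp => pair_mem_prod (hcm hp) trivial
  rw [hDL.dirDeriv_comp (hc.pair (Smooth.tuple hy')) hmaps hv hp,
    dirDeriv_pair hc (Smooth.tuple hy') hv hp, dirDeriv_tuple hy' hv hp, ← hz,
    app_pair_tuple _ _ fun i => dirDeriv X (y i) (const ρ v) p]
  refine congrArg _ (Finset.sum_congr rfl fun i _ => ?_)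
  rw [gradL_eq hDL i (hz ▸ hmaps hp)]

end Gradient

/-! ### Momenta and the Euler–Lagrange equations -/

section EulerLagrange

open Gen

variable {ρ : Gauge} {d m : ℕ} {t₁ t₂ : Gen ρ ℝ} {L : Gen ρ (Jet d m) → Gen ρ ℝ}
  {q : Gen ρ ℝ → Gen ρ (Space d)}

theorem smooth_jet_comp {F : Type*} [NormedAddCommGroup F] [NormedSpace ℝ F]
    {M : Gen ρ (Jet d m) → Gen ρ F} (hM : Smooth (jetDomain d m t₁ t₂) M) (ht : t₁ < t₂)
    (hq : Smooth (Icc t₁ t₂) q) : Smooth (Icc t₁ t₂) (fun t => M (jet m t₁ t₂ q t)) :=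
  smooth_comp_pair_tuple hM (Smooth.id _) (fun _ h => h)
    (y := fun i => iterDeriv (Icc t₁ t₂) i q) fun i _ => hq.iterDeriv (isAdmissible_Icc ht) i

theorem smooth_gradL (hL : Smooth (jetDomain d m t₁ t₂) L) (i : ℕ) :
    Smooth (jetDomain d m t₁ t₂) (gradL t₁ t₂ L i) := by
  obtain ⟨DL, hDL⟩ := hL.exists_hasTotalDeriv
  exact (hDL.smooth_deriv.map (gradForm d m i)).congr fun z hz => (gradL_eq hDL i hz).symm

theorem smooth_gradL_jet (hL : Smooth (jetDomain d m t₁ t₂) L) (ht : t₁ < t₂)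
    (hq : Smooth (Icc t₁ t₂) q) (i : ℕ) :
    Smooth (Icc t₁ t₂) (fun t => gradL t₁ t₂ L i (jet m t₁ t₂ q t)) :=
  smooth_jet_comp (smooth_gradL hL i) ht hq

theorem smooth_momentum (hL : Smooth (jetDomain d m t₁ t₂) L) (ht : t₁ < t₂)
    (hq : Smooth (Icc t₁ t₂) q) (j : ℕ) : Smooth (Icc t₁ t₂) (momentum t₁ t₂ L j q) :=
  Smooth.sum _ fun _ _ => ((smooth_gradL_jet hL ht hq _).iterDeriv (isAdmissible_Icc ht) _).zsmul _

theorem momentum_self (t : Gen ρ ℝ) :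
    momentum t₁ t₂ L m q t = gradL t₁ t₂ L m (jet m t₁ t₂ q t) := by
  simp [momentum, iterDeriv]

/-- The recursion satisfied by the momenta. The momentum of order `0` is the Euler–Lagrange
expression. -/
theorem deriv_momentum_succ (hL : Smooth (jetDomain d m t₁ t₂) L) (ht : t₁ < t₂)
    (hq : Smooth (Icc t₁ t₂) q) {j : ℕ} (hj : j < m) {t : Gen ρ ℝ} (htI : t ∈ Icc t₁ t₂) :
    deriv (Icc t₁ t₂) (momentum t₁ t₂ L (j + 1) q) t =
      gradL t₁ t₂ L j (jet m t₁ t₂ q t) - momentum t₁ t₂ L j q t := by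
  have hI := isAdmissible_Icc ht
  have hs : ∀ i k, Smooth (Icc t₁ t₂)
      (iterDeriv (Icc t₁ t₂) i fun r => gradL t₁ t₂ L k (jet m t₁ t₂ q r)) := fun i k =>
    (smooth_gradL_jet hL ht hq k).iterDeriv hI i
  have h1 : deriv (Icc t₁ t₂) (momentum t₁ t₂ L (j + 1) q) t =
      ∑ i ∈ Finset.range (m - (j + 1) + 1), (-1 : ℤ) ^ i • iterDeriv (Icc t₁ t₂) (i + 1)
        (fun r => gradL t₁ t₂ L (i + (j + 1)) (jet m t₁ t₂ q r)) t := by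
    refine (deriv_sum _ (fun i _ => (hs i _).zsmul _) hI htI).trans
      (Finset.sum_congr rfl fun i _ => ?_)
    rw [deriv_zsmul (hs i _) _ hI htI, iterDeriv_succ]
  rw [h1, show m - (j + 1) + 1 = m - j by omega, momentum, Finset.sum_range_succ']
  simp only [pow_zero, one_smul, zero_add, iterDeriv, Function.iterate_zero, id]
  rw [sub_add_cancel_right, ← Finset.sum_neg_distrib]
  refine Finset.sum_congr rfl fun i _ => ?_
  rw [pow_succ, mul_neg_one, neg_smul, neg_neg, show i + 1 + j = i + (j + 1) by omega]

/-- Summation by parts for the momenta, on a domain `X ⊆ [t₁,t₂]`: the terms `φ^i · ξ^i` cancel. -/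
theorem deriv_sum_dot_momentum (hL : Smooth (jetDomain d m t₁ t₂) L) (ht : t₁ < t₂)
    (hq : Smooth (Icc t₁ t₂) q) {X : Set (Gen ρ ℝ)} (hXI : X ⊆ Icc t₁ t₂)
    (hX : IsAdmissible X (1 : ℝ)) {ξ : ℕ → Gen ρ ℝ → Gen ρ (Space d)}
    (hξ : ∀ i < m, Smooth X (ξ i)) {t : Gen ρ ℝ} (htX : t ∈ X) :
    deriv X (fun t => ∑ i ∈ Finset.range m, dot (momentum t₁ t₂ L (i + 1) q t) (ξ i t)) t =
      ∑ i ∈ Finset.range (m + 1), dot (gradL t₁ t₂ L i (jet m t₁ t₂ q t)) (ξ i t) -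
        dot (momentum t₁ t₂ L 0 q t) (ξ 0 t) +
        ∑ i ∈ Finset.range m,
          dot (momentum t₁ t₂ L (i + 1) q t) (deriv X (ξ i) t - ξ (i + 1) t) := by
  have hφ : ∀ i, Smooth X (momentum t₁ t₂ L i q) := fun i => (smooth_momentum hL ht hq i).mono hXI
  rw [deriv_sum _ (fun i hi => (hφ (i + 1)).dot (hξ i (Finset.mem_range.1 hi))) hX htX]
  have h1 : ∀ i ∈ Finset.range m,
      deriv X (fun t => dot (momentum t₁ t₂ L (i + 1) q t) (ξ i t)) t =
        dot (gradL t₁ t₂ L i (jet m t₁ t₂ q t)) (ξ i t) +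
        (dot (momentum t₁ t₂ L (i + 1) q t) (ξ (i + 1) t) - dot (momentum t₁ t₂ L i q t) (ξ i t)) +
        dot (momentum t₁ t₂ L (i + 1) q t) (deriv X (ξ i) t - ξ (i + 1) t) := fun i hi => by
    have him := Finset.mem_range.1 hi
    rw [deriv_dot (hφ (i + 1)) (hξ i him) hX htX,
      deriv_mono (smooth_momentum hL ht hq (i + 1)) hXI (isAdmissible_Icc ht) hX htX,
      deriv_momentum_succ hL ht hq him (hXI htX), sub_dot, dot_sub]
    ring
  rw [Finset.sum_congr rfl h1, Finset.sum_add_distrib, Finset.sum_add_distrib,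
    Finset.sum_range_sub (fun i => dot (momentum t₁ t₂ L i q t) (ξ i t)), Finset.sum_range_succ _ m,
    momentum_self]
  ring

/-- The first variation is the integral of `∑ ∂L/∂q^{(i)} · h^{(i)}`. -/
theorem firstVariation_eq (hL : Smooth (jetDomain d m t₁ t₂) L) (ht : t₁ < t₂)
    (hq : Smooth (Icc t₁ t₂) q) {h : Gen ρ ℝ → Gen ρ (Space d)} (hh : Smooth (Icc t₁ t₂) h) :
    firstVariation t₁ t₂ L q h = integral t₁ t₂ fun t => ∑ i ∈ Finset.range (m + 1),
      dot (gradL t₁ t₂ L i (jet m t₁ t₂ q t)) (iterDeriv (Icc t₁ t₂) i h t) := by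
  have hI := isAdmissible_Icc ht
  obtain ⟨DL, hDL⟩ := hL.exists_hasTotalDeriv
  set W : Set (Gen ρ (ℝ × ℝ)) := prod Set.univ (Icc t₁ t₂)
  set c : Gen ρ (ℝ × ℝ) → Gen ρ ℝ := fun z => snd z with hcdef
  set y : ℕ → Gen ρ (ℝ × ℝ) → Gen ρ (Space d) := fun i z =>
    iterDeriv (Icc t₁ t₂) i q (snd z) + fst z • iterDeriv (Icc t₁ t₂) i h (snd z) with hydef
  set M : Gen ρ (ℝ × ℝ) → Gen ρ ℝ := fun z => L (pair (c z) (tuple fun i : Fin (m + 1) => y i z))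
    with hMdef
  have hsnd : Set.MapsTo c W (Icc t₁ t₂) := fun z hz => hz.2
  have hc : Smooth W c := Smooth.snd W
  have hy : ∀ i, Smooth W (y i) := fun i =>
    ((hq.iterDeriv hI i).comp hc hsnd).add ((Smooth.fst W).smul ((hh.iterDeriv hI i).comp hc hsnd))
  have hM : Smooth W M := smooth_comp_pair_tuple hL hc hsnd fun i _ => hy i
  have hact : (fun s => action t₁ t₂ L fun t => q t + s • h t) =
      fun s => integral t₁ t₂ fun t => M (pair s t) := funext fun s => by
    refine integral_congr fun t ht' => ?_
    simp only [hMdef, hcdef, hydef, jet, fst_pair, snd_pair]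
    refine congrArg L (congrArg _ (congrArg _ (funext fun i => ?_)))
    exact iterDeriv_add_smul hq hh hI s i t ht'
  rw [firstVariation, hact, (smooth_integral ht hM).2]
  refine integral_congr fun t ht' => ?_
  rw [← dirDeriv_slice_left hM (isAdmissible_univ (1 : ℝ)) trivial ht']
  have hcs : Smooth Set.univ (fun s => c (pair s t)) := smooth_slice_left hc ht'
  have hys : ∀ i, Smooth Set.univ (fun s => y i (pair s t)) := fun i => smooth_slice_left (hy i) ht'
  have hz : jet m t₁ t₂ q t =
      pair (c (pair 0 t)) (tuple fun i : Fin (m + 1) => y i (pair 0 t)) := by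
    simp [hcdef, hydef, jet]
  have huniv := isAdmissible_univ (ρ := ρ) (1 : ℝ)
  refine (dirDeriv_lagrangian hDL (y := fun i s => y i (pair s t)) hcs (fun s _ => hsnd
    (pair_mem_prod trivial ht')) (fun i _ => hys i) huniv trivial hz).trans ?_
  have hc0 : dirDeriv Set.univ (fun s : Gen ρ ℝ => c (pair s t)) (const ρ 1) 0 = 0 := by
    simp only [hcdef, snd_pair]
    exact dirDeriv_const _ _ huniv trivial
  rw [hc0, zero_mul, zero_add]
  refine Finset.sum_congr rfl fun i _ => congrArg _ ?_
  simp only [hydef, snd_pair, fst_pair]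
  rw [dirDeriv_add (Smooth.const _ _) ((Smooth.id _).smul (Smooth.const _ _)) huniv trivial,
    dirDeriv_smul (Smooth.id _) (Smooth.const _ _) huniv trivial, dirDeriv_const _ _ huniv trivial,
    dirDeriv_const _ _ huniv trivial, dirDeriv_id _ huniv trivial, smul_zero, zero_add, zero_add]
  exact one_smul (Gen ρ ℝ) _

/-- The Euler–Lagrange equations. The variation `h = (t - t₁)^m (t₂ - t)^m E`, where `E` is the
Euler–Lagrange expression, shows that a function with derivative
`(t - t₁)^m (t₂ - t)^m E · E ≥ 0` vanishes at both endpoints. It is therefore constant, and the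
powers of `t - t₁` and `t₂ - t` can be cancelled. -/
theorem IsWeakExtremal.momentum_zero (hext : IsWeakExtremal t₁ t₂ L q)
    (hL : Smooth (jetDomain d m t₁ t₂) L) (ht : t₁ < t₂) :
    ∀ t ∈ Icc t₁ t₂, momentum t₁ t₂ L 0 q t = 0 := by
  have hI := isAdmissible_Icc ht
  have hq := hext.1.smooth
  have h1I := left_mem_Icc ht.1
  have h2I := right_mem_Icc ht.1
  set I := Icc t₁ t₂
  set e := momentum t₁ t₂ L 0 q
  have he : Smooth I e := smooth_momentum hL ht hq 0
  set c₁ : Gen ρ ℝ → Gen ρ ℝ := fun t => t - t₁ with hc₁def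
  set c₂ : Gen ρ ℝ → Gen ρ ℝ := fun t => t₂ - t with hc₂def
  have hc₁ : Smooth I c₁ := (Smooth.id I).sub (Smooth.const I t₁)
  have hc₂ : Smooth I c₂ := (Smooth.const I t₂).sub (Smooth.id I)
  set h : Gen ρ ℝ → Gen ρ (Space d) := fun t => c₁ t ^ m • c₂ t ^ m • e t with hhdef
  have hh : Smooth I h := (hc₁.pow m).smul ((hc₂.pow m).smul he)
  have hvan : ∀ i < m, iterDeriv I i h t₁ = 0 ∧ iterDeriv I i h t₂ = 0 := fun i hi => by
    refine ⟨iterDeriv_pow_smul_eq_zero hc₁ hI ((hc₂.pow m).smul he) hi h1I (sub_self _), ?_⟩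
    rw [iterDeriv_congr (f' := fun t => c₂ t ^ m • c₁ t ^ m • e t) (fun t _ => smul_comm _ _ _) i
      _ h2I]
    exact iterDeriv_pow_smul_eq_zero hc₂ hI ((hc₁.pow m).smul he) hi h2I (sub_self _)
  have hvar := hext.2 h ⟨hh.isGSF, hvan⟩
  rw [firstVariation_eq hL ht hq hh] at hvar
  have hhi : ∀ i, Smooth I (iterDeriv I i h) := fun i => hh.iterDeriv hI i
  obtain ⟨Φ, hΦ⟩ := Smooth.exists_primitive ht (Smooth.sum (Finset.range (m + 1))
    fun i _ => (smooth_gradL_jet hL ht hq i).dot (hhi i))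
  rw [hΦ.integral_eq ht] at hvar
  set B : Gen ρ ℝ → Gen ρ ℝ := fun t => ∑ i ∈ Finset.range m,
    dot (momentum t₁ t₂ L (i + 1) q t) (iterDeriv I i h t) with hBdef
  have hB : Smooth I B := Smooth.sum _ fun i _ => (smooth_momentum hL ht hq (i + 1)).dot (hhi i)
  set K : Gen ρ ℝ → Gen ρ ℝ := fun t => Φ t - B t with hKdef
  have hK : Smooth I K := hΦ.1.smooth.sub hB
  have hKd : ∀ t ∈ I, deriv I K t = c₁ t ^ m * (c₂ t ^ m * dot (e t) (e t)) := fun t htI => by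
    rw [deriv_sub hΦ.1.smooth hB hI htI, hΦ.2.2 t htI,
      deriv_sum_dot_momentum hL ht hq subset_rfl hI (fun i _ => hhi i) htI]
    have h0 : ∑ i ∈ Finset.range m, dot (momentum t₁ t₂ L (i + 1) q t)
        (deriv I (iterDeriv I i h) t - iterDeriv I (i + 1) h t) = 0 :=
      Finset.sum_eq_zero fun i _ => by rw [iterDeriv_succ, sub_self, dot_zero]
    rw [h0, add_zero, sub_sub_cancel, ← dot_smul, ← dot_smul]
    rfl
  have hK1 : K t₁ = 0 := by
    simp only [hKdef, hBdef]
    rw [hΦ.2.1, zero_sub, neg_eq_zero]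
    exact Finset.sum_eq_zero fun i hi => by rw [(hvan i (Finset.mem_range.1 hi)).1, dot_zero]
  have hK2 : K t₂ = 0 := by
    simp only [hKdef, hBdef]
    rw [hvar, zero_sub, neg_eq_zero]
    exact Finset.sum_eq_zero fun i hi => by rw [(hvan i (Finset.mem_range.1 hi)).2, dot_zero]
  have hpos : ∀ t ∈ I, 0 ≤ deriv I K t := fun t htI => by
    obtain ⟨x, y, hx, hy, hxy, -⟩ := exists_rep_lt ht
    obtain ⟨z, hz, hzxy⟩ := exists_rep_mem_Icc hx hy hxy htI
    obtain ⟨w, hw⟩ := exists_rep' (e t)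
    rw [hKd t htI]
    refine le_of_rep .zero (((hz.sub hx).pow m).mul (((hy.sub hz).pow m).mul (hw.dot hw)))
      fun ε => ?_
    exact mul_nonneg (pow_nonneg (sub_nonneg.2 (hzxy ε).1) m)
      (mul_nonneg (pow_nonneg (sub_nonneg.2 (hzxy ε).2) m) real_inner_self_nonneg)
  have hK0 : ∀ t ∈ I, K t = 0 := fun t htI => le_antisymm'
    (hK2 ▸ monotone_of_deriv_nonneg ht hK hpos htI h2I htI.2)
    (hK1 ▸ monotone_of_deriv_nonneg ht hK hpos h1I htI htI.1)
  have hprod : ∀ t ∈ I, c₁ t ^ m * (c₂ t ^ m * dot (e t) (e t)) = 0 := fun t htI => by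
    rw [← hKd t htI, deriv_congr hK0, deriv_const I _ hI htI]
  have hu₁ : ∀ t ∈ I, IsUnit (deriv I c₁ t) := fun t htI => by
    rw [deriv_sub (Smooth.id I) (Smooth.const I t₁) hI htI, deriv_id I hI htI,
      deriv_const I _ hI htI, sub_zero]
    exact isUnit_one
  have hu₂ : ∀ t ∈ I, IsUnit (deriv I c₂ t) := fun t htI => by
    rw [deriv_sub (Smooth.const I t₂) (Smooth.id I) hI htI, deriv_id I hI htI,
      deriv_const I _ hI htI, zero_sub]
    exact isUnit_one.neg
  intro t htI
  exact eq_zero_of_dot_self (eq_zero_of_pow_mul_eq_zero hI hc₂ hu₂ (he.dot he) m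
    (eq_zero_of_pow_mul_eq_zero hI hc₁ hu₁ ((hc₂.pow m).mul (he.dot he)) m hprod) t htI)

end EulerLagrange

/-! ### Prolonged transformations -/

section Transformations

open Gen

variable {ρ : Gauge} {d m : ℕ} {t₁ t₂ : Gen ρ ℝ} {P T' : Set (Gen ρ ℝ)} {S' : Set (Gen ρ (Space d))}
  {τ : Gen ρ ℝ → Gen ρ ℝ → Gen ρ ℝ} {σ : Gen ρ ℝ → Gen ρ (Space d) → Gen ρ (Space d)}
  {q : Gen ρ ℝ → Gen ρ (Space d)}

namespace IsOneParamGroup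

variable {E : Type*} [NormedAddCommGroup E] [NormedSpace ℝ E] {D : Set (Gen ρ E)}
  {ψ : Gen ρ ℝ → Gen ρ E → Gen ρ E}

theorem admissible_par (h : IsOneParamGroup P D ψ) : IsAdmissible P (1 : ℝ) :=
  h.open_par.isAdmissible 1

theorem smooth_partialPar (h : IsOneParamGroup P D ψ) : Smooth D (partialPar P D ψ 0) :=
  smooth_slice_right (h.gsf.smooth.dirDeriv (h.admissible_par.prod_left D)) h.zero_mem

theorem admissible_time (h : IsOneParamGroup P T' τ) : IsAdmissible T' (1 : ℝ) :=
  h.open_dom.isAdmissible 1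

theorem deriv_eq_partialTime (h : IsOneParamGroup P T' τ) {s t : Gen ρ ℝ} (hs : s ∈ P)
    (ht : t ∈ T') : deriv T' (τ s) t = partialTime P T' τ s t := by
  have := dirDeriv_slice_right h.gsf.smooth h.admissible_time hs ht
  simp only [fst_pair, snd_pair] at this
  exact this

/-- `∂τ/∂t` is invertible, by the chain rule for `τ(s,·)` and its inverse. -/
theorem isUnit_partialTime (h : IsOneParamGroup P T' τ) {s t : Gen ρ ℝ} (hs : s ∈ P)
    (ht : t ∈ T') : IsUnit (partialTime P T' τ s t) := by
  obtain ⟨hψ, φ, hφ, hleft, -⟩ := h.diffeo s hs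
  obtain ⟨Dφ, hDφ⟩ := hφ.smooth.exists_hasTotalDeriv
  have hT := h.admissible_time
  have h1 := hDφ.dirDeriv_comp hψ.smooth hψ.1 hT ht
  rw [dirDeriv_congr hleft, dirDeriv_id T' hT ht] at h1
  change (1 : Gen ρ ℝ) = app _ (deriv T' (τ s) t) at h1
  rw [h.deriv_eq_partialTime hs ht] at h1
  obtain ⟨A, hA⟩ := exists_rep' (Dφ (τ s t))
  obtain ⟨x, hx⟩ := exists_rep' (partialTime P T' τ s t)
  refine IsUnit.of_mul_eq_one (app (Dφ (τ s t)) 1) ?_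
  refine Eq.trans ?_ h1.symm
  refine (hx.mul (hA.app .one)).eq_of_eventuallyEq (hA.app hx) (.of_forall fun ε => ?_)
  have : A ε (x ε) = A ε (x ε • 1) := by rw [smul_eq_mul, mul_one]
  beta_reduce
  rw [this, map_smul, smul_eq_mul]

theorem partialTime_zero (h : IsOneParamGroup P T' τ) {t : Gen ρ ℝ} (ht : t ∈ T') :
    partialTime P T' τ 0 t = 1 := by
  rw [← h.deriv_eq_partialTime h.zero_mem ht, deriv_congr h.zero, deriv_id T' h.admissible_time ht]

/-- `∂/∂s ∂τ/∂t = d/dt ∂τ/∂s` at `s = 0`. -/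
theorem dirDeriv_partialTime (h : IsOneParamGroup P T' τ) {t : Gen ρ ℝ} (ht : t ∈ T') :
    dirDeriv (prod P T') (fun z => partialTime P T' τ (fst z) (snd z)) (const ρ (1, 0)) (pair 0 t) =
      deriv T' (fun r => partialPar P T' τ 0 r) t := by
  have hs := h.admissible_par.prod_left T'
  have ht' := h.admissible_time.prod_right P
  simp only [partialTime, pair_eta]
  refine (dirDeriv_comm h.gsf.smooth ht' hs (pair_mem_prod h.zero_mem ht)).trans ?_
  exact (dirDeriv_slice_right (h.gsf.smooth.dirDeriv hs) h.admissible_time h.zero_mem ht).symm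

end IsOneParamGroup

/-- A path `q` in `S'` on `[t₁,t₂]`, together with one-parameter groups `τ` on `T' ⊆ [t₁,t₂]` and
`σ` on `S'` with the same parameter set `P`. -/
structure IsTransformedPath (t₁ t₂ : Gen ρ ℝ) (P T' : Set (Gen ρ ℝ)) (S' : Set (Gen ρ (Space d)))
    (τ : Gen ρ ℝ → Gen ρ ℝ → Gen ρ ℝ) (σ : Gen ρ ℝ → Gen ρ (Space d) → Gen ρ (Space d))
    (q : Gen ρ ℝ → Gen ρ (Space d)) : Prop where
  lt : t₁ < t₂
  subset : T' ⊆ Icc t₁ t₂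
  time : IsOneParamGroup P T' τ
  space : IsOneParamGroup P S' σ
  path : IsGSF (Icc t₁ t₂) S' q

namespace IsTransformedPath

theorem mapsTo_snd (h : IsTransformedPath t₁ t₂ P T' S' τ σ q) :
    Set.MapsTo (fun z : Gen ρ (ℝ × ℝ) => snd z) (prod P T') (Icc t₁ t₂) :=
  fun _ hz => h.subset hz.2

theorem smooth_iterDeriv (h : IsTransformedPath t₁ t₂ P T' S' τ σ q) (i : ℕ) :
    Smooth T' (iterDeriv (Icc t₁ t₂) i q) :=
  (h.path.smooth.iterDeriv (isAdmissible_Icc h.lt) i).mono h.subset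

theorem deriv_iterDeriv (h : IsTransformedPath t₁ t₂ P T' S' τ σ q) (i : ℕ) {t : Gen ρ ℝ}
    (ht : t ∈ T') :
    deriv T' (iterDeriv (Icc t₁ t₂) i q) t = iterDeriv (Icc t₁ t₂) (i + 1) q t := by
  have hI := isAdmissible_Icc h.lt
  rw [iterDeriv_succ,
    deriv_mono (h.path.smooth.iterDeriv hI i) h.subset hI h.time.admissible_time ht]

theorem smooth_partialTime (h : IsTransformedPath t₁ t₂ P T' S' τ σ q) :
    Smooth (prod P T') (fun z => partialTime P T' τ (fst z) (snd z)) := by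
  simp only [partialTime, pair_eta]
  exact h.time.gsf.smooth.dirDeriv (h.time.admissible_time.prod_right P)

theorem deriv_transDeriv {i : ℕ} (h : IsTransformedPath t₁ t₂ P T' S' τ σ q)
    (hX : Smooth (prod P T') fun z => transDeriv P T' τ σ q i (fst z) (snd z)) {s t : Gen ρ ℝ}
    (hs : s ∈ P) (ht : t ∈ T') :
    deriv T' (fun r => transDeriv P T' τ σ q i s r) t = dirDeriv (prod P T')
      (fun z => transDeriv P T' τ σ q i (fst z) (snd z)) (const ρ (0, 1)) (pair s t) := by
  have := dirDeriv_slice_right hX h.time.admissible_time hs ht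
  simp only [fst_pair, snd_pair] at this
  exact this

theorem smooth_transDeriv (h : IsTransformedPath t₁ t₂ P T' S' τ σ q) (i : ℕ) :
    Smooth (prod P T') (fun z => transDeriv P T' τ σ q i (fst z) (snd z)) := by
  induction i with
  | zero =>
    have h1 := h.space.gsf.smooth.comp (X := prod P T') (f := fun z => pair (fst z) (q (snd z)))
      ((Smooth.fst _).pair (h.path.smooth.comp (Smooth.snd _) h.mapsTo_snd))
      fun z hz => pair_mem_prod hz.1 (h.path.1 (h.mapsTo_snd hz))
    simp only [fst_pair, snd_pair] at h1
    exact h1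
  | succ i ih =>
    refine ((h.smooth_partialTime.inverse fun z hz => h.time.isUnit_partialTime hz.1 hz.2).smul
      (ih.dirDeriv (h.time.admissible_time.prod_right P))).congr fun z hz => ?_
    rw [transDeriv, h.deriv_transDeriv ih hz.1 hz.2, pair_eta]

/-- The recursion that defines the prolongation, without division. -/
theorem dirDeriv_transDeriv (h : IsTransformedPath t₁ t₂ P T' S' τ σ q) (i : ℕ)
    {z : Gen ρ (ℝ × ℝ)} (hz : z ∈ prod P T') :
    dirDeriv (prod P T') (fun z => transDeriv P T' τ σ q i (fst z) (snd z)) (const ρ (0, 1)) z =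
      partialTime P T' τ (fst z) (snd z) • transDeriv P T' τ σ q (i + 1) (fst z) (snd z) := by
  rw [transDeriv, smul_smul, Ring.mul_inverse_cancel _ (h.time.isUnit_partialTime hz.1 hz.2),
    one_smul, h.deriv_transDeriv (h.smooth_transDeriv i) hz.1 hz.2, pair_eta]

theorem transDeriv_zero (h : IsTransformedPath t₁ t₂ P T' S' τ σ q) (i : ℕ) :
    ∀ t ∈ T', transDeriv P T' τ σ q i 0 t = iterDeriv (Icc t₁ t₂) i q t := by
  induction i with
  | zero => exact fun t ht => h.space.zero _ (h.path.1 (h.subset ht))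
  | succ i ih =>
    intro t ht
    rw [transDeriv, h.time.partialTime_zero ht, Ring.inverse_one, one_smul, deriv_congr ih,
      h.deriv_iterDeriv i ht]

/-- The generators are the derivatives of the prolonged transformations at `s = 0`. -/
theorem dirDeriv_transDeriv_zero (h : IsTransformedPath t₁ t₂ P T' S' τ σ q) (i : ℕ) :
    ∀ t ∈ T', dirDeriv (prod P T') (fun z => transDeriv P T' τ σ q i (fst z) (snd z))
      (const ρ (1, 0)) (pair 0 t) = generator t₁ t₂ P T' S' τ σ q i t := by
  have hadm := h.time.admissible_par.prod_left T'
  have hadm' := h.time.admissible_time.prod_right P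
  have h0 := h.time.zero_mem
  induction i with
  | zero =>
    intro t ht
    have hq := h.path.1 (h.subset ht)
    rw [← dirDeriv_slice_left (h.smooth_transDeriv 0) h.time.admissible_par h0 ht]
    have h1 := dirDeriv_slice_left h.space.gsf.smooth h.space.admissible_par h0 hq
    simp only [fst_pair, snd_pair] at h1 ⊢
    exact h1
  | succ i ih =>
    intro t ht
    have hX := h.smooth_transDeriv i
    have hX' := h.smooth_transDeriv (i + 1)
    have hz : pair (0 : Gen ρ ℝ) t ∈ prod P T' := pair_mem_prod h0 ht
    have h1 : deriv T' (generator t₁ t₂ P T' S' τ σ q i) t =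
        dirDeriv (prod P T') (fun z => transDeriv P T' τ σ q (i + 1) (fst z) (snd z))
          (const ρ (1, 0)) (pair 0 t) +
        deriv T' (fun r => partialPar P T' τ 0 r) t • iterDeriv (Icc t₁ t₂) (i + 1) q t := by
      rw [← deriv_congr ih]
      refine (dirDeriv_slice_right (hX.dirDeriv hadm) h.time.admissible_time h0 ht).trans ?_
      rw [dirDeriv_comm hX hadm hadm' hz, dirDeriv_congr (fun z hz => h.dirDeriv_transDeriv i hz),
        dirDeriv_smul h.smooth_partialTime hX' hadm hz, h.time.dirDeriv_partialTime ht]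
      simp only [fst_pair, snd_pair]
      rw [h.time.partialTime_zero ht, one_smul, h.transDeriv_zero (i + 1) t ht]
    rw [generator, h1, add_sub_cancel_right]

theorem smooth_generator (h : IsTransformedPath t₁ t₂ P T' S' τ σ q) (i : ℕ) :
    Smooth T' (generator t₁ t₂ P T' S' τ σ q i) :=
  (smooth_slice_right ((h.smooth_transDeriv i).dirDeriv (h.time.admissible_par.prod_left T'))
    h.time.zero_mem).congr (h.dirDeriv_transDeriv_zero i)

/-- The infinitesimal form of the invariance of `J`, obtained by differentiating at `s = 0`. -/
theorem infinitesimal_invariance (h : IsTransformedPath t₁ t₂ P T' S' τ σ q)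
    {L : Gen ρ (Jet d m) → Gen ρ ℝ} {DL : Gen ρ (Jet d m) → Gen ρ (Jet d m →L[ℝ] ℝ)}
    (hDL : HasTotalDeriv (jetDomain d m t₁ t₂) L DL)
    (hinv : ∀ s ∈ P, ∀ t ∈ T', L (jet m t₁ t₂ q t) =
      L (pair (τ s t) (tuple fun i : Fin (m + 1) => transDeriv P T' τ σ q i s t)) *
        partialTime P T' τ s t) {t : Gen ρ ℝ} (ht : t ∈ T') :
    L (jet m t₁ t₂ q t) * deriv T' (fun r => partialPar P T' τ 0 r) t +
      (partialPar P T' τ 0 t * app (DL (jet m t₁ t₂ q t)) (const ρ (1, 0)) +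
        ∑ i ∈ Finset.range (m + 1), dot (gradL t₁ t₂ L i (jet m t₁ t₂ q t))
          (generator t₁ t₂ P T' S' τ σ q i t)) = 0 := by
  have hadm := h.time.admissible_par.prod_left T'
  have hz : pair (0 : Gen ρ ℝ) t ∈ prod P T' := pair_mem_prod h.time.zero_mem ht
  have hjet : jet m t₁ t₂ q t = pair (τ (fst (pair (0 : Gen ρ ℝ) t)) (snd (pair (0 : Gen ρ ℝ) t)))
      (tuple fun i : Fin (m + 1) =>
        transDeriv P T' τ σ q i (fst (pair (0 : Gen ρ ℝ) t)) (snd (pair (0 : Gen ρ ℝ) t))) := by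
    simp only [fst_pair, snd_pair, jet]
    rw [h.time.zero t ht]
    exact congrArg _ (congrArg _ (funext fun i => (h.transDeriv_zero i t ht).symm))
  have hmaps : Set.MapsTo (fun z => τ (fst z) (snd z)) (prod P T') (Icc t₁ t₂) :=
    fun z hz => h.subset (h.time.gsf.1 hz)
  have hLτ := smooth_comp_pair_tuple hDL.smooth h.time.gsf.smooth hmaps
    (y := fun i z => transDeriv P T' τ σ q i (fst z) (snd z)) fun i _ => h.smooth_transDeriv i
  have h1 : dirDeriv (prod P T') (fun z => L (jet m t₁ t₂ q (snd z))) (const ρ (1, 0))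
      (pair 0 t) = 0 := by
    have hs : Smooth (prod P T') (fun z => L (jet m t₁ t₂ q (snd z))) :=
      (smooth_jet_comp hDL.smooth h.lt h.path.smooth).comp (Smooth.snd _) h.mapsTo_snd
    rw [← dirDeriv_slice_left hs h.time.admissible_par h.time.zero_mem ht]
    simp only [snd_pair]
    exact dirDeriv_const P _ h.time.admissible_par h.time.zero_mem
  rw [dirDeriv_congr (fun z hz => hinv _ hz.1 _ hz.2),
    dirDeriv_mul hLτ h.smooth_partialTime hadm hz, h.time.dirDeriv_partialTime ht,
    dirDeriv_lagrangian hDL (y := fun i z => transDeriv P T' τ σ q i (fst z) (snd z))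
      h.time.gsf.smooth hmaps (fun i _ => h.smooth_transDeriv i) hadm hz hjet, ← hjet] at h1
  simp only [fst_pair, snd_pair] at h1
  rw [h.time.partialTime_zero ht, mul_one] at h1
  simp only [h.dirDeriv_transDeriv_zero _ t ht] at h1
  exact h1

/-! ### The Noether charge -/

theorem smooth_noetherCharge (h : IsTransformedPath t₁ t₂ P T' S' τ σ q)
    {L : Gen ρ (Jet d m) → Gen ρ ℝ} (hL : Smooth (jetDomain d m t₁ t₂) L) :
    Smooth T' (noetherCharge t₁ t₂ L P T' S' τ σ q) := by
  have hφ : ∀ i, Smooth T' (momentum t₁ t₂ L i q) := fun i =>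
    (smooth_momentum hL h.lt h.path.smooth i).mono h.subset
  exact (Smooth.sum _ fun i _ => (hφ (i + 1)).dot (h.smooth_generator i)).add
    ((((smooth_jet_comp hL h.lt h.path.smooth).mono h.subset).sub
      (Smooth.sum _ fun i _ => (hφ (i + 1)).dot (h.smooth_iterDeriv (i + 1)))).mul
        h.time.smooth_partialPar)

/-- Along an extremal, summation by parts turns the derivative of the charge into the infinitesimal
invariance identity, up to a multiple of the momentum of order `0`, which vanishes. -/
theorem deriv_noetherCharge (h : IsTransformedPath t₁ t₂ P T' S' τ σ q)
    {L : Gen ρ (Jet d m) → Gen ρ ℝ} (hL : Smooth (jetDomain d m t₁ t₂) L)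
    (hinv : IsInvariant t₁ t₂ L P T' S' τ σ) (hext : IsWeakExtremal t₁ t₂ L q) {t : Gen ρ ℝ}
    (ht : t ∈ T') : deriv T' (noetherCharge t₁ t₂ L P T' S' τ σ q) t = 0 := by
  obtain ⟨DL, hDL⟩ := hL.exists_hasTotalDeriv
  have hT := h.time.admissible_time
  have hφ : ∀ i, Smooth T' (momentum t₁ t₂ L i q) := fun i =>
    (smooth_momentum hL h.lt h.path.smooth i).mono h.subset
  have hq := h.smooth_iterDeriv
  have hη := h.smooth_generator
  have hLj := (smooth_jet_comp hL h.lt h.path.smooth).mono h.subset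
  have hζ := h.time.smooth_partialPar
  have hsq : Smooth T' (fun t => ∑ i ∈ Finset.range m,
      dot (momentum t₁ t₂ L (i + 1) q t) (iterDeriv (Icc t₁ t₂) (i + 1) q t)) :=
    Smooth.sum _ fun i _ => (hφ (i + 1)).dot (hq (i + 1))
  have hsη : Smooth T' (fun t => ∑ i ∈ Finset.range m,
      dot (momentum t₁ t₂ L (i + 1) q t) (generator t₁ t₂ P T' S' τ σ q i t)) :=
    Smooth.sum _ fun i _ => (hφ (i + 1)).dot (hη i)
  have hEL := hext.momentum_zero hL h.lt t (h.subset ht)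
  have hLd : deriv T' (fun t => L (jet m t₁ t₂ q t)) t =
      1 * app (DL (jet m t₁ t₂ q t)) (const ρ (1, 0)) + ∑ i ∈ Finset.range (m + 1),
        dot (gradL t₁ t₂ L i (jet m t₁ t₂ q t)) (iterDeriv (Icc t₁ t₂) (i + 1) q t) := by
    have h1 := dirDeriv_lagrangian hDL (Smooth.id T') (fun t ht => h.subset ht)
      (y := fun i => iterDeriv (Icc t₁ t₂) i q) (fun i _ => hq i) hT ht
      (z := jet m t₁ t₂ q t) rfl
    rw [dirDeriv_id T' hT ht] at h1
    refine h1.trans (congrArg _ (Finset.sum_congr rfl fun i _ => congrArg _ ?_))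
    exact h.deriv_iterDeriv i ht
  have hqd := deriv_sum_dot_momentum hL h.lt h.path.smooth h.subset hT
    (ξ := fun i => iterDeriv (Icc t₁ t₂) (i + 1) q) (fun i _ => hq (i + 1)) ht
  have hηd := deriv_sum_dot_momentum hL h.lt h.path.smooth h.subset hT
    (ξ := generator t₁ t₂ P T' S' τ σ q) (fun i _ => hη i) ht
  have hq0 : ∑ i ∈ Finset.range m, dot (momentum t₁ t₂ L (i + 1) q t)
      (deriv T' (iterDeriv (Icc t₁ t₂) (i + 1) q) t - iterDeriv (Icc t₁ t₂) (i + 1 + 1) q t) = 0 :=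
    Finset.sum_eq_zero fun i _ => by rw [h.deriv_iterDeriv _ ht, sub_self, dot_zero]
  have hη0 : ∑ i ∈ Finset.range m, dot (momentum t₁ t₂ L (i + 1) q t)
      (deriv T' (generator t₁ t₂ P T' S' τ σ q i) t - generator t₁ t₂ P T' S' τ σ q (i + 1) t) =
      deriv T' (partialPar P T' τ 0) t * ∑ i ∈ Finset.range m,
        dot (momentum t₁ t₂ L (i + 1) q t) (iterDeriv (Icc t₁ t₂) (i + 1) q t) := by
    rw [Finset.mul_sum]
    refine Finset.sum_congr rfl fun i _ => ?_
    rw [generator, sub_sub_cancel, dot_smul]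
  rw [hEL, zero_dot, sub_zero] at hqd hηd
  rw [hq0, add_zero] at hqd
  rw [hη0] at hηd
  have hI := h.infinitesimal_invariance hDL (hinv q h.path hext) ht
  have hC : deriv T' (noetherCharge t₁ t₂ L P T' S' τ σ q) t = _ :=
    deriv_add hsη ((hLj.sub hsq).mul hζ) hT ht
  rw [hC, deriv_mul (hLj.sub hsq) hζ hT ht, deriv_sub hLj hsq hT ht, hLd, hqd, hηd]
  linear_combination hI

end IsTransformedPath

end Transformations

end GSF

theorem mainTheorem2 (ρ : GSF.Gauge) (d m : ℕ) (hm : 0 < m)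
    (t₁ t₂ : GSF.Gen ρ ℝ) (ht : t₁ < t₂)
    (L : GSF.Gen ρ (GSF.Jet d m) → GSF.Gen ρ ℝ)
    (hL : GSF.IsGSF (GSF.jetDomain d m t₁ t₂) Set.univ L)
    (P T' : Set (GSF.Gen ρ ℝ)) (S' : Set (GSF.Gen ρ (GSF.Space d)))
    (hT' : T' ⊆ GSF.Gen.Icc t₁ t₂)
    (τ : GSF.Gen ρ ℝ → GSF.Gen ρ ℝ → GSF.Gen ρ ℝ)
    (σ : GSF.Gen ρ ℝ → GSF.Gen ρ (GSF.Space d) → GSF.Gen ρ (GSF.Space d))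
    (hτ : GSF.IsOneParamGroup P T' τ) (hσ : GSF.IsOneParamGroup P S' σ)
    (hinv : GSF.IsInvariant t₁ t₂ L P T' S' τ σ) :
    ∀ q : GSF.Gen ρ ℝ → GSF.Gen ρ (GSF.Space d), GSF.IsGSF (GSF.Gen.Icc t₁ t₂) S' q →
      GSF.IsGSF T' Set.univ (GSF.noetherCharge t₁ t₂ L P T' S' τ σ q) ∧
      (GSF.IsWeakExtremal t₁ t₂ L q →
        ∀ t ∈ T', GSF.deriv T' (GSF.noetherCharge t₁ t₂ L P T' S' τ σ q) t = 0) := by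
  intro q hq
  have h : GSF.IsTransformedPath t₁ t₂ P T' S' τ σ q := ⟨ht, hT', hτ, hσ, hq⟩
  exact ⟨(h.smooth_noetherCharge hL.smooth).isGSF,
    fun hext t htT => h.deriv_noetherCharge hL.smooth hinv hext htT⟩
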